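/- Let $\mathcal L$ be a compact connected Riemann surface and $\lambda:\mathcal L\to\mathbb{CP}^1$ a meromorphic function whose poles are exactly the $m+1$ distinct points $\infty_0,\dots,\infty_m$, the pole at $\infty_i$ having order $n_i+1\ge 1$, and whose finite ramification points are simple and lie over pairwise distinct branch points. Near $\infty_i$ use a local parameter $x_i=\lambda^{-1/(n_i+1)}$ on a small coordinate disc; the discs are pairwise disjoint. Fix $z\in\mathbb C\setminus\{0\}$. Let $\mathcal L^z$ be the surface with boundary obtained from $\mathcal L\setminus\{\infty_0,\dots,\infty_m\}$ by replacing every $\infty_i$ by its circle of directions (real oriented blow-up) and keeping of this circle only the $n_i+1$ open arcs on which $\pi/2<\arg\{z\lambda\}<3\pi/2$. Its boundary $\partial\mathcal L^z$ is the union of these arcs. Put $\Lambda^*(z)=H_1(\mathcal L^z,\partial\mathcal L^z;\mathbb C)$ (relative singular homology). For every $i$ choose one of the arcs at $\infty_i$ and number the arcs at $\infty_i$ by $0,1,\dots,n_i$ counterclockwise around $\infty_i$, starting with the chosen arc. Consider the following contours. 1. Closed curves $a_1,\dots,a_g,b_1,\dots,b_g$ in $\mathcal L\setminus\{\infty_0,\dots,\infty_m\}$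 whose classes form a basis of $H_1(\mathcal L;\mathbb Z)$ (for instance a canonical homology basis), where $g$ is the genus of $\mathcal L$. 2. For $i=1,\dots,m$, a circle $\mathcal V_i$ $\{|x_i|=\rho_i\}$ in the coordinate disc, going once counterclockwise around $\infty_i$. 3. For $i=1,\dots,m$, a path $\mathcal W_{0i}(z)$ in $\mathcal L^z$ from a point of arc number $0$ at $\infty_0$ to a point of arc number $0$ at $\infty_i$. 4. For $i=0,\dots,m$ and $\alpha=1,\dots,n_i$, a path $\mathcal T_{i;\alpha}(z)$ in $\mathcal L^z$ which stays in the blown-up coordinate disc of $\infty_i$, starts at a point of arc number $\alpha-1$ at $\infty_i$, turns counterclockwise around $\infty_i$ to the next arc, number $\alpha$, and ends at a point of that arc; that is, a continuous choice of $\arg x_i$ along the path moves from the sector of the arc $\alpha-1$ to the adjacent sector of the arc $\alpha$. Then the classes of these $n=2g+2m+\sum_{i=0}^m n_i$ contours form a basis of the complex vector space $\Lambda^*(z)$. -/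

import Mathlib

open scoped Manifold ContDiff

noncomputable section

/-! ### Singular homology of a pair in degree one -/

namespace SingularPair

/-- Singular `k`-simplices of `X`. -/
abbrev Simp (k : ℕ) (X : Type*) [TopologicalSpace X] := C(stdSimplex ℝ (Fin (k + 1)), X)

/-- Singular `k`-chains with coefficients in `R`: the free `R`-module on the singular simplices. -/
abbrev Chain (R : Type*) [CommRing R] (k : ℕ) (X : Type*) [TopologicalSpace X] :=
  Simp k X →₀ R

/-- The inclusion of the face of the standard simplex opposite to the vertex `i`. -/
def faceMap (k : ℕ) (i : Fin (k + 2)) :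
    C(stdSimplex ℝ (Fin (k + 1)), stdSimplex ℝ (Fin (k + 2))) :=
  ⟨stdSimplex.map i.succAbove, stdSimplex.continuous_map _⟩

/-- The singular boundary operator, `∂σ = ∑ i, (-1)^i σ ∘ δ_i`. -/
def boundary (R : Type*) [CommRing R] (k : ℕ) (X : Type*) [TopologicalSpace X] :
    Chain R (k + 1) X →ₗ[R] Chain R k X :=
  Finsupp.linearCombination R fun σ : Simp (k + 1) X =>
    ∑ i : Fin (k + 2), Finsupp.single (σ.comp (faceMap k i)) ((-1 : R) ^ (i : ℕ))

/-- The chains of `X` all of whose simplices lie in the subset `A`. -/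
def chainsIn (R : Type*) [CommRing R] (k : ℕ) {X : Type*} [TopologicalSpace X] (A : Set X) :
    Submodule R (Chain R k X) :=
  Finsupp.supported R R {σ : Simp k X | Set.range σ ⊆ A}

/-- Relative singular `1`-cycles: the `1`-chains of `X` whose boundary is a chain of `A`. -/
def relCycles (R : Type*) [CommRing R] {X : Type*} [TopologicalSpace X] (A : Set X) :
    Submodule R (Chain R 1 X) :=
  (chainsIn R 0 A).comap (boundary R 0 X)

/-- Relative singular `1`-boundaries: sums of a boundary in `X` and a `1`-chain of `A`. -/
def relBoundaries (R : Type*) [CommRing R] {X : Type*} [TopologicalSpace X] (A : Set X) :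
    Submodule R (Chain R 1 X) :=
  LinearMap.range (boundary R 1 X) ⊔ chainsIn R 1 A

/-- The first relative singular homology `H₁(X, A; R)`, the quotient of the relative cycles by the
relative boundaries, formed inside the quotient of all `1`-chains by the relative boundaries.
For `A = ∅` it is `H₁(X; R)`. -/
abbrev H1 (R : Type*) [CommRing R] (X : Type*) [TopologicalSpace X] (A : Set X) :=
  (relCycles R A).map (relBoundaries R A).mkQ

/-- A path regarded as a singular `1`-simplex. -/
def pathSimp {X : Type*} [TopologicalSpace X] {p q : X} (γ : Path p q) : Simp 1 X :=
  γ.toContinuousMap.comp (toContinuousMap stdSimplexHomeomorphUnitInterval)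

/-- A point regarded as a singular `0`-simplex. -/
def pointSimp {X : Type*} [TopologicalSpace X] (p : X) : Simp 0 X := ContinuousMap.const _ p

lemma pathSimp_face {X : Type*} [TopologicalSpace X] {p q : X} (γ : Path p q) :
    (pathSimp γ).comp (faceMap 0 0) = pointSimp q ∧
      (pathSimp γ).comp (faceMap 0 1) = pointSimp p := by
  have hv : ∀ s : stdSimplex ℝ (Fin 1), s = stdSimplex.vertex 0 := fun s => by
    apply stdSimplex.ext
    funext i
    fin_cases i
    simp
  constructor
  · ext s
    rw [hv s]
    simp only [pathSimp, faceMap, pointSimp, ContinuousMap.comp_apply, ContinuousMap.coe_mk,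
      stdSimplex.map_vertex, ContinuousMap.const_apply]
    change γ (stdSimplexHomeomorphUnitInterval (stdSimplex.vertex 1)) = q
    rw [show stdSimplexHomeomorphUnitInterval (stdSimplex.vertex 1) = 1 from
      stdSimplexHomeomorphUnitInterval_one]
    exact γ.target
  · ext s
    rw [hv s]
    simp only [pathSimp, faceMap, pointSimp, ContinuousMap.comp_apply, ContinuousMap.coe_mk,
      stdSimplex.map_vertex, ContinuousMap.const_apply]
    change γ (stdSimplexHomeomorphUnitInterval (stdSimplex.vertex 0)) = p
    rw [show stdSimplexHomeomorphUnitInterval (stdSimplex.vertex 0) = 0 from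
      stdSimplexHomeomorphUnitInterval_zero]
    exact γ.source

lemma boundary_path (R : Type*) [CommRing R] {X : Type*} [TopologicalSpace X] {p q : X}
    (γ : Path p q) :
    boundary R 0 X (Finsupp.single (pathSimp γ) 1) =
      Finsupp.single (pointSimp q) 1 - Finsupp.single (pointSimp p) 1 := by
  simp only [boundary, Finsupp.linearCombination_single, one_smul]
  rw [Fin.sum_univ_two, (pathSimp_face γ).1, (pathSimp_face γ).2]
  simp [sub_eq_add_neg]

/-- The class in `H₁(X, A; R)` of a closed path of `X`. -/
def loopClass (R : Type*) [CommRing R] {X : Type*} [TopologicalSpace X] (A : Set X) {p : X}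
    (γ : Path p p) : H1 R X A :=
  ⟨(relBoundaries R A).mkQ (Finsupp.single (pathSimp γ) 1), Submodule.mem_map_of_mem <| by
    rw [relCycles, Submodule.mem_comap, boundary_path, sub_self]
    exact Submodule.zero_mem _⟩

/-- The class in `H₁(X, A; R)` of a path of `X` with both end points in `A`. -/
def pathClass (R : Type*) [CommRing R] {X : Type*} [TopologicalSpace X] (A : Set X) {p q : X}
    (hp : p ∈ A) (hq : q ∈ A) (γ : Path p q) : H1 R X A :=
  ⟨(relBoundaries R A).mkQ (Finsupp.single (pathSimp γ) 1), Submodule.mem_map_of_mem <| by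
    have key : ∀ x ∈ A, Finsupp.single (pointSimp x) (1 : R) ∈ chainsIn R 0 A := by
      intro x hx
      refine Finsupp.single_mem_supported R 1 ?_
      rintro _ ⟨s, rfl⟩
      exact hx
    rw [relCycles, Submodule.mem_comap, boundary_path]
    exact Submodule.sub_mem _ (key q hq) (key p hp)⟩

end SingularPair

/-! ### Hurwitz coverings -/

/-- A point of the Hurwitz space with ramification profile `n 0, …, n m` over infinity: a
meromorphic function `fn` on the Riemann surface `L` (the values of `fn` at its poles are
irrelevant) with poles `∞_i = pole i` of order `n i + 1` and with simple, distinct finite branch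
points. At every pole we record a coordinate disc of the distinguished local parameter
`λ ^ (-1 / (n i + 1))`; the discs are small enough to be pairwise disjoint. -/
structure HurwitzCovering (L : Type*) [TopologicalSpace L] [ChartedSpace ℂ L]
    (m : ℕ) (n : Fin (m + 1) → ℕ) where
  /-- the covering map `λ`, away from its poles -/
  fn : L → ℂ
  /-- the points `∞_0, …, ∞_m` -/
  pole : Fin (m + 1) → L
  pole_injective : Function.Injective pole
  holomorphic : ∀ P, P ∉ Set.range pole → MDifferentiableAt 𝓘(ℂ) 𝓘(ℂ) fn P
  /-- the local parameter at `∞_i` -/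
  coord : Fin (m + 1) → OpenPartialHomeomorph L ℂ
  coord_mem : ∀ i, coord i ∈ IsManifold.maximalAtlas 𝓘(ℂ) ω L
  radius : Fin (m + 1) → ℝ
  radius_pos : ∀ i, 0 < radius i
  coord_target : ∀ i, (coord i).target = Metric.ball 0 (radius i)
  pole_mem : ∀ i, pole i ∈ (coord i).source
  coord_pole : ∀ i, coord i (pole i) = 0
  coord_disjoint : Pairwise fun i j => Disjoint (coord i).source (coord j).source
  fn_eq : ∀ i, ∀ P ∈ (coord i).source, P ≠ pole i → fn P = ((coord i P) ^ (n i + 1))⁻¹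
  /-- finite ramification points are simple: `dλ` has only simple zeros -/
  simple : ∀ P, P ∉ Set.range pole →
    deriv (fn ∘ (chartAt ℂ P).symm) (chartAt ℂ P P) = 0 →
    deriv (deriv (fn ∘ (chartAt ℂ P).symm)) (chartAt ℂ P P) ≠ 0
  /-- different finite ramification points lie over different branch points -/
  distinct : ∀ P Q, P ∉ Set.range pole → Q ∉ Set.range pole →
    deriv (fn ∘ (chartAt ℂ P).symm) (chartAt ℂ P P) = 0 →
    deriv (fn ∘ (chartAt ℂ Q).symm) (chartAt ℂ Q Q) = 0 → fn P = fn Q → P = Q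

namespace HurwitzCovering

variable {L : Type*} [TopologicalSpace L] [ChartedSpace ℂ L] {m : ℕ} {n : Fin (m + 1) → ℕ}
  (C : HurwitzCovering L m n)

/-- The surface `L` without the points at infinity. -/
abbrev Punctured := {P : L // P ∉ Set.range C.pole}

/-- The directions `u` at `∞_i` along which `π/2 < arg (z λ) < 3π/2`: in the local parameter,
`λ = ρ ^ (-(n i + 1)) u ^ (-(n i + 1))` at `ρ u`. -/
def arcs (_C : HurwitzCovering L m n) (z : ℂ) (i : Fin (m + 1)) : Set Circle :=
  {u | (z * ((u : ℂ) ^ (n i + 1))⁻¹).re < 0}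

/-- The points of the surface `L^z`: the punctured surface, together with those directions at the
points at infinity that belong to the open arcs `π/2 < arg (z λ) < 3π/2` of the boundary circles
of the blow-up. -/
inductive Blow (z : ℂ) : Type _
  | interior (P : C.Punctured) : Blow z
  | boundary (i : Fin (m + 1)) (u : C.arcs z i) : Blow z

/-- Polar coordinates `(ρ, u)` near the boundary circle over `∞_i`, without the closed arcs of the
circle `ρ = 0` that are left out. -/
abbrev Collar (z : ℂ) (i : Fin (m + 1)) :=
  {p : ℝ × Circle // 0 ≤ p.1 ∧ p.1 < C.radius i ∧ (p.1 = 0 → p.2 ∈ C.arcs z i)}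

lemma coord_symm_notMem (i : Fin (m + 1)) {w : ℂ} (hw : w ≠ 0) (hr : ‖w‖ < C.radius i) :
    (C.coord i).symm w ∉ Set.range C.pole := by
  have ht : w ∈ (C.coord i).target := by
    rw [C.coord_target]
    simpa using hr
  have hs := (C.coord i).map_target ht
  rintro ⟨j, hj⟩
  by_cases h : i = j
  · subst h
    apply hw
    rw [← (C.coord i).right_inv ht, ← hj, C.coord_pole]
  · refine Set.disjoint_left.1 (C.coord_disjoint h) hs ?_
    rw [← hj]
    exact C.pole_mem j

lemma norm_polar {ρ : ℝ} (h : 0 ≤ ρ) (u : Circle) : ‖(ρ : ℂ) * (u : ℂ)‖ = ρ := by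
  rw [norm_mul, Circle.norm_coe, mul_one, Complex.norm_real, Real.norm_of_nonneg h]

/-- The point of the punctured surface with local parameter `ρ u` at `∞_i`. -/
def polarPoint (i : Fin (m + 1)) (ρ : ℝ) (h0 : 0 < ρ) (hr : ρ < C.radius i) (u : Circle) :
    C.Punctured :=
  ⟨(C.coord i).symm ((ρ : ℂ) * (u : ℂ)), C.coord_symm_notMem i
    (mul_ne_zero (by exact_mod_cast h0.ne') u.coe_ne_zero) (by rwa [norm_polar h0.le])⟩

/-- The collar of the boundary circle over `∞_i` as a part of `L^z`. -/
def collarMap (z : ℂ) (i : Fin (m + 1)) (p : C.Collar z i) : C.Blow z :=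
  if h : p.1.1 = 0 then Blow.boundary i ⟨p.1.2, p.2.2.2 h⟩
  else Blow.interior (C.polarPoint i p.1.1 (lt_of_le_of_ne p.2.1 (Ne.symm h)) p.2.2.1 p.1.2)

/-- The topology of `L^z`, glued from the punctured surface and the collars: a set is open iff its
traces on the punctured surface and on all the collars are open. -/
instance instTopologicalSpaceBlow (z : ℂ) : TopologicalSpace (C.Blow z) :=
  TopologicalSpace.coinduced (fun P : C.Punctured => Blow.interior P) inferInstance ⊔
    ⨆ i, TopologicalSpace.coinduced (C.collarMap z i) inferInstance

lemma continuous_interior (z : ℂ) :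
    Continuous (fun P : C.Punctured => (Blow.interior P : C.Blow z)) :=
  continuous_iff_coinduced_le.2 le_sup_left

lemma continuous_collarMap (z : ℂ) (i : Fin (m + 1)) : Continuous (C.collarMap z i) :=
  continuous_iff_coinduced_le.2
    (le_sup_of_le_right (le_iSup (fun i => TopologicalSpace.coinduced (C.collarMap z i) _) i))

/-- The boundary `∂L^z`, a disjoint union of open arcs. -/
def bdry (z : ℂ) : Set (C.Blow z) := {x | ∃ i u, x = Blow.boundary i u}

/-- The space `Λ*(z) = H₁(L^z, ∂L^z)`, with complex coefficients. -/
abbrev LambdaStar (z : ℂ) := SingularPair.H1 ℂ (C.Blow z) (C.bdry z)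

/-- The arc number `β` at `∞_i`, in terms of the angle `θ` of the local parameter: as
`arg (z λ) = arg z - (n i + 1) θ`, these `θ` satisfy `π/2 < arg (z λ) < 3π/2` modulo `2π`.
The arcs `β` and `β + n i + 1` agree on the circle, and `β + 1` is the arc that follows `β`
counterclockwise around `∞_i`, i.e. the one on the next sheet. -/
def arcAngles (_C : HurwitzCovering L m n) (z : ℂ) (i : Fin (m + 1)) (β : ℤ) : Set ℝ :=
  Set.Ioo ((z.arg + Real.pi / 2 + 2 * Real.pi * β) / (n i + 1))
    ((z.arg + 3 * Real.pi / 2 + 2 * Real.pi * β) / (n i + 1))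

/-- The loop of radius `ρ` which encircles `∞_i` once counterclockwise. -/
def circleLoop (i : Fin (m + 1)) (ρ : ℝ) (h0 : 0 < ρ) (hr : ρ < C.radius i) :
    Path (C.polarPoint i ρ h0 hr 1) (C.polarPoint i ρ h0 hr 1) where
  toFun t := C.polarPoint i ρ h0 hr (Circle.exp (2 * Real.pi * (t : ℝ)))
  continuous_toFun := by
    refine Continuous.subtype_mk ?_ _
    refine (C.coord i).continuousOn_symm.comp_continuous (by fun_prop) fun t => ?_
    rw [C.coord_target, mem_ball_zero_iff, norm_polar h0.le]
    exact hr
  source' := by simp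
  target' := by simp

/-- The data of the contours `γ_k(z)` on a Hurwitz covering of genus `g`. -/
structure ContourSystem (g : ℕ) (z : ℂ) where
  /-- base points of the cycles `a_k` and `b_k` -/
  aBase : Fin g → C.Punctured
  bBase : Fin g → C.Punctured
  /-- the `a`- and `b`-cycles, closed curves avoiding the points at infinity -/
  a : ∀ k, Path (aBase k) (aBase k)
  b : ∀ k, Path (bBase k) (bBase k)
  /-- the cycles `a_k`, `b_k` represent a basis of the homology of the compact surface -/
  homologyBasis : ∃ B : Module.Basis (Fin g ⊕ Fin g) ℤ (SingularPair.H1 ℤ L ∅), ⇑B =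
    Sum.elim (fun k => SingularPair.loopClass ℤ ∅ ((a k).map continuous_subtype_val))
      (fun k => SingularPair.loopClass ℤ ∅ ((b k).map continuous_subtype_val))
  /-- radius of the loop around the point `∞_{i+1}` -/
  vRadius : Fin m → ℝ
  vRadius_pos : ∀ i, 0 < vRadius i
  vRadius_lt : ∀ i, vRadius i < C.radius i.succ
  /-- number of the arc at `∞_i` which lies on the first sheet (number `k_i`) at `∞_i` -/
  firstSheet : Fin (m + 1) → ℤ
  /-- directions in which the path from `∞_0` to `∞_{i+1}` leaves and arrives -/
  wStart : Fin m → C.arcs z 0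
  wEnd : ∀ i : Fin m, C.arcs z i.succ
  wStart_mem : ∀ i, ∃ θ ∈ C.arcAngles z 0 (firstSheet 0), (wStart i : Circle) = Circle.exp θ
  wEnd_mem : ∀ i : Fin m, ∃ θ ∈ C.arcAngles z i.succ (firstSheet i.succ),
    (wEnd i : Circle) = Circle.exp θ
  /-- the path from `∞_0` to `∞_{i+1}` -/
  w : ∀ i : Fin m, Path (Blow.boundary 0 (wStart i) : C.Blow z) (Blow.boundary i.succ (wEnd i))
  /-- the path which leaves `∞_i` on the sheet number `α` (counted from the first sheet at `∞_i`),
  goes counterclockwise around `∞_i` and comes back to `∞_i` on the next sheet, given by a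
  curve in polar coordinates at `∞_i` together with a continuous choice of the angle -/
  tStart : ∀ i, Fin (n i) → C.Collar z i
  tEnd : ∀ i, Fin (n i) → C.Collar z i
  t : ∀ i (α : Fin (n i)), Path (tStart i α) (tEnd i α)
  tAngle : ∀ i, Fin (n i) → C(unitInterval, ℝ)
  t_angle : ∀ i α s, (t i α s).1.2 = Circle.exp (tAngle i α s)
  tStart_radius : ∀ i α, (tStart i α).1.1 = 0
  tEnd_radius : ∀ i α, (tEnd i α).1.1 = 0
  tAngle_start : ∀ i (α : Fin (n i)),
    tAngle i α 0 ∈ C.arcAngles z i (firstSheet i + ((α : ℕ) : ℤ))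
  tAngle_end : ∀ i (α : Fin (n i)),
    tAngle i α 1 ∈ C.arcAngles z i (firstSheet i + ((α : ℕ) : ℤ) + 1)

lemma collarMap_mem_bdry (z : ℂ) (i : Fin (m + 1)) (p : C.Collar z i) (hp : p.1.1 = 0) :
    C.collarMap z i p ∈ C.bdry z := by
  rw [collarMap, dif_pos hp]
  exact ⟨i, _, rfl⟩

end HurwitzCovering

/-- Index set of the contours: the `a`-cycles, the `b`-cycles, the loops around
`∞_1, …, ∞_m`, the paths from `∞_0` to `∞_1, …, ∞_m`, and the `n i` paths from `∞_i` to itself. -/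
abbrev ContourIndex (g m : ℕ) (n : Fin (m + 1) → ℕ) :=
  (Fin g ⊕ Fin g) ⊕ (Fin m ⊕ (Fin m ⊕ (Σ i, Fin (n i))))

lemma card_contourIndex (g m : ℕ) (n : Fin (m + 1) → ℕ) :
    Fintype.card (ContourIndex g m n) = 2 * g + 2 * m + ∑ i, n i := by
  simp only [Fintype.card_sum, Fintype.card_fin, Fintype.card_sigma]
  ring

namespace HurwitzCovering

open SingularPair

variable {L : Type*} [TopologicalSpace L] [ChartedSpace ℂ L] {m : ℕ} {n : Fin (m + 1) → ℕ}
  {C : HurwitzCovering L m n}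

/-- The classes of the contours `γ_k(z)` in `Λ*(z)`. -/
def ContourSystem.contour {g : ℕ} {z : ℂ} (S : C.ContourSystem g z) :
    ContourIndex g m n → C.LambdaStar z
  | .inl (.inl k) => loopClass ℂ (C.bdry z) ((S.a k).map (C.continuous_interior z))
  | .inl (.inr k) => loopClass ℂ (C.bdry z) ((S.b k).map (C.continuous_interior z))
  | .inr (.inl i) => loopClass ℂ (C.bdry z)
      ((C.circleLoop i.succ (S.vRadius i) (S.vRadius_pos i) (S.vRadius_lt i)).map
        (C.continuous_interior z))
  | .inr (.inr (.inl i)) => pathClass ℂ (C.bdry z) ⟨_, _, rfl⟩ ⟨_, _, rfl⟩ (S.w i)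
  | .inr (.inr (.inr ⟨i, α⟩)) => pathClass ℂ (C.bdry z)
      (C.collarMap_mem_bdry z i _ (S.tStart_radius i α))
      (C.collarMap_mem_bdry z i _ (S.tEnd_radius i α))
      ((S.t i α).map (C.continuous_collarMap z i))

end HurwitzCovering

end

/-!
A functional on `Λ*(z)` is the integral of a *path cocycle*, a function on the paths of the blow-up
which is additive on triangles, and which here has to vanish on the paths in the boundary.

The contours generate: let a cocycle vanish on all of them. Its residues at `∞_1, …, ∞_m` vanish,
and so does the one at `∞_0`, because the sum of all residues is the residue at infinity of the
trace of the cocycle along `λ`, which is a cocycle on the simply connected plane. Hence the cocycle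
extends from the punctured surface to the compact one, where its periods along a homology basis
vanish, so that it is the increment of a function. This function is locally constant on the arcs,
and the contours `W` and `T` connect all arcs, so it is constant on the boundary and the functional
is zero.

The contours are independent, since each of them is detected by a cocycle: `W` and `T` by increments
of functions which are constant on the arcs, `a` and `b` by pull-backs from the compact surface, and
the circle around `∞_i` by the logarithm of a function with a zero at `∞_i` and a pole at `∞_0`.
Such a function need not exist, but its logarithm does up to constants: it can be glued
topologically along a chain of coordinate discs.
-/

noncomputable section

open Topology Filter Set SingularPair
open scoped unitInterval

/-! ### Cocycles on paths and their primitives -/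

section PathCocycle

variable {Y Z E M : Type*} [TopologicalSpace Y] [TopologicalSpace Z] [TopologicalSpace E]
  [AddCommGroup M]

/-- A `1`-cocycle on the paths of `Y`: the values on two sides of the lower triangle of a square add
up to the value on the diagonal. Such functions play the role of closed `1`-forms, and they are the
functionals on singular `1`-chains that vanish on boundaries. -/
def IsPathCocycle (ψ : C(I, Y) → M) : Prop :=
  ∀ H : C(I × I, Y), ψ ⟨fun s => H (s, 0), by fun_prop⟩ + ψ ⟨fun s => H (1, s), by fun_prop⟩ =
    ψ ⟨fun s => H (s, s), by fun_prop⟩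

/-- The exact cocycle `γ ↦ h (γ 1) - h (γ 0)`. -/
def increment (h : Y → M) (γ : C(I, Y)) : M := h (γ 1) - h (γ 0)

/-- `k` is a primitive on `K` of the pull-back of `ψ` along `e`. The curves `γ` and `η = e ∘ γ` are
separate variables because `e` is only meant to be continuous on `K`. -/
def IsPrimitiveAlong (ψ : C(I, Y) → M) (e : E → Y) (K : Set E) (k : E → M) : Prop :=
  ∀ (γ : C(I, E)) (η : C(I, Y)), (∀ t, γ t ∈ K) → (∀ t, η t = e (γ t)) → ψ η = increment k γ

/-- `h` is a primitive of `ψ` near `y`. -/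
def IsPrimitiveAt (ψ : C(I, Y) → M) (h : Y → M) (y : Y) : Prop :=
  ∃ V ∈ 𝓝 y, ∀ γ : C(I, Y), (∀ t, γ t ∈ V) → ψ γ = increment h γ

lemma isPathCocycle_increment (h : Y → M) : IsPathCocycle (increment h) := fun H => by
  simp [increment]

lemma increment_loop (h : Y → M) {p : Y} (γ : Path p p) : increment h γ.toContinuousMap = 0 := by
  simp [increment]

lemma eq_of_eventually_sub_eq [PreconnectedSpace Y] {F G : Y → M}
    (h : ∀ y, ∀ᶠ x in 𝓝 y, F x - G x = F y - G y) (x y : Y) : F x - F y = G x - G y :=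
  sub_eq_sub_iff_sub_eq_sub.1 <|
    ((IsLocallyConstant.iff_eventually_eq fun x => F x - G x).2 h).apply_eq_of_preconnectedSpace x y

namespace IsPathCocycle

variable {ψ : C(I, Y) → M} (hψ : IsPathCocycle ψ)
include hψ

lemma comp (e : C(Z, Y)) : IsPathCocycle fun γ : C(I, Z) => ψ (e.comp γ) :=
  fun H => hψ (e.comp H)

lemma const_eq_zero (y : Y) : ψ (ContinuousMap.const _ y) = 0 :=
  left_eq_add.1 (hψ (ContinuousMap.const _ y)).symm

lemma square (H : C(I × I, Y)) :
    ψ ⟨fun s => H (s, 0), by fun_prop⟩ + ψ ⟨fun s => H (1, s), by fun_prop⟩ =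
      ψ ⟨fun s => H (0, s), by fun_prop⟩ + ψ ⟨fun s => H (s, 1), by fun_prop⟩ := by
  rw [hψ H]
  exact (hψ (H.comp ⟨Prod.swap, continuous_swap⟩)).symm

/-- The square is a cone with apex `y`: this is how primitives are produced. -/
lemma eq_sub_of_cone (H : C(I × I, Y)) {y : Y} (hy : ∀ s, H (0, s) = y) :
    ψ ⟨fun s => H (1, s), by fun_prop⟩ =
      ψ ⟨fun s => H (s, 1), by fun_prop⟩ - ψ ⟨fun s => H (s, 0), by fun_prop⟩ := by
  have hconst : (⟨fun s => H (0, s), by fun_prop⟩ : C(I, Y)) = ContinuousMap.const _ y :=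
    ContinuousMap.ext hy
  rw [eq_sub_iff_add_eq', hψ.square H, hconst, hψ.const_eq_zero, zero_add]

lemma exists_isPrimitiveAlong_of_convex [AddCommGroup E] [Module ℝ E] [IsTopologicalAddGroup E]
    [ContinuousSMul ℝ E] {K : Set E} (hK : Convex ℝ K) {e : E → Y} (he : ContinuousOn e K) :
    ∃ k : E → M, IsPrimitiveAlong ψ e K k := by
  classical
  rcases K.eq_empty_or_nonempty with rfl | ⟨x₀, hx₀⟩
  · exact ⟨0, fun γ η h => absurd (h 0) (notMem_empty _)⟩
  have hmem : ∀ x ∈ K, ∀ u : I, Path.segment x₀ x u ∈ K := fun x hx u =>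
    hK.segment_subset hx₀ hx (Path.range_segment x₀ x ▸ mem_range_self u)
  have hcone : ∀ x ∈ K, Continuous fun u : I => e (Path.segment x₀ x u) := fun x hx =>
    he.comp_continuous (by fun_prop) (hmem x hx)
  refine ⟨fun x => if hx : x ∈ K then ψ ⟨_, hcone x hx⟩ else 0, fun γ η hγ hη => ?_⟩
  have hH : Continuous fun p : I × I => e (Path.segment x₀ (γ p.2) p.1) :=
    he.comp_continuous (by simp only [Path.segment_apply]; fun_prop) fun p => hmem _ (hγ _) _
  rw [increment, dif_pos (hγ 1), dif_pos (hγ 0)]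
  refine Eq.trans (congrArg ψ ?_) (hψ.eq_sub_of_cone ⟨_, hH⟩ (y := e x₀) fun s => by simp)
  ext s
  simp [hη]

lemma exists_increment_eq_comp (γ : C(I, Y)) :
    ∃ F : I → M, ∀ p : C(I, I), ψ (γ.comp p) = increment F p := by
  refine ⟨fun t => ψ (γ.comp ⟨fun s => s * t, by fun_prop⟩), fun p => ?_⟩
  have h := hψ.eq_sub_of_cone (γ.comp ⟨fun q => q.1 * p q.2, by fun_prop⟩) (y := γ 0)
    fun s => by simp
  refine Eq.trans (congrArg ψ ?_) h
  ext s
  simp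

lemma symm {x y : Y} (γ : Path x y) :
    ψ γ.symm.toContinuousMap = -ψ γ.toContinuousMap := by
  obtain ⟨F, hF⟩ := hψ.exists_increment_eq_comp γ.toContinuousMap
  have hsymm := hF ⟨σ, by fun_prop⟩
  have hid := hF (ContinuousMap.id I)
  simp only [increment, ContinuousMap.coe_mk, unitInterval.symm_zero, unitInterval.symm_one,
    ContinuousMap.id_apply] at hsymm hid
  exact hsymm.trans (by rw [← neg_sub, ← hid]; rfl)

lemma trans {x y z : Y} (γ : Path x y) (γ' : Path y z) :
    ψ (γ.trans γ').toContinuousMap = ψ γ.toContinuousMap + ψ γ'.toContinuousMap := by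
  have h := hψ ⟨fun q => γ.trans γ' ⟨(q.1 + q.2) / 2, by
    constructor <;> linarith [q.1.2.1, q.1.2.2, q.2.2.1, q.2.2.2]⟩, by fun_prop⟩
  refine Eq.trans (congrArg ψ ?_) (h.symm.trans (congrArg₂ (ψ · + ψ ·) ?_ ?_))
  · ext s
    exact congrArg (γ.trans γ') (Subtype.ext (add_self_div_two (s : ℝ)).symm)
  · ext s
    have hs : (s + (0 : I) : ℝ) / 2 ≤ 1 / 2 := by
      rw [Icc.coe_zero]
      linarith [s.2.2]
    refine (Path.trans_apply _ _ _).trans ((dif_pos hs).trans (congrArg γ (Subtype.ext ?_)))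
    simp [mul_div_cancel₀]
  · ext s
    rcases s.2.1.eq_or_lt with hs | hs
    · obtain rfl : s = 0 := Subtype.ext hs.symm
      simp [Path.trans_apply]
    · refine (Path.trans_apply _ _ _).trans ((dif_neg (not_le.2 ?_)).trans
        (congrArg γ' (Subtype.ext ?_)))
      · change (1 : ℝ) / 2 < (1 + s) / 2
        linarith
      · simp [mul_div_cancel₀]

end IsPathCocycle

section Local

variable {ψ : C(I, Y) → M} {h h' : Y → M} {y : Y}

lemma IsPrimitiveAt.eventually (hh : IsPrimitiveAt ψ h y) : ∀ᶠ x in 𝓝 y, IsPrimitiveAt ψ h x := by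
  obtain ⟨V, hV, hprim⟩ := hh
  filter_upwards [eventually_mem_nhds_iff.2 hV] with x hx
  exact ⟨V, hx, hprim⟩

lemma IsPrimitiveAt.congr_add_const (hh : IsPrimitiveAt ψ h y) (c : M)
    (heq : ∀ᶠ x in 𝓝 y, h' x = h x + c) : IsPrimitiveAt ψ h' y := by
  obtain ⟨V, hV, hprim⟩ := hh
  refine ⟨_, inter_mem hV heq, fun γ hγ => ?_⟩
  rw [hprim γ fun t => (hγ t).1, increment, increment, (hγ 1).2, (hγ 0).2,
    add_sub_add_right_eq_sub]

lemma IsPrimitiveAt.comp {e : C(Z, Y)} {z : Z} (hh : IsPrimitiveAt ψ h (e z)) :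
    IsPrimitiveAt (fun γ : C(I, Z) => ψ (e.comp γ)) (h ∘ e) z := by
  obtain ⟨V, hV, hprim⟩ := hh
  exact ⟨e ⁻¹' V, e.continuous.continuousAt.preimage_mem_nhds hV, fun γ hγ => hprim _ hγ⟩

lemma IsPrimitiveAt.eventually_sub_eq [LocallyPathConnectedSpace Y] (hh : IsPrimitiveAt ψ h y)
    (hh' : IsPrimitiveAt ψ h' y) : ∀ᶠ x in 𝓝 y, h x - h' x = h y - h' y := by
  obtain ⟨V, hV, hprim⟩ := hh
  obtain ⟨V', hV', hprim'⟩ := hh'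
  obtain ⟨W, ⟨hW, hW_conn⟩, hWV⟩ := (path_connected_basis y).mem_iff.1 (inter_mem hV hV')
  filter_upwards [hW] with x hx
  obtain ⟨γ, hγ⟩ := hW_conn.joinedIn y (mem_of_mem_nhds hW) x hx
  have heq := (hprim γ.toContinuousMap fun t => (hWV (hγ t)).1).symm.trans
    (hprim' γ.toContinuousMap fun t => (hWV (hγ t)).2)
  simpa [increment] using sub_eq_sub_iff_sub_eq_sub.1 heq

lemma IsPrimitiveAlong.eventually_sub_eq [LocallyPathConnectedSpace E] {K : Set E} {e : E → Y}
    {k : E → M} (hk : IsPrimitiveAlong ψ e K k) (he : ContinuousOn e K) {x : E} (hK : K ∈ 𝓝 x)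
    (hh : IsPrimitiveAt ψ h (e x)) : ∀ᶠ x' in 𝓝 x, k x' - h (e x') = k x - h (e x) := by
  obtain ⟨V, hV, hprim⟩ := hh
  obtain ⟨W, ⟨hW, hW_conn⟩, hWV⟩ := (path_connected_basis x).mem_iff.1
    (inter_mem hK ((he.continuousAt hK).preimage_mem_nhds hV))
  filter_upwards [hW] with x' hx'
  obtain ⟨γ, hγ⟩ := hW_conn.joinedIn x (mem_of_mem_nhds hW) x' hx'
  let η : C(I, Y) := ⟨fun t => e (γ t), he.comp_continuous γ.continuous fun t => (hWV (hγ t)).1⟩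
  have heq := (hk γ.toContinuousMap η (fun t => (hWV (hγ t)).1) fun _ => rfl).symm.trans
    (hprim η fun t => (hWV (hγ t)).2)
  exact sub_eq_sub_iff_sub_eq_sub.1 (by simpa [increment, η] using heq)

lemma IsPrimitiveAlong.isPrimitiveAt_comp_section {K : Set E} {e : E → Y} {k : E → M}
    (hk : IsPrimitiveAlong ψ e K k) {V : Set Y} (hV : V ∈ 𝓝 y) {s : Y → E} (hs : ContinuousOn s V)
    (hsK : MapsTo s V K) (hes : ∀ v ∈ V, e (s v) = v) : IsPrimitiveAt ψ (k ∘ s) y :=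
  ⟨V, hV, fun γ hγ => hk ⟨fun t => s (γ t), hs.comp_continuous γ.continuous hγ⟩ γ
    (fun t => hsK (hγ t)) fun t => (hes _ (hγ t)).symm⟩

lemma IsPrimitiveAlong.eq_sub_of_segment [AddCommGroup E] [Module ℝ E] [ContinuousAdd E]
    [ContinuousSMul ℝ E] {e : E → Y} {K : Set E} {k : E → M} (hk : IsPrimitiveAlong ψ e K k)
    (hK : Convex ℝ K) {x x' : E} (hx : x ∈ K) (hx' : x' ∈ K) {η : C(I, Y)}
    (hη : ∀ t, η t = e (Path.segment x x' t)) : ψ η = k x' - k x := by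
  have hmem : ∀ t, Path.segment x x' t ∈ K := fun t =>
    hK.segment_subset hx hx' (Path.range_segment x x' ▸ mem_range_self t)
  simpa [increment] using hk (Path.segment x x').toContinuousMap η hmem hη

instance : LocallyPathConnectedSpace I := (convex_Icc (0 : ℝ) 1).locallyPathConnectedSpace

namespace IsPathCocycle

variable (hψ : IsPathCocycle ψ)
include hψ

lemma eq_increment_of_isPrimitiveAt {γ : C(I, Y)} (hh : ∀ t, IsPrimitiveAt ψ h (γ t)) :
    ψ γ = increment h γ := by
  obtain ⟨F, hF⟩ := hψ.exists_increment_eq_comp γ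
  have hF_prim : ∀ t, IsPrimitiveAt (fun p : C(I, I) => ψ (γ.comp p)) F t := fun t =>
    ⟨univ, univ_mem, fun p _ => hF p⟩
  exact (hF (ContinuousMap.id I)).trans <| eq_of_eventually_sub_eq
    (fun t => (hF_prim t).eventually_sub_eq (hh t).comp) 1 0

lemma exists_isPrimitiveAt_of_chart {V : Type*} [NormedAddCommGroup V] [NormedSpace ℝ V]
    (φ : OpenPartialHomeomorph Y V) (hy : y ∈ φ.source) : ∃ h : Y → M, IsPrimitiveAt ψ h y := by
  obtain ⟨ε, hε, hball⟩ := Metric.isOpen_iff.1 φ.open_target _ (φ.map_source hy)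
  obtain ⟨k, hk⟩ := hψ.exists_isPrimitiveAlong_of_convex (convex_ball (φ y) ε)
    (φ.continuousOn_symm.mono hball)
  exact ⟨_, hk.isPrimitiveAt_comp_section
    (inter_mem (φ.open_source.mem_nhds hy) ((φ.continuousAt hy).preimage_mem_nhds
      (Metric.ball_mem_nhds _ hε))) (φ.continuousOn.mono inter_subset_left) (fun _ hv => hv.2)
    fun _ hv => φ.left_inv hv.1⟩

lemma exists_eq_increment_of_loops [PathConnectedSpace Y]
    (hloop : ∀ (p : Y) (γ : Path p p), ψ γ.toContinuousMap = 0) : ∃ h : Y → M, ψ = increment h := by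
  obtain ⟨y₀⟩ : Nonempty Y := inferInstance
  let p : ∀ y, Path y₀ y := PathConnectedSpace.somePath y₀
  refine ⟨fun y => ψ (p y).toContinuousMap, funext fun γ => ?_⟩
  have h := hloop y₀ (((p (γ 0)).trans ⟨γ, rfl, rfl⟩).trans (p (γ 1)).symm)
  rw [hψ.trans, hψ.trans, hψ.symm, add_neg_eq_zero] at h
  exact eq_sub_of_add_eq' h

end IsPathCocycle

end Local

end PathCocycle

/-! ### Coherent families of local functions -/

section Coherent

variable {Y Z M : Type*} [TopologicalSpace Y] [TopologicalSpace Z] [AddCommGroup M]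

/-- A family of functions, `f y` being considered near `y` only, whose members differ by locally
constant functions: local primitives of one and the same closed `1`-form. -/
def IsCoherent (f : Y → Y → M) : Prop :=
  ∀ y, ∀ᶠ x in 𝓝 y, ∀ᶠ x' in 𝓝 x, f y x' - f x x' = f y x - f x x

/-- `F` differs from every member of the family `f` by a locally constant function: a global
primitive of the `1`-form whose local primitives are the `f y`. -/
def IsGlobalPrimitive (f : Y → Y → M) (F : Y → M) : Prop :=
  ∀ x, ∀ᶠ x' in 𝓝 x, F x' - f x x' = F x - f x x

lemma IsGlobalPrimitive.comp {f : Y → Y → M} {F : Y → M} (hF : IsGlobalPrimitive f F) {e : Z → Y}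
    (he : Continuous e) : IsGlobalPrimitive (fun z z' => f (e z) (e z')) fun z => F (e z) :=
  fun _ => he.continuousAt.eventually (hF _)

lemma IsGlobalPrimitive.sub_eq [PreconnectedSpace Y] {f : Y → Y → M} {F G : Y → M}
    (hF : IsGlobalPrimitive f F) (hG : IsGlobalPrimitive f G) (x y : Y) :
    F x - F y = G x - G y := by
  refine eq_of_eventually_sub_eq (fun y => ?_) x y
  filter_upwards [hF y, hG y] with x hFx hGx
  rw [← sub_sub_sub_cancel_right (F x) _ (f y x), hFx, hGx, sub_sub_sub_cancel_right]

namespace IsCoherent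

variable {f : Y → Y → M} (hf : IsCoherent f)
include hf

lemma comp {e : Z → Y} (he : Continuous e) : IsCoherent fun z z' => f (e z) (e z') := fun z =>
  (he.continuousAt.eventually (hf (e z))).mono fun _ hx => he.continuousAt.eventually hx

/-- The bundle of germs of primitives of a coherent family, a principal bundle with discrete
structure group `M`: in the trivialization near `i` the germ of `f i + v` has the coordinate `v`. -/
def primitiveBundle [TopologicalSpace M] [DiscreteTopology M] : FiberBundleCore Y Y M where
  baseSet y := interior {x | ∀ᶠ x' in 𝓝 x, f y x' - f x x' = f y x - f x x}
  isOpen_baseSet _ := isOpen_interior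
  indexAt := id
  mem_baseSet_at x := mem_interior_iff_mem_nhds.2 (hf x)
  coordChange i j x v := v + (f i x - f j x)
  coordChange_self i x _ v := by simp
  continuousOn_coordChange i j := by
    rintro ⟨x, v⟩ ⟨⟨hi, hj⟩, -⟩
    replace hi := interior_subset hi
    replace hj := interior_subset hj
    have hloc : ∀ᶠ p : Y × M in 𝓝 (x, v), f i p.1 - f j p.1 = f i x - f j x := by
      filter_upwards [continuous_fst.continuousAt.eventually hi,
        continuous_fst.continuousAt.eventually hj] with p hip hjp
      rw [← sub_sub_sub_cancel_right (f i p.1) _ (f x p.1), hip, hjp, sub_sub_sub_cancel_right]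
    have hadd : Continuous fun p : Y × M => p.2 + (f i x - f j x) :=
      (continuous_of_discreteTopology (f := (· + (f i x - f j x)))).comp continuous_snd
    exact (hadd.continuousAt.congr (hloc.mono fun p hp => congrArg (p.2 + ·) hp.symm))
      |>.continuousWithinAt
  coordChange_comp i j k x _ v := by abel

lemma exists_isGlobalPrimitive [SimplyConnectedSpace Y] [LocallyPathConnectedSpace Y] :
    ∃ F : Y → M, IsGlobalPrimitive f F := by
  let _ : TopologicalSpace M := ⊥
  have _ : DiscreteTopology M := ⟨rfl⟩
  obtain ⟨y₀⟩ : Nonempty Y := inferInstance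
  let B := hf.primitiveBundle
  have hcov : IsCoveringMap (Bundle.TotalSpace.proj : Bundle.TotalSpace M B.Fiber → Y) :=
    FiberBundle.isCoveringMap
  obtain ⟨s, ⟨-, hs⟩, -⟩ := hcov.existsUnique_continuousMap_lifts (ContinuousMap.id Y) y₀
    ⟨y₀, (0 : M)⟩ rfl
  have hs_proj : ∀ x, (s x).proj = x := congrFun hs
  let v : Y → M := fun x => (s x).snd
  have hv : ∀ y x, (B.localTriv y (s x)).2 = v x + (f x x - f y x) := fun y x => by
    have h : (B.localTriv y (s x)).2 = v x + (f (s x).proj (s x).proj - f y (s x).proj) := rfl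
    rw [h, hs_proj]
  refine ⟨fun x => v x + f x x, fun y => ?_⟩
  have hcont : ContinuousAt (fun x => (B.localTriv y (s x)).2) y := by
    refine continuous_snd.continuousAt.comp
      (ContinuousAt.comp (f := s) ?_ s.continuous.continuousAt)
    refine (B.localTriv y).continuousOn_toFun.continuousAt
      ((B.localTriv y).open_source.mem_nhds ?_)
    rw [FiberBundleCore.mem_localTriv_source, hs_proj]
    exact B.mem_baseSet_at y
  filter_upwards [hcont.preimage_mem_nhds (isOpen_discrete {_} |>.mem_nhds rfl)] with x hx
  rwa [mem_preimage, mem_singleton_iff, hv, hv, ← add_sub_assoc, ← add_sub_assoc] at hx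

instance : ContractibleSpace I := (convex_Icc (0 : ℝ) 1).contractibleSpace ⟨0, by simp⟩

lemma exists_isPathCocycle :
    ∃ ψ : C(I, Y) → M, IsPathCocycle ψ ∧ (∀ y, IsPrimitiveAt ψ (f y) y) ∧
      ∀ (γ : C(I, Y)) (F : I → M),
        IsGlobalPrimitive (fun t t' => f (γ t) (γ t')) F → ψ γ = F 1 - F 0 := by
  choose F hF using fun γ : C(I, Y) => (hf.comp γ.continuous).exists_isGlobalPrimitive
  have hF_eq : ∀ (γ : C(I, Y)) (G : I → M),
      IsGlobalPrimitive (fun t t' => f (γ t) (γ t')) G → F γ 1 - F γ 0 = G 1 - G 0 :=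
    fun γ G hG => (hF γ).sub_eq hG 1 0
  refine ⟨fun γ => F γ 1 - F γ 0, fun H => ?_, fun y => ?_, hF_eq⟩
  · obtain ⟨G, hG⟩ := (hf.comp H.continuous).exists_isGlobalPrimitive
    have hF_comp : ∀ e : C(I, I × I), F (H.comp e) 1 - F (H.comp e) 0 = G (e 1) - G (e 0) :=
      fun e => hF_eq _ (fun t => G (e t)) (hG.comp e.continuous)
    refine (congrArg₂ (· + ·) (hF_comp ⟨fun s => (s, 0), by fun_prop⟩)
      (hF_comp ⟨fun s => (1, s), by fun_prop⟩)).trans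
      (Eq.trans ?_ (hF_comp ⟨fun s => (s, s), by fun_prop⟩).symm)
    simp
  · exact ⟨_, hf y, fun γ hγ => hF_eq γ (fun t => f y (γ t)) fun t =>
      γ.continuous.continuousAt.eventually (hγ t)⟩

end IsCoherent

end Coherent

/-! ### Path cocycles and functionals on singular homology -/

section Singular

/-- The square, collapsed onto its lower triangle `0 ≤ v ≤ u ≤ 1`, the latter being identified with
the standard simplex. -/
def squareToSimplex : C(I × I, stdSimplex ℝ (Fin 3)) where
  toFun p := ⟨![1 - p.1, p.1 - min (p.1 : ℝ) p.2, min (p.1 : ℝ) p.2], by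
    refine ⟨fun i => ?_, by simp [Fin.sum_univ_three]⟩
    fin_cases i
    · simpa using p.1.2.2
    · simp
    · exact le_min p.1.2.1 p.2.2.1⟩
  continuous_toFun := by
    refine Continuous.subtype_mk (continuous_pi fun i => ?_) _
    fin_cases i
    · exact (by fun_prop : Continuous fun p : I × I => 1 - (p.1 : ℝ))
    · exact (by fun_prop : Continuous fun p : I × I => (p.1 : ℝ) - min (p.1 : ℝ) p.2)
    · exact (by fun_prop : Continuous fun p : I × I => min (p.1 : ℝ) p.2)

/-- The standard simplex as the lower triangle of the square. -/
def simplexToSquare : C(stdSimplex ℝ (Fin 3), I × I) where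
  toFun t := (⟨t 1 + t 2, add_nonneg (t.2.1 1) (t.2.1 2), by
    have hsum := t.2.2
    rw [Fin.sum_univ_three, add_assoc] at hsum
    exact (le_add_of_nonneg_left (t.2.1 0)).trans hsum.le⟩, ⟨t 2, mem_Icc_of_mem_stdSimplex t.2 2⟩)
  continuous_toFun := by
    have h : ∀ i, Continuous fun t : stdSimplex ℝ (Fin 3) => t i := fun i =>
      (continuous_apply i).comp continuous_subtype_val
    exact (((h 1).add (h 2)).subtype_mk _).prodMk ((h 2).subtype_mk _)

/-- The sides of the lower triangle of the square, numbered like the faces of the simplex. -/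
def triangleSide : Fin 3 → C(I, I × I) :=
  ![⟨fun s => (1, s), by fun_prop⟩, ⟨fun s => (s, s), by fun_prop⟩, ⟨fun s => (s, 0), by fun_prop⟩]

lemma faceMap_eq_squareToSimplex (i : Fin 3) (s : I) :
    faceMap 1 i (stdSimplexHomeomorphUnitInterval.symm s) = squareToSimplex (triangleSide i s) := by
  have hsymm : stdSimplexHomeomorphUnitInterval.symm s 0 = 1 - s ∧
    stdSimplexHomeomorphUnitInterval.symm s 1 = s := ⟨rfl, rfl⟩
  have hface : ∀ (x : stdSimplex ℝ (Fin 2)) (j : Fin 3),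
      faceMap 1 i x j = ∑ k ∈ Finset.univ.filter (fun k => i.succAbove k = j), x k := fun x j => by
    simp [faceMap, stdSimplex.map_coe, FunOnFinite.linearMap_apply_apply]
  have hcoe : ∀ p : I × I, (squareToSimplex p : Fin 3 → ℝ) =
    ![1 - (p.1 : ℝ), p.1 - min (p.1 : ℝ) p.2, min (p.1 : ℝ) p.2] := fun _ => rfl
  apply stdSimplex.ext
  funext j
  rw [hface, hcoe]
  fin_cases i <;> fin_cases j <;>
    simp [triangleSide, Finset.sum_filter, hsymm, Fin.succAbove, Fin.lt_def, s.2.1, s.2.2]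

lemma simplexToSquare_squareToSimplex {p : I × I} (hp : p.2 ≤ p.1) :
    simplexToSquare (squareToSimplex p) = p := by
  have hmin : min (p.1 : ℝ) p.2 = p.2 := min_eq_right hp
  refine Prod.ext (Subtype.ext ?_) (Subtype.ext hmin)
  change (p.1 : ℝ) - min (p.1 : ℝ) p.2 + min (p.1 : ℝ) p.2 = p.1
  rw [sub_add_cancel]

lemma triangleSide_snd_le_fst (i : Fin 3) (s : I) :
    (triangleSide i s).2 ≤ (triangleSide i s).1 := by
  fin_cases i <;> simp [triangleSide, unitInterval.le_one']

variable {Y M : Type*} [TopologicalSpace Y]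

/-- A singular `1`-simplex regarded as a map on the unit interval. -/
def simpPath (τ : Simp 1 Y) : C(I, Y) :=
  τ.comp (toContinuousMap stdSimplexHomeomorphUnitInterval.symm)

/-- The inverse of `simpPath`; it differs from `SingularPair.pathSimp` in that the end points of the
path are not part of its type. -/
def pathToSimp (γ : C(I, Y)) : Simp 1 Y :=
  γ.comp (toContinuousMap stdSimplexHomeomorphUnitInterval)

lemma simpPath_pathToSimp (γ : C(I, Y)) : simpPath (pathToSimp γ) = γ := by
  ext s
  simp [simpPath, pathToSimp]

lemma pathToSimp_simpPath (τ : Simp 1 Y) : pathToSimp (simpPath τ) = τ := by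
  ext s
  simp [simpPath, pathToSimp]

lemma face_comp_squareToSimplex (τ : Simp 2 Y) (i : Fin 3) :
    τ.comp (faceMap 1 i) = pathToSimp ((τ.comp squareToSimplex).comp (triangleSide i)) := by
  rw [← pathToSimp_simpPath (τ.comp (faceMap 1 i))]
  congr 1
  ext s
  exact congrArg τ (faceMap_eq_squareToSimplex i s)

lemma face_simplexToSquare (H : C(I × I, Y)) (i : Fin 3) :
    (H.comp simplexToSquare).comp (faceMap 1 i) = pathToSimp (H.comp (triangleSide i)) := by
  rw [face_comp_squareToSimplex]
  congr 1
  ext s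
  exact congrArg H (simplexToSquare_squareToSimplex (triangleSide_snd_le_fst i s))

lemma boundary_single (R : Type*) [CommRing R] (τ : Simp 2 Y) :
    boundary R 1 Y (Finsupp.single τ 1) =
      Finsupp.single (τ.comp (faceMap 1 2)) 1 + Finsupp.single (τ.comp (faceMap 1 0)) 1 -
        Finsupp.single (τ.comp (faceMap 1 1)) 1 := by
  have hsum := Fin.sum_univ_three fun i : Fin 3 =>
    Finsupp.single (τ.comp (faceMap 1 i)) ((-1 : R) ^ (i : ℕ))
  rw [boundary, Finsupp.linearCombination_single, one_smul, hsum]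
  simp only [Fin.val_zero, Fin.val_one, Fin.val_two, pow_zero, pow_one, neg_one_sq,
    Finsupp.single_neg]
  abel

variable [AddCommGroup M]

/-- `ψ` vanishes on the paths that stay in `A`. -/
def VanishesOn (ψ : C(I, Y) → M) (A : Set Y) : Prop := ∀ γ : C(I, Y), (∀ t, γ t ∈ A) → ψ γ = 0

lemma vanishesOn_empty (ψ : C(I, Y) → M) : VanishesOn ψ ∅ := fun _ h => (h 0).elim

variable (R : Type*) [CommRing R] [Module R M]

lemma isPathCocycle_of_boundary {R : Type*} [CommRing R] [Module R M] (Φ : Chain R 1 Y →ₗ[R] M)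
    (hΦ : ∀ c, Φ (boundary R 1 Y c) = 0) :
    IsPathCocycle fun γ => Φ (Finsupp.single (pathToSimp γ) 1) := by
  intro H
  have h := hΦ (Finsupp.single (H.comp simplexToSquare) 1)
  rw [boundary_single, map_sub, map_add, face_simplexToSquare, face_simplexToSquare,
    face_simplexToSquare] at h
  exact sub_eq_zero.1 h

/-- The functional on singular `1`-chains with given values on the paths. -/
def chainFunctional (ψ : C(I, Y) → M) : Chain R 1 Y →ₗ[R] M :=
  Finsupp.linearCombination R fun τ => ψ (simpPath τ)

lemma chainFunctional_single (ψ : C(I, Y) → M) (γ : C(I, Y)) :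
    chainFunctional R ψ (Finsupp.single (pathToSimp γ) 1) = ψ γ := by
  simp [chainFunctional, simpPath_pathToSimp]

section homologyFunctional

variable {ψ : C(I, Y) → M} (hψ : IsPathCocycle ψ)

include hψ in
lemma chainFunctional_boundary (c : Chain R 2 Y) : chainFunctional R ψ (boundary R 1 Y c) = 0 := by
  suffices (chainFunctional R ψ).comp (boundary R 1 Y) = 0 from LinearMap.congr_fun this c
  refine Finsupp.lhom_ext' fun τ => LinearMap.ext_ring ?_
  simp only [LinearMap.comp_apply, Finsupp.lsingle_apply, LinearMap.zero_apply]
  rw [boundary_single, map_sub, map_add, face_comp_squareToSimplex, face_comp_squareToSimplex,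
    face_comp_squareToSimplex, chainFunctional_single, chainFunctional_single,
    chainFunctional_single]
  exact sub_eq_zero.2 (hψ (τ.comp squareToSimplex))

variable {A : Set Y} (hA : VanishesOn ψ A)

include hψ hA in
lemma relBoundaries_le_ker_chainFunctional :
    relBoundaries R A ≤ LinearMap.ker (chainFunctional R ψ) := by
  refine sup_le ?_ ?_
  · rintro _ ⟨c, rfl⟩
    exact chainFunctional_boundary R hψ c
  · rw [chainsIn, Finsupp.supported_eq_span_single, Submodule.span_le]
    rintro _ ⟨τ, hτ, rfl⟩
    rw [SetLike.mem_coe, LinearMap.mem_ker, ← pathToSimp_simpPath τ, chainFunctional_single]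
    exact hA _ fun t => hτ ⟨_, rfl⟩

/-- The functional on relative homology given by a cocycle that vanishes on the paths of `A`. -/
def homologyFunctional : H1 R Y A →ₗ[R] M :=
  ((relBoundaries R A).liftQ (chainFunctional R ψ)
    (relBoundaries_le_ker_chainFunctional R hψ hA)).comp (Submodule.subtype _)

lemma homologyFunctional_loopClass {p : Y} (γ : Path p p) :
    homologyFunctional R hψ hA (loopClass R A γ) = ψ γ.toContinuousMap :=
  chainFunctional_single R ψ γ.toContinuousMap

lemma homologyFunctional_pathClass {p q : Y} (hp : p ∈ A) (hq : q ∈ A) (γ : Path p q) :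
    homologyFunctional R hψ hA (pathClass R A hp hq γ) = ψ γ.toContinuousMap :=
  chainFunctional_single R ψ γ.toContinuousMap

lemma IsPathCocycle.loop_eq_zero_of_span_eq_top {s : Set (H1 R Y ∅)} (hs : Submodule.span R s = ⊤)
    (hzero : ∀ x ∈ s, homologyFunctional R hψ (vanishesOn_empty ψ) x = 0) {p : Y} (γ : Path p p) :
    ψ γ.toContinuousMap = 0 := by
  rw [← homologyFunctional_loopClass R hψ (vanishesOn_empty ψ) γ,
    LinearMap.ext_on (g := 0) hs hzero, LinearMap.zero_apply]

end homologyFunctional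

lemma chainFunctional_increment (h : Y → M) : chainFunctional R (increment h) =
    (Finsupp.linearCombination R fun τ : Simp 0 Y => h (τ default)).comp (boundary R 0 Y) := by
  refine Finsupp.lhom_ext' fun τ => LinearMap.ext_ring ?_
  let γ : Path (simpPath τ 0) (simpPath τ 1) := ⟨simpPath τ, rfl, rfl⟩
  have hγ : pathSimp γ = τ := pathToSimp_simpPath τ
  have hb := boundary_path R γ
  rw [hγ] at hb
  simp [chainFunctional, increment, hb, pointSimp]

lemma homologyFunctional_eq_zero_of_increment {h : Y → M} {A : Set Y}
    (hA : VanishesOn (increment h) A) {c : M} (hc : ∀ a ∈ A, h a = c) :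
    homologyFunctional R (isPathCocycle_increment h) hA = 0 := by
  refine LinearMap.ext fun ⟨_, x, hx, rfl⟩ => ?_
  have hincr : increment h = increment fun y => h y - c := by
    ext γ
    simp [increment]
  refine (LinearMap.congr_fun (hincr ▸ chainFunctional_increment R fun y => h y - c) x).trans ?_
  rw [SetLike.mem_coe, relCycles, Submodule.mem_comap, chainsIn, Finsupp.mem_supported] at hx
  refine Finset.sum_eq_zero fun τ hτ => ?_
  simp [hc _ (hx hτ ⟨default, rfl⟩)]

lemma exists_eq_homologyFunctional {K : Type*} [Field K] [Module K M] {A : Set Y}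
    (φ : H1 K Y A →ₗ[K] M) : ∃ (ψ : C(I, Y) → M) (hψ : IsPathCocycle ψ) (hA : VanishesOn ψ A),
      φ = homologyFunctional K hψ hA := by
  obtain ⟨Φ, hΦ⟩ := LinearMap.exists_extend φ
  let Ψ := Φ.comp (relBoundaries K A).mkQ
  have hΨ : ∀ c ∈ relBoundaries K A, Ψ c = 0 := fun c hc => by
    rw [LinearMap.comp_apply, Submodule.mkQ_apply, (Submodule.Quotient.mk_eq_zero _).2 hc, map_zero]
  have hA : VanishesOn (fun γ => Ψ (Finsupp.single (pathToSimp γ) 1)) A := fun γ hγ => by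
    refine hΨ _ (Submodule.mem_sup_right (Finsupp.single_mem_supported K 1 ?_))
    rintro _ ⟨s, rfl⟩
    exact hγ _
  refine ⟨_, isPathCocycle_of_boundary Ψ fun c => hΨ _ (Submodule.mem_sup_left ⟨c, rfl⟩), hA, ?_⟩
  have hchain : chainFunctional K (fun γ => Ψ (Finsupp.single (pathToSimp γ) 1)) = Ψ :=
    Finsupp.lhom_ext' fun τ => LinearMap.ext_ring <| by simp [chainFunctional, pathToSimp_simpPath]
  refine LinearMap.ext fun ⟨_, x, hx, rfl⟩ => ?_
  exact (LinearMap.congr_fun hΦ _).symm.trans (LinearMap.congr_fun hchain x).symm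

variable {R}

/-- Paths are closed up by paths from a base point; the choice of the latter does not matter for
the values on loops. -/
lemma exists_isPathCocycle_eq_on_loops [PathConnectedSpace Y] (φ : H1 R Y ∅ →ₗ[R] M) :
    ∃ ψ : C(I, Y) → M, IsPathCocycle ψ ∧
      ∀ (p : Y) (γ : Path p p), ψ γ.toContinuousMap = φ (loopClass R ∅ γ) := by
  obtain ⟨y₀⟩ : Nonempty Y := inferInstance
  let c : C(I, Y) → Chain R 1 Y := fun γ => Finsupp.single (pathToSimp γ) 1
  let q : Y → Chain R 1 Y := fun y => c (PathConnectedSpace.somePath y₀ y).toContinuousMap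
  let closed : C(I, Y) → Chain R 1 Y := fun γ => c γ - increment q γ
  have hclosed : ∀ γ, closed γ ∈ relCycles R (∅ : Set Y) := by
    intro γ
    have hγ := boundary_path R (⟨γ, rfl, rfl⟩ : Path (γ 0) (γ 1))
    have hq := fun y => boundary_path R (PathConnectedSpace.somePath y₀ y)
    have hzero : boundary R 0 Y (closed γ) = 0 := by
      rw [map_sub, increment, map_sub]
      refine (congrArg₂ _ hγ (congrArg₂ _ (hq _) (hq _))).trans ?_
      rw [sub_sub_sub_cancel_right, sub_self]
    rw [relCycles, Submodule.mem_comap, hzero]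
    exact Submodule.zero_mem _
  let π := (relBoundaries R (∅ : Set Y)).mkQ
  have hc : IsPathCocycle fun γ => π (c γ) := isPathCocycle_of_boundary π fun c => by
    rw [Submodule.mkQ_apply, Submodule.Quotient.mk_eq_zero]
    exact Submodule.mem_sup_left ⟨c, rfl⟩
  refine ⟨fun γ => φ ⟨π (closed γ), Submodule.mem_map_of_mem (hclosed γ)⟩, fun H => ?_,
    fun p γ => congrArg φ (Subtype.ext (congrArg π ?_))⟩
  · rw [← map_add]
    refine congrArg φ (Subtype.ext ?_)
    have hH := hc H
    beta_reduce at hH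
    simp only [Submodule.coe_add, closed, map_sub, increment, ← hH]
    simp only [ContinuousMap.coe_mk]
    abel
  · exact (congrArg (c γ.toContinuousMap - ·) (increment_loop q γ)).trans (sub_zero _)

end Singular

/-! ### Periods and extensions of cocycles -/

section PeriodExtension

variable {X Y E M : Type*} [TopologicalSpace X] [TopologicalSpace Y] [AddCommGroup M]
  {ψ : C(I, Y) → M}

lemma IsPrimitiveAlong.translate_sub_eq [TopologicalSpace E] [AddCommGroup E] [Module ℝ E]
    [ContinuousAdd E] [ContinuousSMul ℝ E] {e : E → Y} {K : Set E} {k : E → M}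
    (hk : IsPrimitiveAlong ψ e K k) (hK : Convex ℝ K) (he : ContinuousOn e K) {v x x' : E}
    (hv : ∀ x ∈ K, x + v ∈ K) (hev : ∀ x ∈ K, e (x + v) = e x) (hx : x ∈ K) (hx' : x' ∈ K) :
    k (x + v) - k x = k (x' + v) - k x' := by
  have hmem : ∀ t, Path.segment x x' t ∈ K := fun t =>
    hK.segment_subset hx hx' (Path.range_segment x x' ▸ mem_range_self t)
  let η : C(I, Y) := ⟨fun t => e (Path.segment x x' t),
    he.comp_continuous (Path.segment x x').continuous hmem⟩
  have h₁ : ψ η = k x' - k x := hk.eq_sub_of_segment hK hx hx' fun _ => rfl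
  have h₂ : ψ η = k (x' + v) - k (x + v) :=
    hk.eq_sub_of_segment hK (hv x hx) (hv x' hx') fun t => by
      have htranslate : Path.segment (x + v) (x' + v) t = Path.segment x x' t + v := by
        simp only [Path.segment_apply, AffineMap.lineMap_apply_module', add_sub_add_right_eq_sub]
        abel
      rw [htranslate, hev _ (hmem t)]
      rfl
  exact (sub_eq_sub_iff_sub_eq_sub.1 (h₂.symm.trans h₁)).symm

lemma IsPrimitiveAlong.exists_period [TopologicalSpace E] [AddCommGroup E] [Module ℝ E]
    [ContinuousAdd E] [ContinuousSMul ℝ E] {e : E → Y} {K : Set E} {k : E → M}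
    (hk : IsPrimitiveAlong ψ e K k) (hK : Convex ℝ K) (he : ContinuousOn e K) {v : E}
    (hv : ∀ x, x + v ∈ K ↔ x ∈ K) (hev : ∀ x ∈ K, e (x + v) = e x) :
    ∃ c : M, ∀ x ∈ K, ∀ l : ℤ, k (x + l • v) = k x + l • c := by
  rcases K.eq_empty_or_nonempty with rfl | ⟨x₀, hx₀⟩
  · exact ⟨0, fun x hx => hx.elim⟩
  have hstep : ∀ x ∈ K, k (x + v) = k x + (k (x₀ + v) - k x₀) := fun x hx =>
    eq_add_of_sub_eq' (hk.translate_sub_eq hK he (fun x => (hv x).2) hev hx hx₀)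
  have hmem : ∀ x ∈ K, ∀ l : ℤ, x + l • v ∈ K := fun x hx l => by
    induction l with
    | zero => simpa using hx
    | succ j ih => rwa [add_smul, one_smul, ← add_assoc, hv]
    | pred j ih => rwa [sub_smul, one_smul, ← hv, ← add_sub_assoc, sub_add_cancel]
  refine ⟨k (x₀ + v) - k x₀, fun x hx l => ?_⟩
  induction l with
  | zero => simp
  | succ j ih =>
    rw [add_smul, one_smul, ← add_assoc, hstep _ (hmem x hx j), ih, add_smul, one_smul, add_assoc]
  | pred j ih =>
    have h := hstep _ (hmem x hx (-j - 1))
    rw [add_assoc, ← add_one_zsmul, sub_add_cancel, ih] at h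
    rw [eq_sub_of_add_eq h.symm, sub_smul, one_smul, add_sub_assoc]

/-- At a point of `X` that is missing in `Y` it suffices to have a function which is a primitive at
all the points near by; its value at the missing point does not matter. -/
lemma IsPathCocycle.exists_extension [LocallyPathConnectedSpace Y] (hψ : IsPathCocycle ψ)
    {e : C(Y, X)} (he : IsOpenEmbedding e) (hloc : ∀ y, ∃ h, IsPrimitiveAt ψ h y)
    (hext : ∀ x ∉ range e, ∃ h : X → M,
      ∀ᶠ x' in 𝓝[≠] x, ∃ y, e y = x' ∧ IsPrimitiveAt ψ (h ∘ e) y) :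
    ∃ Ψ : C(I, X) → M, IsPathCocycle Ψ ∧ ∀ γ : C(I, Y), Ψ (e.comp γ) = ψ γ := by
  have hfamily : ∀ x, ∃ h : X → M, (∀ y, e y = x → IsPrimitiveAt ψ (h ∘ e) y) ∧
      ∀ᶠ x' in 𝓝[≠] x, ∃ y, e y = x' ∧ IsPrimitiveAt ψ (h ∘ e) y := by
    intro x
    by_cases hx : x ∈ range e
    · obtain ⟨y, rfl⟩ := hx
      obtain ⟨h, hh⟩ := hloc y
      have hcomp : Function.extend e h 0 ∘ e = h := Function.extend_comp he.injective h 0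
      refine ⟨Function.extend e h 0, fun y' hy' => ?_, ?_⟩
      · rwa [he.injective hy', hcomp]
      · refine eventually_nhdsWithin_of_eventually_nhds ?_
        rw [← he.map_nhds_eq, eventually_map, hcomp]
        exact hh.eventually.mono fun y' hy' => ⟨y', rfl, hy'⟩
    · obtain ⟨h, hh⟩ := hext x hx
      exact ⟨h, fun y hy => (hx ⟨y, hy⟩).elim, hh⟩
  choose f hf_self hf_near using hfamily
  have hcoh : IsCoherent f := fun x => by
    filter_upwards [eventually_nhdsWithin_iff.1 (hf_near x)] with x' hx'
    rcases eq_or_ne x' x with rfl | hne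
    · simp
    · obtain ⟨y, rfl, hy⟩ := hx' hne
      rw [← he.map_nhds_eq, eventually_map]
      exact hy.eventually_sub_eq (hf_self _ y rfl)
  obtain ⟨Ψ, hΨ, -, hval⟩ := hcoh.exists_isPathCocycle
  refine ⟨Ψ, hΨ, fun γ => ?_⟩
  obtain ⟨F, hF⟩ := hψ.exists_increment_eq_comp γ
  have hF_prim : ∀ t, IsPrimitiveAt (fun p : C(I, I) => ψ (γ.comp p)) F t := fun t =>
    ⟨univ, univ_mem, fun p _ => hF p⟩
  exact (hval _ F fun t => (hF_prim t).eventually_sub_eq (hf_self _ _ rfl).comp).trans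
    (hF (ContinuousMap.id I)).symm

end PeriodExtension

/-! ### Residues at the points at infinity -/

namespace HurwitzCovering

variable {L M : Type*} [TopologicalSpace L] [ChartedSpace ℂ L] {m : ℕ} {n : Fin (m + 1) → ℕ}
  (C : HurwitzCovering L m n) [AddCommGroup M]

/-- The inclusion of the punctured surface. -/
def puncturedIncl : C(C.Punctured, L) := ⟨Subtype.val, continuous_subtype_val⟩

lemma isOpenEmbedding_puncturedIncl [T2Space L] : IsOpenEmbedding C.puncturedIncl :=
  (finite_range C.pole).isClosed.isOpen_compl.isOpenEmbedding_subtypeVal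

lemma locallyPathConnectedSpace_punctured [T2Space L] : LocallyPathConnectedSpace C.Punctured :=
  have := ChartedSpace.locallyPathConnectedSpace ℂ L
  C.isOpenEmbedding_puncturedIncl.locallyPathConnectedSpace

lemma exists_isPrimitiveAt [T2Space L] {ψ : C(I, C.Punctured) → M} (hψ : IsPathCocycle ψ)
    (P : C.Punctured) : ∃ h, IsPrimitiveAt ψ h P :=
  have : Nonempty C.Punctured := ⟨P⟩
  hψ.exists_isPrimitiveAt_of_chart
    ((C.isOpenEmbedding_puncturedIncl.toOpenPartialHomeomorph _).trans (chartAt ℂ (P : L)))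
    (by simp [puncturedIncl])

/-- The logarithms of the points of the coordinate disc at `∞_i`. -/
def logDisc (i : Fin (m + 1)) : Set ℂ := {s | s.re < Real.log (C.radius i)}

/-- The point with local parameter `exp s` at `∞_i`, with a junk value if `exp s` is not in the
coordinate disc. -/
def expPoint (i : Fin (m + 1)) (s : ℂ) : C.Punctured :=
  if h : s.re < Real.log (C.radius i) then
    ⟨(C.coord i).symm (Complex.exp s), C.coord_symm_notMem i (Complex.exp_ne_zero s) (by
      rwa [Complex.norm_exp, ← Real.lt_log_iff_exp_lt (C.radius_pos i)])⟩
  else C.polarPoint i (C.radius i / 2) (half_pos (C.radius_pos i)) (half_lt_self (C.radius_pos i)) 1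

variable {i : Fin (m + 1)}

lemma exp_mem_target {s : ℂ} : Complex.exp s ∈ (C.coord i).target ↔ s ∈ C.logDisc i := by
  rw [C.coord_target, mem_ball_zero_iff, Complex.norm_exp,
    ← Real.lt_log_iff_exp_lt (C.radius_pos i), logDisc, mem_ofPred_eq]

lemma mem_logDisc {s : ℂ} {P : L} (hP : P ∈ (C.coord i).source)
    (hs : Complex.exp s = C.coord i P) : s ∈ C.logDisc i :=
  C.exp_mem_target.1 (hs ▸ (C.coord i).map_source hP)

lemma coe_expPoint {s : ℂ} (hs : s ∈ C.logDisc i) :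
    (C.expPoint i s : L) = (C.coord i).symm (Complex.exp s) := by
  rw [expPoint, dif_pos (show s.re < _ from hs)]

lemma expPoint_mem_source {s : ℂ} (hs : s ∈ C.logDisc i) :
    (C.expPoint i s : L) ∈ (C.coord i).source := by
  rw [C.coe_expPoint hs]
  exact (C.coord i).map_target (C.exp_mem_target.2 hs)

lemma coord_expPoint {s : ℂ} (hs : s ∈ C.logDisc i) :
    C.coord i (C.expPoint i s) = Complex.exp s := by
  rw [C.coe_expPoint hs, (C.coord i).right_inv (C.exp_mem_target.2 hs)]

lemma expPoint_eq {s : ℂ} {P : C.Punctured} (hP : (P : L) ∈ (C.coord i).source)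
    (hs : Complex.exp s = C.coord i P) : C.expPoint i s = P :=
  Subtype.ext <| by rw [C.coe_expPoint (C.mem_logDisc hP hs), hs, (C.coord i).left_inv hP]

lemma continuousOn_expPoint : ContinuousOn (C.expPoint i) (C.logDisc i) := by
  rw [continuousOn_iff_continuous_domRestrict, continuous_induced_rng]
  have hcont : Continuous fun s : C.logDisc i => (C.coord i).symm (Complex.exp s) :=
    (C.coord i).continuousOn_symm.comp_continuous (by fun_prop) fun s => C.exp_mem_target.2 s.2
  exact hcont.congr fun s => (C.coe_expPoint s.2).symm

variable (i) in
lemma convex_logDisc : Convex ℝ (C.logDisc i) := convex_halfSpace_re_lt _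

variable (i) in
lemma isOpen_logDisc : IsOpen (C.logDisc i) :=
  isOpen_lt Complex.continuous_re continuous_const

lemma coord_eq_zero_iff {P : L} (hP : P ∈ (C.coord i).source) :
    C.coord i P = 0 ↔ P = C.pole i := by
  rw [← C.coord_pole i, (C.coord i).injOn.eq_iff hP (C.pole_mem i)]

lemma coord_ne_zero {P : L} (hP : P ∈ (C.coord i).source) (h : P ∉ range C.pole) :
    C.coord i P ≠ 0 := fun h0 => h ⟨i, ((C.coord_eq_zero_iff hP).1 h0).symm⟩

lemma notMem_range_pole {P : L} (hP : P ∈ (C.coord i).source) (h : C.coord i P ≠ 0) :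
    P ∉ range C.pole := by
  have hr := (C.coord i).map_source hP
  rw [C.coord_target, mem_ball_zero_iff] at hr
  rw [← (C.coord i).left_inv hP]
  exact C.coord_symm_notMem i h hr

lemma log_mem_logDisc {ρ : ℝ} (h0 : 0 < ρ) (hr : ρ < C.radius i) :
    (Real.log ρ : ℂ) ∈ C.logDisc i := by
  simpa [logDisc] using Real.log_lt_log h0 hr

lemma polarPoint_exp {ρ : ℝ} (h0 : 0 < ρ) (hr : ρ < C.radius i) (θ : ℝ) :
    C.polarPoint i ρ h0 hr (Circle.exp θ) = C.expPoint i (Real.log ρ + θ * Complex.I) := by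
  have hmem : (Real.log ρ + θ * Complex.I : ℂ) ∈ C.logDisc i := by
    simpa [logDisc] using Real.log_lt_log h0 hr
  apply Subtype.ext
  rw [C.coe_expPoint hmem, Complex.exp_add, ← Complex.ofReal_exp, Real.exp_log h0,
    ← Circle.coe_exp]
  rfl

variable (i) in
/-- The residue of a cocycle at `∞_i` is the period of its primitive in the logarithm of the local
parameter. -/
lemma exists_residue {ψ : C(I, C.Punctured) → M} (hψ : IsPathCocycle ψ) :
    ∃ (k : ℂ → M) (c : M), IsPrimitiveAlong ψ (C.expPoint i) (C.logDisc i) k ∧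
      (∀ s ∈ C.logDisc i, ∀ l : ℤ, k (s + l * (2 * Real.pi * Complex.I)) = k s + l • c) ∧
      ∀ ρ h0 hr, ψ (C.circleLoop i ρ h0 hr).toContinuousMap = c := by
  obtain ⟨k, hk⟩ := hψ.exists_isPrimitiveAlong_of_convex (C.convex_logDisc i)
    C.continuousOn_expPoint
  have hmem : ∀ s, s + 2 * Real.pi * Complex.I ∈ C.logDisc i ↔ s ∈ C.logDisc i := fun s => by
    simp [logDisc]
  have hexp : ∀ s ∈ C.logDisc i, C.expPoint i (s + 2 * Real.pi * Complex.I) = C.expPoint i s :=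
    fun s hs => C.expPoint_eq (C.expPoint_mem_source hs) <| by
      rw [Complex.exp_periodic, C.coord_expPoint hs]
  obtain ⟨c, hc⟩ := hk.exists_period (C.convex_logDisc i) C.continuousOn_expPoint hmem hexp
  refine ⟨k, c, hk, fun s hs l => by simpa only [zsmul_eq_mul] using hc s hs l,
    fun ρ h0 hr => ?_⟩
  have hρ := C.log_mem_logDisc h0 hr
  have hcircle : ∀ t, C.circleLoop i ρ h0 hr t = C.expPoint i
      (Path.segment (Real.log ρ : ℂ) (Real.log ρ + 2 * Real.pi * Complex.I) t) := fun t => by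
    refine (C.polarPoint_exp h0 hr (2 * Real.pi * t)).trans (congrArg _ ?_)
    simp only [Path.segment_apply, AffineMap.lineMap_apply_module', add_sub_cancel_left,
      Complex.real_smul]
    push_cast
    ring
  rw [hk.eq_sub_of_segment (C.convex_logDisc i) hρ ((hmem _).2 hρ) hcircle]
  simpa [sub_eq_iff_eq_add'] using hc _ hρ 1

lemma isPrimitiveAt_log_div {ψ : C(I, C.Punctured) → M} {k : ℂ → M}
    (hk : IsPrimitiveAlong ψ (C.expPoint i) (C.logDisc i) k) {P : C.Punctured}
    (hP : (P : L) ∈ (C.coord i).source) {s : ℂ} (hs : Complex.exp s = C.coord i P) :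
    IsPrimitiveAt ψ (fun Q : C.Punctured => k (s + Complex.log (C.coord i Q / C.coord i P))) P := by
  have hP0 := C.coord_ne_zero hP P.2
  have hquot : ContinuousAt (fun Q : C.Punctured => C.coord i Q / C.coord i P) P :=
    (((C.coord i).continuousAt hP).comp continuous_subtype_val.continuousAt).div_const _
  have hexp : ∀ Q : C.Punctured, (Q : L) ∈ (C.coord i).source →
      Complex.exp (s + Complex.log (C.coord i Q / C.coord i P)) = C.coord i Q := fun Q hQ => by
    rw [Complex.exp_add, hs, Complex.exp_log (div_ne_zero (C.coord_ne_zero hQ Q.2) hP0),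
      mul_div_cancel₀ _ hP0]
  refine hk.isPrimitiveAt_comp_section
    (s := fun Q : C.Punctured => s + Complex.log (C.coord i Q / C.coord i P))
    (V := {Q : C.Punctured | (Q : L) ∈ (C.coord i).source ∧
      C.coord i Q / C.coord i P ∈ Complex.slitPlane}) ?_ ?_
    (fun Q hQ => C.mem_logDisc hQ.1 (hexp Q hQ.1)) fun Q hQ => C.expPoint_eq hQ.1 (hexp Q hQ.1)
  · refine inter_mem (continuous_subtype_val.continuousAt.preimage_mem_nhds
      ((C.coord i).open_source.mem_nhds hP)) (hquot.preimage_mem_nhds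
        (t := Complex.slitPlane) (Complex.isOpen_slitPlane.mem_nhds ?_))
    rw [div_self hP0]
    exact Complex.one_mem_slitPlane
  · exact continuousOn_const.add <| ContinuousOn.clog (((C.coord i).continuousOn.comp
      continuous_subtype_val.continuousOn fun Q hQ => hQ.1).div_const _) fun Q hQ => hQ.2

lemma isPrimitiveAt_log {ψ : C(I, C.Punctured) → M} {k : ℂ → M}
    (hk : IsPrimitiveAlong ψ (C.expPoint i) (C.logDisc i) k)
    (hper : ∀ s ∈ C.logDisc i, ∀ l : ℤ, k (s + l * (2 * Real.pi * Complex.I)) = k s)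
    {P : C.Punctured} (hP : (P : L) ∈ (C.coord i).source) :
    IsPrimitiveAt ψ (fun Q : C.Punctured => k (Complex.log (C.coord i Q))) P := by
  have hP0 := C.coord_ne_zero hP P.2
  refine (C.isPrimitiveAt_log_div hk hP (Complex.exp_log hP0)).congr_add_const 0 ?_
  filter_upwards [continuous_subtype_val.continuousAt.preimage_mem_nhds
      ((C.coord i).open_source.mem_nhds hP)] with Q hQ
  have hQ0 := C.coord_ne_zero hQ Q.2
  have hexp : Complex.exp (Complex.log (C.coord i P) + Complex.log (C.coord i Q / C.coord i P)) =
      Complex.exp (Complex.log (C.coord i Q)) := by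
    rw [Complex.exp_add, Complex.exp_log hP0, Complex.exp_log (div_ne_zero hQ0 hP0),
      mul_div_cancel₀ _ hP0, Complex.exp_log hQ0]
  obtain ⟨l, hl⟩ := Complex.exp_eq_exp_iff_exists_int.1 hexp
  rw [hl, hper _ (C.mem_logDisc hQ (Complex.exp_log hQ0)), add_zero]

/-- Without residues, `k ∘ log` is well defined near `∞_i` and serves as a primitive there. -/
lemma exists_extension [T2Space L] {ψ : C(I, C.Punctured) → M} (hψ : IsPathCocycle ψ)
    (hres : ∀ i ρ h0 hr, ψ (C.circleLoop i ρ h0 hr).toContinuousMap = 0) :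
    ∃ Ψ : C(I, L) → M, IsPathCocycle Ψ ∧ ∀ γ, Ψ (C.puncturedIncl.comp γ) = ψ γ := by
  have := C.locallyPathConnectedSpace_punctured
  refine hψ.exists_extension C.isOpenEmbedding_puncturedIncl (C.exists_isPrimitiveAt hψ)
    fun x hx => ?_
  obtain ⟨i, rfl⟩ : x ∈ range C.pole := by_contra fun h => hx ⟨⟨x, h⟩, rfl⟩
  obtain ⟨k, c, hk, hper, hc⟩ := C.exists_residue i hψ
  have hc0 : c = 0 := by
    rw [← hc _ (half_pos (C.radius_pos i)) (half_lt_self (C.radius_pos i)), hres]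
  refine ⟨fun x => k (Complex.log (C.coord i x)), eventually_nhdsWithin_iff.2 ?_⟩
  filter_upwards [(C.coord i).open_source.mem_nhds (C.pole_mem i)] with x hx hne
  have hx0 : C.coord i x ≠ 0 := mt (C.coord_eq_zero_iff hx).1 hne
  exact ⟨⟨x, C.notMem_range_pole hx hx0⟩, rfl, C.isPrimitiveAt_log hk
    (fun s hs l => by rw [hper s hs l, hc0, smul_zero, add_zero]) hx⟩

end HurwitzCovering

/-! ### The trace of a cocycle -/

lemma exists_eventuallyEq_of_finite {X M : Type*} [TopologicalSpace X] [T2Space X] {s : Set X}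
    (hs : s.Finite) (h : X → X → M) : ∃ g : X → M, ∀ q ∈ s, g =ᶠ[𝓝 q] h q := by
  classical
  obtain ⟨U, hU, hdisj⟩ := hs.t2_separation
  refine ⟨fun x => if hx : ∃ q ∈ s, x ∈ U q then h hx.choose x else h x x, fun q hq => ?_⟩
  filter_upwards [(hU q).2.mem_nhds (hU q).1] with x hx
  have hex : ∃ q ∈ s, x ∈ U q := ⟨q, hq, hx⟩
  have hchoose : hex.choose = q := by
    by_contra hne
    exact disjoint_left.1 (hdisj hex.choose_spec.1 hq hne) hex.choose_spec.2 hx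
  rw [dif_pos hex, hchoose]

lemma eventually_finsum_fiber_eq {X Y M : Type*} [TopologicalSpace X] [TopologicalSpace Y]
    [T2Space X] [AddCommMonoid M] {f : X → Y} {y : Y} (hclosed : IsClosedMap f)
    (hfin : (f ⁻¹' {y}).Finite) (hloc : IsLocalHomeomorphOn f (f ⁻¹' {y})) {g : X → M}
    (hg : ∀ q ∈ f ⁻¹' {y}, ∀ᶠ q' in 𝓝 q, g q' = g q) :
    ∀ᶠ y' in 𝓝 y, ∑ᶠ q ∈ f ⁻¹' {y'}, g q = ∑ᶠ q ∈ f ⁻¹' {y}, g q := by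
  obtain ⟨U, hU, hdisj⟩ := hfin.t2_separation
  have hnhds : ∀ q ∈ f ⁻¹' {y}, ∃ S ∈ 𝓝 q, InjOn f S ∧ map f (𝓝 q) = 𝓝 y := fun q hq => by
    obtain ⟨e, he, rfl⟩ := hloc q hq
    exact ⟨e.source, e.open_source.mem_nhds he, e.injOn, hq ▸ e.map_nhds_eq he⟩
  choose! S hS hinj hmap using hnhds
  let V : X → Set X := fun q => U q ∩ S q ∩ {q' | g q' = g q}
  have hV : ∀ q ∈ f ⁻¹' {y}, V q ∈ 𝓝 q := fun q hq =>
    inter_mem (inter_mem ((hU q).2.mem_nhds (hU q).1) (hS q hq)) (hg q hq)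
  have himage : ∀ q ∈ f ⁻¹' {y}, f '' V q ∈ 𝓝 y := fun q hq =>
    hmap q hq ▸ image_mem_map (hV q hq)
  filter_upwards [hclosed.eventually_nhds_fiber (p := fun x => ∃ q ∈ f ⁻¹' {y}, x ∈ V q) y
    fun q hq => mem_of_superset (hV q hq) fun x hx => ⟨q, hq, hx⟩,
    (biInter_mem hfin).2 himage] with y' hcover hmeet
  choose! b hbV hfb using mem_iInter₂.1 hmeet
  refine (finsum_mem_eq_of_bijOn b ⟨fun q hq => hfb q hq, fun q hq q' hq' hbb => ?_,
    fun x hx => ?_⟩ fun q hq => (hbV q hq).2.symm).symm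
  · by_contra hne
    exact disjoint_left.1 (hdisj hq hq' hne) (hbV q hq).1.1 (hbb ▸ (hbV q' hq').1.1)
  · obtain ⟨q, hq, hxq⟩ := hcover x hx
    exact ⟨q, hq, hinj q hq (hbV q hq).1.2 hxq.1.2 ((hfb q hq).trans hx.symm)⟩

lemma eventually_deriv_ne_zero_and_ne {f : ℂ → ℂ} {a : ℂ} (hf : AnalyticAt ℂ f a)
    (hsimple : deriv f a = 0 → deriv (deriv f) a ≠ 0) :
    ∀ᶠ w in 𝓝[≠] a, deriv f w ≠ 0 ∧ f w ≠ f a := by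
  have hderiv : ∀ᶠ w in 𝓝[≠] a, deriv f w ≠ 0 := by
    refine hf.deriv.eventually_eq_zero_or_eventually_ne_zero.resolve_left fun h => ?_
    refine hsimple h.self_of_nhds ?_
    rw [EventuallyEq.deriv_eq (f := fun _ => (0 : ℂ)) h, deriv_const]
  refine hderiv.and ?_
  refine (hf.eventually_eq_or_eventually_ne analyticAt_const (g := fun _ => f a)).resolve_left
    fun h => ?_
  have hderiv_zero : ∀ᶠ w in 𝓝[≠] a, deriv f w = 0 := by
    filter_upwards [(eventually_eventually_nhds.2 h).filter_mono nhdsWithin_le_nhds] with w hw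
    rw [EventuallyEq.deriv_eq (f := fun _ => f a) hw, deriv_const]
  obtain ⟨w, hw_zero, hw⟩ := (hderiv_zero.and hderiv).exists
  exact hw hw_zero

namespace HurwitzCovering

variable {L M : Type*} [TopologicalSpace L] [ChartedSpace ℂ L] {m : ℕ} {n : Fin (m + 1) → ℕ}
  (C : HurwitzCovering L m n) [AddCommGroup M]

/-- The covering map `λ` on the punctured surface. -/
def val (Q : C.Punctured) : ℂ := C.fn Q

lemma tendsto_fn_pole (i : Fin (m + 1)) : Tendsto C.fn (𝓝[≠] C.pole i) (Bornology.cobounded ℂ) := by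
  have hsource : ∀ᶠ P in 𝓝[≠] C.pole i, P ∈ (C.coord i).source :=
    nhdsWithin_le_nhds ((C.coord i).open_source.mem_nhds (C.pole_mem i))
  have hpow : Tendsto (fun P => C.coord i P ^ (n i + 1)) (𝓝[≠] C.pole i) (𝓝[≠] 0) := by
    refine tendsto_nhdsWithin_iff.2 ⟨?_, ?_⟩
    · have h := ((C.coord i).continuousAt (C.pole_mem i)).tendsto.pow (n i + 1)
      rw [C.coord_pole, zero_pow (Nat.succ_ne_zero _)] at h
      exact h.mono_left nhdsWithin_le_nhds
    · filter_upwards [hsource, self_mem_nhdsWithin] with P hP hne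
      exact pow_ne_zero _ (mt (C.coord_eq_zero_iff hP).1 hne)
  refine (tendsto_inv₀_nhdsNE_zero.comp hpow).congr' ?_
  filter_upwards [hsource, self_mem_nhdsWithin] with P hP hne
  exact (C.fn_eq i P hP hne).symm

lemma continuous_val : Continuous C.val :=
  continuous_iff_continuousAt.2 fun Q =>
    (C.holomorphic Q Q.2).continuousAt.comp continuous_subtype_val.continuousAt

lemma isProperMap_val [CompactSpace L] : IsProperMap C.val := by
  refine isProperMap_iff_ultrafilter.2 ⟨C.continuous_val, fun U y hU => ?_⟩
  obtain ⟨P, -, hP⟩ := isCompact_univ.ultrafilter_le_nhds (U.map Subtype.val) (by simp)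
  have hUP : Tendsto Subtype.val (U : Filter C.Punctured) (𝓝 P) := hP
  have hP_pole : P ∉ range C.pole := by
    rintro ⟨i, rfl⟩
    have hUP' : Tendsto Subtype.val (U : Filter C.Punctured) (𝓝[≠] C.pole i) :=
      tendsto_nhdsWithin_iff.2 ⟨hUP, Eventually.of_forall fun Q hQ => Q.2 ⟨i, hQ.symm⟩⟩
    exact ((C.tendsto_fn_pole i).comp hUP').not_tendsto (Metric.disjoint_cobounded_nhds y) hU
  have hU_le : (U : Filter C.Punctured) ≤ 𝓝 ⟨P, hP_pole⟩ := by
    rw [nhds_subtype_eq_comap]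
    exact tendsto_iff_comap.1 hUP
  exact ⟨⟨P, hP_pole⟩,
    tendsto_nhds_unique ((C.continuous_val.tendsto _).mono_left hU_le) hU, hU_le⟩

lemma analyticAt_chart [T2Space L] [IsManifold 𝓘(ℂ) ω L] {P : L} (hP : P ∉ range C.pole) :
    AnalyticAt ℂ (C.fn ∘ (chartAt ℂ P).symm) (chartAt ℂ P P) := by
  have : IsManifold 𝓘(ℂ) 1 L := IsManifold.of_le (n := ω) le_top
  have hW : (chartAt ℂ P).target ∩ (chartAt ℂ P).symm ⁻¹' (range C.pole)ᶜ ∈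
      𝓝 (chartAt ℂ P P) := by
    refine inter_mem ((chartAt ℂ P).open_target.mem_nhds (mem_chart_target ℂ P)) ?_
    refine ((chartAt ℂ P).continuousAt_symm (mem_chart_target ℂ P)).preimage_mem_nhds ?_
    rw [(chartAt ℂ P).left_inv (mem_chart_source ℂ P)]
    exact (finite_range C.pole).isClosed.isOpen_compl.mem_nhds hP
  refine DifferentiableOn.analyticAt (fun w hw => ?_) hW
  refine DifferentiableAt.differentiableWithinAt ?_
  rw [← mdifferentiableAt_iff_differentiableAt]
  exact (C.holomorphic _ hw.2).comp w (mdifferentiableAt_atlas_symm (chart_mem_atlas ℂ P) hw.1)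

lemma isLocalHomeomorphOn_singleton [T2Space L] {φ : OpenPartialHomeomorph L ℂ} {Q : C.Punctured}
    (hQ : (Q : L) ∈ φ.source) {c : ℂ} (hderiv : HasStrictDerivAt (C.fn ∘ φ.symm) c (φ Q))
    (hc : c ≠ 0) : IsLocalHomeomorphOn C.val {Q} := by
  have : Nonempty C.Punctured := ⟨Q⟩
  have hf := hderiv.hasStrictFDerivAt_equiv hc
  refine IsLocalHomeomorphOn.mk _ _ fun R hR => ?_
  obtain rfl : R = Q := hR
  refine ⟨((C.isOpenEmbedding_puncturedIncl.toOpenPartialHomeomorph _).trans φ).trans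
    (hf.toOpenPartialHomeomorph _), ?_, fun R hR => ?_⟩
  · have h := hf.mem_toOpenPartialHomeomorph_source
    simp [puncturedIncl, hQ, h]
  · have hRφ : (R : L) ∈ φ.source := by
      simp only [OpenPartialHomeomorph.trans_source, mem_inter_iff] at hR
      exact hR.1.2
    simp [val, puncturedIncl, φ.left_inv hRφ]

lemma eventually_unramified [T2Space L] [IsManifold 𝓘(ℂ) ω L] (P : C.Punctured) :
    ∀ᶠ Q in 𝓝[≠] P, C.val Q ≠ C.val P ∧ IsLocalHomeomorphOn C.val {Q} := by
  set φ := chartAt ℂ (P : L)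
  have hPφ : (P : L) ∈ φ.source := mem_chart_source ℂ (P : L)
  have hfn : ∀ Q : C.Punctured, (Q : L) ∈ φ.source → (C.fn ∘ φ.symm) (φ Q) = C.val Q :=
    fun Q hQ => congrArg C.fn (φ.left_inv hQ)
  have hsource : ∀ᶠ Q : C.Punctured in 𝓝[≠] P, (Q : L) ∈ φ.source :=
    nhdsWithin_le_nhds (continuous_subtype_val.continuousAt.preimage_mem_nhds
      (φ.open_source.mem_nhds hPφ))
  have hφ : Tendsto (fun Q : C.Punctured => φ Q) (𝓝[≠] P) (𝓝[≠] (φ P)) := by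
    refine tendsto_nhdsWithin_iff.2 ⟨?_, ?_⟩
    · exact ((φ.continuousAt hPφ).comp continuous_subtype_val.continuousAt).tendsto.mono_left
        nhdsWithin_le_nhds
    · filter_upwards [hsource, self_mem_nhdsWithin] with Q hQ hne h
      exact hne (Subtype.ext (φ.injOn hQ hPφ h))
  have hanalytic := C.analyticAt_chart P.2
  filter_upwards [hsource,
    hφ.eventually (eventually_deriv_ne_zero_and_ne hanalytic (C.simple P P.2)),
    hφ.eventually (hanalytic.eventually_analyticAt.filter_mono nhdsWithin_le_nhds)]
    with Q hQ ⟨hderiv, hne⟩ hQ_analytic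
  rw [hfn Q hQ, hfn P hPφ] at hne
  exact ⟨hne, C.isLocalHomeomorphOn_singleton hQ hQ_analytic.hasStrictDerivAt hderiv⟩

variable [T2Space L] [CompactSpace L] [IsManifold 𝓘(ℂ) ω L]

lemma finite_fiber (y : ℂ) : (C.val ⁻¹' {y}).Finite := by
  by_contra hinf
  obtain ⟨P, hP, hacc⟩ := Set.Infinite.exists_accPt_of_subset_isCompact hinf
    (C.isProperMap_val.isCompact_preimage isCompact_singleton) subset_rfl
  obtain ⟨Q, hQ, hne⟩ := ((accPt_iff_frequently_nhdsNE.1 hacc).and_eventually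
    (C.eventually_unramified P)).exists
  exact hne.1 (Eq.trans hQ hP.symm)

/-- The traces over the fibres near a ramified one are still coherent, since only the local
primitives near the finitely many points of a fibre enter. -/
lemma isCoherent_trace {ψ : C(I, C.Punctured) → M} {g : ℂ → C.Punctured → M}
    (hg : ∀ y, ∀ Q ∈ C.val ⁻¹' {y}, IsPrimitiveAt ψ (g y) Q) :
    IsCoherent fun y y' => ∑ᶠ Q ∈ C.val ⁻¹' {y'}, g y Q := by
  have := C.locallyPathConnectedSpace_punctured
  intro y
  have hnear : ∀ Q ∈ C.val ⁻¹' {y}, ∀ᶠ Q' in 𝓝 Q, IsPrimitiveAt ψ (g y) Q' ∧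
      (C.val Q' ≠ y → IsLocalHomeomorphOn C.val {Q'}) := fun Q hQ => by
    filter_upwards [(hg y Q hQ).eventually, eventually_nhdsWithin_iff.1
      (C.eventually_unramified Q)] with Q' hprim hunram
    exact ⟨hprim, fun hne => (hunram fun h => hne ((congrArg C.val h).trans hQ)).2⟩
  filter_upwards [C.isProperMap_val.isClosedMap.eventually_nhds_fiber y hnear] with x hx
  rcases eq_or_ne x y with rfl | hxy
  · simp
  have hloc : IsLocalHomeomorphOn C.val (C.val ⁻¹' {x}) := fun Q hQ =>
    (hx Q hQ).2 (fun h => hxy ((show C.val Q = x from hQ).symm.trans h)) Q rfl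
  filter_upwards [eventually_finsum_fiber_eq (g := fun Q => g y Q - g x Q)
    C.isProperMap_val.isClosedMap (C.finite_fiber x) hloc
    fun Q hQ => (hx Q hQ).1.eventually_sub_eq (hg x Q hQ)] with x' hx'
  rwa [finsum_mem_sub_distrib _ _ (C.finite_fiber x'),
    finsum_mem_sub_distrib _ _ (C.finite_fiber x)] at hx'

/-- The local traces glue because the plane is simply connected. -/
lemma exists_trace {ψ : C(I, C.Punctured) → M} (hψ : IsPathCocycle ψ) :
    ∃ (F : ℂ → M) (g : ℂ → C.Punctured → M), (∀ y, ∀ Q ∈ C.val ⁻¹' {y}, IsPrimitiveAt ψ (g y) Q) ∧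
      IsGlobalPrimitive (fun y y' => ∑ᶠ Q ∈ C.val ⁻¹' {y'}, g y Q) F := by
  choose h hh using C.exists_isPrimitiveAt hψ
  choose g hg using fun y => exists_eventuallyEq_of_finite (C.finite_fiber y) h
  have hprim : ∀ y, ∀ Q ∈ C.val ⁻¹' {y}, IsPrimitiveAt ψ (g y) Q := fun y Q hQ =>
    (hh Q).congr_add_const 0 ((hg y Q hQ).mono fun Q' hQ' => by rw [hQ', add_zero])
  obtain ⟨F, hF⟩ := (C.isCoherent_trace hprim).exists_isGlobalPrimitive
  exact ⟨F, g, hprim, hF⟩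

end HurwitzCovering

/-! ### The residue theorem -/

/-- The logarithms of the numbers `x` with `x ^ (-(d + 1)) = exp s`, that is, of the possible local
parameters at a pole of order `d + 1` of the points over `exp s`. -/
def sheetLog (d : ℕ) (j : ℤ) (s : ℂ) : ℂ :=
  (-s + j * (2 * Real.pi * Complex.I)) / (d + 1)

section SheetLog

variable {d : ℕ} {j j' : ℤ} {s : ℂ}

lemma continuous_sheetLog : Continuous (sheetLog d j) := by
  unfold sheetLog
  fun_prop

lemma re_sheetLog : (sheetLog d j s).re = -s.re / (d + 1) := by
  rw [sheetLog, ← Nat.cast_add_one, Complex.div_natCast_re]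
  simp

lemma sheetLog_add_period : sheetLog d j (s + 2 * Real.pi * Complex.I) = sheetLog d (j - 1) s := by
  simp only [sheetLog]
  push_cast
  ring

lemma sheetLog_add_degree (l : ℤ) :
    sheetLog d (j + l * (d + 1)) s = sheetLog d j s + l * (2 * Real.pi * Complex.I) := by
  simp only [sheetLog]
  push_cast
  field

lemma sheetLog_injective : Function.Injective fun j => sheetLog d j s := fun j j' h => by
  have hd := Nat.cast_add_one_ne_zero (R := ℂ) d
  exact_mod_cast mul_right_cancel₀ Complex.two_pi_I_ne_zero
    (add_left_cancel ((div_left_inj' hd).1 h))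

lemma exp_sheetLog_eq_iff :
    Complex.exp (sheetLog d j s) = Complex.exp (sheetLog d j' s) ↔ j ≡ j' [ZMOD d + 1] := by
  rw [Complex.exp_eq_exp_iff_exists_int, Int.modEq_comm, Int.modEq_iff_add_fac]
  simp only [← sheetLog_add_degree, sheetLog_injective.eq_iff, mul_comm ((d : ℤ) + 1)]

lemma inv_exp_pow_eq_iff {w : ℂ} : (Complex.exp w ^ (d + 1))⁻¹ = Complex.exp s ↔
    ∃ j : Fin (d + 1), Complex.exp (sheetLog d (j : ℕ) s) = Complex.exp w := by
  have hd := Nat.cast_add_one_ne_zero (R := ℂ) d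
  rw [← Complex.exp_nat_mul, ← Complex.exp_neg]
  push_cast
  constructor
  · intro h
    obtain ⟨l, hl⟩ := Complex.exp_eq_exp_iff_exists_int.1 h
    have hw : w = sheetLog d (-l) s := by
      rw [sheetLog, eq_div_iff hd]
      push_cast
      linear_combination -hl
    obtain ⟨j, hj_lt, hj⟩ := Int.existsUnique_equiv_nat (-l) (b := d + 1) (by positivity)
    exact ⟨⟨j, by omega⟩, hw ▸ exp_sheetLog_eq_iff.2 hj⟩
  · rintro ⟨j, hj⟩
    obtain ⟨l, hl⟩ := Complex.exp_eq_exp_iff_exists_int.1 hj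
    refine Complex.exp_eq_exp_iff_exists_int.2 ⟨l * (d + 1) - j, ?_⟩
    rw [sheetLog, div_eq_iff hd] at hl
    push_cast at hl ⊢
    linear_combination hl

lemma sum_sheetLog_sub_sum_sheetLog_add_period {M : Type*} [AddCommGroup M] (k : ℂ → M) :
    ∑ j : Fin (d + 1), k (sheetLog d (j : ℕ) s) -
      ∑ j : Fin (d + 1), k (sheetLog d (j : ℕ) (s + 2 * Real.pi * Complex.I)) =
    k (sheetLog d d s) - k (sheetLog d (-1) s) := by
  let A : ℕ → M := fun j => k (sheetLog d ((j : ℤ) - 1) s)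
  have hA : ∀ j : ℕ, k (sheetLog d j s) = A (j + 1) := fun j => by simp [A]
  simp only [sheetLog_add_period, hA]
  rw [← Finset.sum_sub_distrib, Fin.sum_univ_eq_sum_range (fun j => A (j + 1) - A j),
    Finset.sum_range_sub]
  simp [A]

end SheetLog

namespace HurwitzCovering

variable {L M : Type*} [TopologicalSpace L] [ChartedSpace ℂ L] {m : ℕ} {n : Fin (m + 1) → ℕ}
  (C : HurwitzCovering L m n) [AddCommGroup M]

/-- All the points over `exp s` lie in the coordinate discs, and all the local parameters of points
over `exp s` that are possible for the orders of the poles occur. -/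
def IsNearInfinity (s : ℂ) : Prop :=
  (∀ (i : Fin (m + 1)) (j : ℤ), sheetLog (n i) j s ∈ C.logDisc i) ∧
    ∀ Q ∈ C.val ⁻¹' {Complex.exp s}, ∃ i, (Q : L) ∈ (C.coord i).source

/-- The point over `exp s` on a given sheet at infinity. -/
def sheetPoint (s : ℂ) (p : (i : Fin (m + 1)) × Fin (n i + 1)) : C.Punctured :=
  C.expPoint p.1 (sheetLog (n p.1) (p.2 : ℕ) s)

variable {s : ℂ}

lemma val_eq_inv_coord_pow {i : Fin (m + 1)} {Q : C.Punctured} (hQ : (Q : L) ∈ (C.coord i).source) :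
    C.val Q = (C.coord i Q ^ (n i + 1))⁻¹ :=
  C.fn_eq i Q hQ fun h => Q.2 ⟨i, h.symm⟩

lemma val_sheetPoint (hs : C.IsNearInfinity s) (p : (i : Fin (m + 1)) × Fin (n i + 1)) :
    C.val (C.sheetPoint s p) = Complex.exp s := by
  rw [sheetPoint, C.val_eq_inv_coord_pow (C.expPoint_mem_source (hs.1 _ _)),
    C.coord_expPoint (hs.1 _ _)]
  exact inv_exp_pow_eq_iff.2 ⟨p.2, rfl⟩

lemma sheetPoint_injective (hs : C.IsNearInfinity s) : Function.Injective (C.sheetPoint s) := by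
  rintro ⟨i, j⟩ ⟨i', j'⟩ h
  obtain rfl : i = i' := by
    by_contra hne
    refine disjoint_left.1 (C.coord_disjoint hne) (C.expPoint_mem_source (hs.1 i (j : ℕ))) ?_
    exact congrArg (fun Q : C.Punctured => (Q : L) ∈ (C.coord i').source) h |>.mpr
      (C.expPoint_mem_source (hs.1 i' (j' : ℕ)))
  have hexp := congrArg (fun Q : C.Punctured => C.coord i Q) h
  simp only [sheetPoint, C.coord_expPoint (hs.1 i _)] at hexp
  have hmod : (j : ℕ) ≡ j' [MOD n i + 1] := Int.natCast_modEq_iff.1 <| by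
    push_cast
    exact exp_sheetLog_eq_iff.1 hexp
  rw [Fin.ext (hmod.eq_of_lt_of_lt j.2 j'.2)]

lemma range_sheetPoint (hs : C.IsNearInfinity s) :
    range (C.sheetPoint s) = C.val ⁻¹' {Complex.exp s} := by
  refine Subset.antisymm (range_subset_iff.2 (C.val_sheetPoint hs)) fun Q hQ => ?_
  obtain ⟨i, hi⟩ := hs.2 Q hQ
  have hexp_log := Complex.exp_log (C.coord_ne_zero hi Q.2)
  obtain ⟨j, hj⟩ := inv_exp_pow_eq_iff (s := s) (d := n i)
    (w := Complex.log (C.coord i Q)) |>.1 <| by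
    rw [hexp_log, ← C.val_eq_inv_coord_pow hi]
    exact hQ
  exact ⟨⟨i, j⟩, C.expPoint_eq hi (hj.trans hexp_log)⟩

lemma finsum_fiber_eq_sum_sheetPoint (hs : C.IsNearInfinity s) (h : C.Punctured → M) :
    ∑ᶠ Q ∈ C.val ⁻¹' {Complex.exp s}, h Q = ∑ p, h (C.sheetPoint s p) := by
  rw [← C.range_sheetPoint hs, finsum_mem_range (C.sheetPoint_injective hs),
    finsum_eq_sum_of_fintype]

lemma eventually_sub_sum_sheetLog_eq {ψ : C(I, C.Punctured) → M} {k : Fin (m + 1) → ℂ → M}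
    (hk : ∀ i, IsPrimitiveAlong ψ (C.expPoint i) (C.logDisc i) (k i))
    {g : ℂ → C.Punctured → M} (hg : ∀ y, ∀ Q ∈ C.val ⁻¹' {y}, IsPrimitiveAt ψ (g y) Q) {F : ℂ → M}
    (hF : IsGlobalPrimitive (fun y y' => ∑ᶠ Q ∈ C.val ⁻¹' {y'}, g y Q) F)
    (hs : ∀ᶠ s' in 𝓝 s, C.IsNearInfinity s') :
    let K := fun s : ℂ => ∑ p : (i : Fin (m + 1)) × Fin (n i + 1),
      k p.1 (sheetLog (n p.1) (p.2 : ℕ) s)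
    ∀ᶠ s' in 𝓝 s, F (Complex.exp s') - K s' = F (Complex.exp s) - K s := by
  intro K
  have hs₀ := hs.self_of_nhds
  have hsheets : ∀ᶠ s' in 𝓝 s, ∀ p : (i : Fin (m + 1)) × Fin (n i + 1),
      k p.1 (sheetLog (n p.1) (p.2 : ℕ) s') - g (Complex.exp s) (C.sheetPoint s' p) =
        k p.1 (sheetLog (n p.1) (p.2 : ℕ) s) - g (Complex.exp s) (C.sheetPoint s p) :=
    eventually_all.2 fun p => continuous_sheetLog.continuousAt.eventually <|
      (hk p.1).eventually_sub_eq C.continuousOn_expPoint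
        ((C.isOpen_logDisc p.1).mem_nhds (hs₀.1 _ _)) (hg _ _ (C.val_sheetPoint hs₀ p))
  filter_upwards [Complex.continuous_exp.continuousAt.eventually (hF (Complex.exp s)), hs, hsheets]
    with s' hF_eq hs' hsheets_eq
  rw [C.finsum_fiber_eq_sum_sheetPoint hs', C.finsum_fiber_eq_sum_sheetPoint hs₀] at hF_eq
  have hK_eq : K s' - ∑ p, g (Complex.exp s) (C.sheetPoint s' p) =
      K s - ∑ p, g (Complex.exp s) (C.sheetPoint s p) := by
    simp only [K, ← Finset.sum_sub_distrib, hsheets_eq]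
  rw [← sub_sub_sub_cancel_right (F (Complex.exp s')), hF_eq, hK_eq, sub_sub_sub_cancel_right]

lemma exists_isNearInfinity_of_lt_re [CompactSpace L] :
    ∃ S : ℝ, ∀ s : ℂ, S < s.re → C.IsNearInfinity s := by
  have hcompact : IsCompact (⋃ i, (C.coord i).source)ᶜ :=
    (isOpen_iUnion fun i => (C.coord i).open_source).isClosed_compl.isCompact
  have hcont : ContinuousOn C.fn (⋃ i, (C.coord i).source)ᶜ := fun P hP =>
    (C.holomorphic P fun ⟨i, hi⟩ =>
      hP (mem_iUnion.2 ⟨i, hi ▸ C.pole_mem i⟩)).continuousAt.continuousWithinAt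
  obtain ⟨R, hR⟩ := (hcompact.image_of_continuousOn hcont).isBounded.exists_norm_le
  obtain ⟨S, hS⟩ := (finite_range fun i => -((n i + 1 : ℝ) * Real.log (C.radius i))).bddAbove
  refine ⟨max R S, fun s hs => ⟨fun i j => ?_, fun Q hQ => ?_⟩⟩
  · have hSi : -((n i + 1 : ℝ) * Real.log (C.radius i)) ≤ S := hS ⟨i, rfl⟩
    have hs_lt := (le_max_right R S).trans_lt hs
    change (sheetLog (n i) j s).re < _
    rw [re_sheetLog, div_lt_iff₀ (by positivity)]
    linarith
  · by_contra hne
    have hnorm := hR _ ⟨Q, fun h => hne (mem_iUnion.1 h), rfl⟩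
    have hs_lt := (le_max_left R S).trans_lt hs
    rw [show C.fn Q = Complex.exp s from hQ, Complex.norm_exp] at hnorm
    linarith [Real.add_one_le_exp s.re]

/-- The trace is exact on the plane, so it has no period along a large circle. Continuing the
primitives along the lift of this circle permutes the sheets at each `∞_i` cyclically, and a full
cycle contributes the residue. -/
lemma sum_residue_eq_zero [T2Space L] [CompactSpace L] [IsManifold 𝓘(ℂ) ω L]
    {ψ : C(I, C.Punctured) → M} (hψ : IsPathCocycle ψ)
    {ρ : Fin (m + 1) → ℝ} (h0 : ∀ i, 0 < ρ i) (hr : ∀ i, ρ i < C.radius i) :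
    ∑ i, ψ (C.circleLoop i (ρ i) (h0 i) (hr i)).toContinuousMap = 0 := by
  choose k c hk hper hc using fun i => C.exists_residue i hψ
  obtain ⟨F, g, hg, hF⟩ := C.exists_trace hψ
  obtain ⟨S, hS⟩ := C.exists_isNearInfinity_of_lt_re
  have : PreconnectedSpace {s : ℂ | S < s.re} :=
    Subtype.preconnectedSpace (convex_halfSpace_re_gt S).isPreconnected
  let s₀ : ℂ := ((S + 1 : ℝ) : ℂ)
  have hs₀ : S < s₀.re := by simp [s₀]
  have hs₁ : S < (s₀ + 2 * Real.pi * Complex.I).re := by simp [s₀]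
  have hconst := eq_of_eventually_sub_eq (Y := {s : ℂ | S < s.re})
    (F := fun s => F (Complex.exp s)) (fun s => continuous_subtype_val.continuousAt.eventually
      (C.eventually_sub_sum_sheetLog_eq hk hg hF
        ((Complex.continuous_re.continuousAt.eventually_const_lt s.2).mono hS))) ⟨_, hs₀⟩ ⟨_, hs₁⟩
  simp only [Complex.exp_periodic s₀, sub_self, Fintype.sum_sigma] at hconst
  rw [hconst, ← Finset.sum_sub_distrib]
  refine Finset.sum_congr rfl fun i _ => ?_
  have hcycle : sheetLog (n i) (n i) s₀ = sheetLog (n i) (-1) s₀ + (1 : ℤ) *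
      (2 * Real.pi * Complex.I) := by
    rw [← sheetLog_add_degree]
    congr 1
    ring
  rw [hc, sum_sheetLog_sub_sum_sheetLog_add_period, hcycle, hper i _ ((hS s₀ hs₀).1 i (-1)),
    one_smul, add_sub_cancel_left]

end HurwitzCovering

/-! ### The topology of the blow-up -/

section Embedding

variable {X Y Z M : Type*} [TopologicalSpace X] [TopologicalSpace Y] [TopologicalSpace Z]

lemma exists_comp_eq_of_forall_mem_range {e : C(Y, X)} (he : IsEmbedding e) {γ : C(Z, X)}
    (hγ : ∀ t, γ t ∈ range e) : ∃ η : C(Z, Y), e.comp η = γ := by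
  choose η hη using hγ
  exact ⟨⟨η, he.continuous_iff.2 (γ.continuous.congr fun t => (hη t).symm)⟩, ContinuousMap.ext hη⟩

lemma isPrimitiveAt_of_isOpenEmbedding [AddCommGroup M] {ψ : C(I, X) → M} {h : X → M} {e : C(Y, X)}
    (he : IsOpenEmbedding e) (hψ : ∀ γ : C(I, Y), ψ (e.comp γ) = increment h (e.comp γ)) (y : Y) :
    IsPrimitiveAt ψ h (e y) :=
  ⟨range e, he.isOpen_range.mem_nhds ⟨y, rfl⟩, fun γ hγ => by
    obtain ⟨η, rfl⟩ := exists_comp_eq_of_forall_mem_range he.isEmbedding hγ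
    exact hψ η⟩

end Embedding

/-- The direction of a non-zero complex number. -/
def circleDir (w : ℂ) : Circle := Circle.exp w.arg

lemma norm_mul_circleDir (w : ℂ) : (‖w‖ : ℂ) * circleDir w = w := by
  rw [circleDir, Circle.coe_exp, Complex.norm_mul_exp_arg_mul_I]

lemma circleDir_mul {ρ : ℝ} (hρ : 0 < ρ) (u : Circle) : circleDir (ρ * u) = u := by
  have h := norm_mul_circleDir (ρ * u)
  rw [HurwitzCovering.norm_polar hρ.le] at h
  exact Circle.ext (mul_left_cancel₀ (by exact_mod_cast hρ.ne') h)

lemma continuousOn_circleDir : ContinuousOn circleDir {0}ᶜ := by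
  rw [continuousOn_iff_continuous_domRestrict]
  refine continuous_induced_rng.2 ?_
  have hne : ∀ w : ({0}ᶜ : Set ℂ), ((‖(w : ℂ)‖ : ℝ) : ℂ) ≠ 0 := fun w =>
    Complex.ofReal_ne_zero.2 (norm_ne_zero_iff.2 w.2)
  have hdiv : Continuous fun w : ({0}ᶜ : Set ℂ) => (w : ℂ) / (‖(w : ℂ)‖ : ℂ) :=
    continuous_subtype_val.div (by fun_prop) hne
  refine hdiv.congr fun w => ?_
  rw [div_eq_iff (hne w), mul_comm]
  exact (norm_mul_circleDir w).symm

namespace HurwitzCovering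

variable {L M : Type*} [TopologicalSpace L] [ChartedSpace ℂ L] {m : ℕ} {n : Fin (m + 1) → ℕ}
  (C : HurwitzCovering L m n) [AddCommGroup M] (z : ℂ) {i j : Fin (m + 1)}

lemma isOpen_blow_iff {S : Set (C.Blow z)} : IsOpen S ↔
    IsOpen ((fun P : C.Punctured => (Blow.interior P : C.Blow z)) ⁻¹' S) ∧
      ∀ i, IsOpen (C.collarMap z i ⁻¹' S) :=
  isOpen_sup.trans (and_congr Iff.rfl isOpen_iSup_iff)

/-- The inclusion of the interior of the blow-up. -/
def interiorIncl : C(C.Punctured, C.Blow z) := ⟨Blow.interior, C.continuous_interior z⟩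

/-- The inclusion of the collar of the boundary circle over `∞_i`. -/
def collarIncl (i : Fin (m + 1)) : C(C.Collar z i, C.Blow z) :=
  ⟨C.collarMap z i, C.continuous_collarMap z i⟩

/-- The point of `L` below a point of the collar. -/
def collarPoint (p : C.Collar z i) : L := (C.coord i).symm ((p.1.1 : ℂ) * (p.1.2 : ℂ))

/-- The point of the collar over a point of the punctured coordinate disc. -/
def polarCoord (P : {P : C.Punctured // (P : L) ∈ (C.coord i).source}) : C.Collar z i :=
  ⟨(‖C.coord i P‖, circleDir (C.coord i P)), norm_nonneg _, by
    simpa [C.coord_target] using (C.coord i).map_source P.2,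
    fun h => absurd (norm_eq_zero.1 h) (C.coord_ne_zero P.2 P.1.2)⟩

lemma continuous_polarCoord : Continuous (C.polarCoord z (i := i)) := by
  have hcoord : Continuous fun P : {P : C.Punctured // (P : L) ∈ (C.coord i).source} =>
      C.coord i P := (C.coord i).continuousOn.comp_continuous (by fun_prop) fun P => P.2
  exact Continuous.subtype_mk (hcoord.norm.prodMk
    (continuousOn_circleDir.comp_continuous hcoord fun P => C.coord_ne_zero P.2 P.1.2)) _

variable {z}

lemma collarPoint_coord_mem (p : C.Collar z i) :
    (p.1.1 : ℂ) * (p.1.2 : ℂ) ∈ (C.coord i).target := by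
  rw [C.coord_target, mem_ball_zero_iff, norm_polar p.2.1]
  exact p.2.2.1

lemma collarPoint_mem_source (p : C.Collar z i) : C.collarPoint z p ∈ (C.coord i).source :=
  (C.coord i).map_target (C.collarPoint_coord_mem p)

lemma coord_collarPoint (p : C.Collar z i) :
    C.coord i (C.collarPoint z p) = (p.1.1 : ℂ) * (p.1.2 : ℂ) :=
  (C.coord i).right_inv (C.collarPoint_coord_mem p)

lemma continuous_collarPoint : Continuous (C.collarPoint z (i := i)) :=
  (C.coord i).continuousOn_symm.comp_continuous (by fun_prop) C.collarPoint_coord_mem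

lemma collarMap_eq_boundary_iff {p : C.Collar z i} {u : C.arcs z j} :
    C.collarMap z i p = Blow.boundary j u ↔ p.1.1 = 0 ∧ i = j ∧ p.1.2 = u := by
  rw [collarMap]
  split_ifs with h
  · simp only [Blow.boundary.injEq, h, true_and]
    constructor
    · rintro ⟨rfl, h⟩
      exact ⟨rfl, congrArg Subtype.val (eq_of_heq h)⟩
    · rintro ⟨rfl, h⟩
      exact ⟨rfl, heq_of_eq (Subtype.ext h)⟩
  · simp [h]

lemma collarMap_eq_boundary {p : C.Collar z i} (hp : p.1.1 = 0) :
    C.collarMap z i p = Blow.boundary i ⟨p.1.2, p.2.2.2 hp⟩ :=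
  C.collarMap_eq_boundary_iff.2 ⟨hp, rfl, rfl⟩

lemma collarMap_eq_interior_iff {p : C.Collar z i} {P : C.Punctured} :
    C.collarMap z i p = Blow.interior P ↔ p.1.1 ≠ 0 ∧ C.collarPoint z p = P := by
  rw [collarMap]
  split_ifs with h
  · simp [h]
  · simp only [Blow.interior.injEq, Subtype.ext_iff]
    exact ⟨fun h' => ⟨h, h'⟩, fun h' => h'.2⟩

lemma collarMap_eq_interior_iff_polarCoord_eq {p : C.Collar z i} {P : C.Punctured} :
    C.collarMap z i p = Blow.interior P ↔
      ∃ hP : (P : L) ∈ (C.coord i).source, C.polarCoord z ⟨P, hP⟩ = p := by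
  rw [collarMap_eq_interior_iff]
  constructor
  · rintro ⟨hp, hpP⟩
    have hcoord : C.coord i P = p.1.1 * p.1.2 := by rw [← hpP, coord_collarPoint]
    refine ⟨hpP ▸ C.collarPoint_mem_source p, Subtype.ext (Prod.ext ?_ ?_)⟩
    · simp only [polarCoord, hcoord, norm_polar p.2.1]
    · simp only [polarCoord, hcoord, circleDir_mul (lt_of_le_of_ne p.2.1 (Ne.symm hp))]
  · rintro ⟨hP, rfl⟩
    refine ⟨norm_ne_zero_iff.2 (C.coord_ne_zero hP P.2), ?_⟩
    simp only [collarPoint, polarCoord, norm_mul_circleDir, (C.coord i).left_inv hP]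

lemma eq_of_collarMap_eq {p : C.Collar z i} {q : C.Collar z j}
    (h : C.collarMap z i p = C.collarMap z j q) : i = j := by
  rcases hq : C.collarMap z j q with P | ⟨l, u⟩
  · by_contra hne
    obtain ⟨hPi, -⟩ := C.collarMap_eq_interior_iff_polarCoord_eq.1 (h.trans hq)
    obtain ⟨hPj, -⟩ := C.collarMap_eq_interior_iff_polarCoord_eq.1 hq
    exact disjoint_left.1 (C.coord_disjoint hne) hPi hPj
  · exact (C.collarMap_eq_boundary_iff.1 (h.trans hq)).2.1.trans
      (C.collarMap_eq_boundary_iff.1 hq).2.1.symm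

lemma collarMap_injective : Function.Injective (C.collarMap z i) := fun p q h => by
  rcases hq : C.collarMap z i q with P | ⟨l, u⟩
  · obtain ⟨hP, rfl⟩ := C.collarMap_eq_interior_iff_polarCoord_eq.1 (h.trans hq)
    obtain ⟨-, rfl⟩ := C.collarMap_eq_interior_iff_polarCoord_eq.1 hq
    rfl
  · obtain ⟨hp₀, -, hpu⟩ := C.collarMap_eq_boundary_iff.1 (h.trans hq)
    obtain ⟨hq₀, -, hqu⟩ := C.collarMap_eq_boundary_iff.1 hq
    exact Subtype.ext (Prod.ext (hp₀.trans hq₀.symm) (hpu.trans hqu.symm))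

lemma isOpenEmbedding_interiorIncl [T2Space L] : IsOpenEmbedding (C.interiorIncl z) := by
  have hinj : Function.Injective (C.interiorIncl z) := fun P Q h => by injection h
  refine .of_continuous_injective_isOpenMap (C.interiorIncl z).continuous hinj fun O hO =>
    (C.isOpen_blow_iff z).2 ⟨by rwa [← preimage_image_eq O hinj] at hO, fun i => ?_⟩
  have hpreimage : C.collarMap z i ⁻¹' (C.interiorIncl z '' O) =
      {p | p.1.1 ≠ 0} ∩ C.collarPoint z ⁻¹' (C.puncturedIncl '' O) := by
    ext p
    constructor
    · rintro ⟨P, hP, hPp⟩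
      obtain ⟨hp, hpP⟩ := C.collarMap_eq_interior_iff.1 hPp.symm
      exact ⟨hp, P, hP, hpP.symm⟩
    · rintro ⟨hp, P, hP, hPp⟩
      exact ⟨P, hP, (C.collarMap_eq_interior_iff.2 ⟨hp, hPp.symm⟩).symm⟩
  rw [hpreimage]
  exact (isOpen_ne_fun (by fun_prop) continuous_const).inter
    ((C.isOpenEmbedding_puncturedIncl.isOpenMap O hO).preimage C.continuous_collarPoint)

lemma isOpenEmbedding_collarIncl : IsOpenEmbedding (C.collarIncl z i) := by
  refine .of_continuous_injective_isOpenMap (C.collarIncl z i).continuous C.collarMap_injective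
    fun O hO => (C.isOpen_blow_iff z).2 ⟨?_, fun j => ?_⟩
  · have hpreimage : (fun P : C.Punctured => (Blow.interior P : C.Blow z)) ⁻¹'
        (C.collarIncl z i '' O) = Subtype.val '' (C.polarCoord z (i := i) ⁻¹' O) := by
      ext P
      constructor
      · rintro ⟨p, hp, hpP⟩
        obtain ⟨hP, rfl⟩ := C.collarMap_eq_interior_iff_polarCoord_eq.1 hpP
        exact ⟨⟨P, hP⟩, hp, rfl⟩
      · rintro ⟨⟨P, hP⟩, hPO, rfl⟩
        exact ⟨_, hPO, C.collarMap_eq_interior_iff_polarCoord_eq.2 ⟨hP, rfl⟩⟩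
    rw [hpreimage]
    exact ((C.coord i).open_source.preimage continuous_subtype_val).isOpenEmbedding_subtypeVal
      |>.isOpenMap _ (hO.preimage (C.continuous_polarCoord z))
  · by_cases hij : i = j
    · subst hij
      rwa [← preimage_image_eq O C.collarMap_injective] at hO
    · convert isOpen_empty
      refine eq_empty_of_forall_notMem fun q => ?_
      rintro ⟨p, -, hp⟩
      exact hij (C.eq_of_collarMap_eq hp)

/-! ### Extending primitives to the boundary of the blow-up -/

/-- The homotopy that pushes the collar outwards to the circle of half the radius. -/
def collarPush (i : Fin (m + 1)) : C(I × C.Collar z i, C.Collar z i) where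
  toFun q := ⟨((1 - q.1) * q.2.1.1 + q.1 * (C.radius i / 2), q.2.1.2), by
    have hr := C.radius_pos i
    obtain ⟨⟨t, ht₀, ht₁⟩, ⟨ρ, u⟩, hρ₀, hρ, hu⟩ := q
    refine ⟨add_nonneg (mul_nonneg (sub_nonneg.2 ht₁) hρ₀) (mul_nonneg ht₀ (half_pos hr).le),
      by dsimp only at *; nlinarith, fun h => hu ?_⟩
    dsimp only at *
    obtain ⟨h₁, h₂⟩ := (add_eq_zero_iff_of_nonneg (mul_nonneg (sub_nonneg.2 ht₁) hρ₀)
      (mul_nonneg ht₀ (half_pos hr).le)).1 h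
    obtain rfl := (mul_eq_zero.1 h₂).resolve_right (half_pos hr).ne'
    simpa using h₁⟩

/-- The path from a point of the collar to the circle of half the radius. -/
def radialPath (p : C.Collar z i) : C(I, C.Blow z) :=
  (C.collarIncl z i).comp ((C.collarPush i).comp ⟨fun t => (t, p), by fun_prop⟩)

/-- The circle of half the radius of the coordinate disc. -/
def halfCircle (i : Fin (m + 1)) : C(Circle, C.Punctured) where
  toFun := C.polarPoint i (C.radius i / 2) (half_pos (C.radius_pos i))
    (half_lt_self (C.radius_pos i))
  continuous_toFun := Continuous.subtype_mk ((C.coord i).continuousOn_symm.comp_continuous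
    (by fun_prop) fun u => by
      rw [C.coord_target, mem_ball_zero_iff, norm_polar (half_pos (C.radius_pos i)).le]
      exact half_lt_self (C.radius_pos i)) _

lemma collarMap_collarPush_one (p : C.Collar z i) :
    C.collarMap z i (C.collarPush i (1, p)) = Blow.interior (C.halfCircle i p.1.2) := by
  refine C.collarMap_eq_interior_iff.2 ⟨?_, ?_⟩
  · simpa [collarPush] using (C.radius_pos i).ne'
  · change (C.coord i).symm _ = (C.coord i).symm _
    simp [collarPush]

lemma collarPush_zero (p : C.Collar z i) : C.collarPush i (0, p) = p :=
  Subtype.ext (Prod.ext (by simp [collarPush]) rfl)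

section ExtendPrimitive

variable {ψ : C(I, C.Blow z) → M} {h : C.Punctured → M}
  (hh : ∀ γ : C(I, C.Punctured), ψ ((C.interiorIncl z).comp γ) = increment h γ)

include hh

/-- The square swept out by pushing `γ` outwards. -/
lemma eq_increment_collar (hψ : IsPathCocycle ψ) (γ : C(I, C.Collar z i)) :
    ψ ((C.collarIncl z i).comp γ) =
      increment (fun p => h (C.halfCircle i p.1.2) - ψ (C.radialPath p)) γ := by
  have hsquare := hψ.square ((C.collarIncl z i).comp
    ((C.collarPush i).comp ⟨fun q : I × I => (q.2, γ q.1), by fun_prop⟩))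
  have hstart : (⟨fun s => C.collarIncl z i (C.collarPush i (0, γ s)), by fun_prop⟩ :
      C(I, C.Blow z)) = (C.collarIncl z i).comp γ :=
    ContinuousMap.ext fun s => congrArg (C.collarIncl z i) (C.collarPush_zero (γ s))
  have hend : (⟨fun s => C.collarIncl z i (C.collarPush i (1, γ s)), by fun_prop⟩ :
      C(I, C.Blow z)) = (C.interiorIncl z).comp ((C.halfCircle i).comp
        ⟨fun s => (γ s).1.2, by fun_prop⟩) :=
    ContinuousMap.ext fun s => C.collarMap_collarPush_one (γ s)
  simp only [ContinuousMap.comp_apply, ContinuousMap.coe_mk, hstart, hend, hh] at hsquare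
  rw [eq_sub_of_add_eq hsquare]
  simp only [increment]
  change ψ (C.radialPath (γ 0)) + (h (C.halfCircle i (γ 1).1.2) - h (C.halfCircle i (γ 0).1.2)) -
    ψ (C.radialPath (γ 1)) = _
  abel

lemma eq_sub_radialPath [T2Space L] {p : C.Collar z i} {P : C.Punctured}
    (hp : C.collarMap z i p = Blow.interior P) :
    h P = h (C.halfCircle i p.1.2) - ψ (C.radialPath p) := by
  have hp₀ : 0 < p.1.1 := lt_of_le_of_ne p.2.1 (C.collarMap_eq_interior_iff.1 hp).1.symm
  have hinterior : ∀ t, C.radialPath p t ∈ range (C.interiorIncl z) := fun t => by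
    have hpos : 0 < (C.collarPush i (t, p)).1.1 := by
      have hr := C.radius_pos i
      change 0 < (1 - (t : ℝ)) * p.1.1 + t * (C.radius i / 2)
      rcases t.2.1.eq_or_lt with ht | ht
      · simpa [← ht] using hp₀
      · have ht₁ := sub_nonneg.2 t.2.2
        positivity
    exact ⟨C.polarPoint i _ hpos (C.collarPush i (t, p)).2.2.1 _,
      (show C.collarMap z i _ = _ from dif_neg hpos.ne').symm⟩
  obtain ⟨η, hη⟩ := exists_comp_eq_of_forall_mem_range
    C.isOpenEmbedding_interiorIncl.isEmbedding hinterior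
  have hη₀ : η 0 = P := C.isOpenEmbedding_interiorIncl.injective <|
    (DFunLike.congr_fun hη 0).trans ((congrArg (C.collarMap z i) (C.collarPush_zero p)).trans hp)
  have hη₁ : η 1 = C.halfCircle i p.1.2 := C.isOpenEmbedding_interiorIncl.injective <|
    (DFunLike.congr_fun hη 1).trans (C.collarMap_collarPush_one p)
  rw [← hη, hh, increment, hη₀, hη₁, sub_sub_cancel]

lemma exists_eq_increment_of_interior [T2Space L] (hψ : IsPathCocycle ψ) :
    ∃ H : C.Blow z → M, ∀ γ, ψ γ = increment H γ := by
  let H : C.Blow z → M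
    | .interior P => h P
    | .boundary i u => h (C.halfCircle i u) -
        ψ (C.radialPath ⟨(0, u), le_rfl, C.radius_pos i, fun _ => u.2⟩)
  have hcollar : ∀ i (p : C.Collar z i),
      H (C.collarMap z i p) = h (C.halfCircle i p.1.2) - ψ (C.radialPath p) := fun i p => by
    rcases hx : C.collarMap z i p with P | ⟨j, u⟩
    · exact C.eq_sub_radialPath hh hx
    · obtain ⟨hp₀, rfl, hu⟩ := C.collarMap_eq_boundary_iff.1 hx
      have hp : p = ⟨(0, u), le_rfl, C.radius_pos i, fun _ => u.2⟩ := Subtype.ext (Prod.ext hp₀ hu)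
      rw [hp]
  refine ⟨H, fun γ => hψ.eq_increment_of_isPrimitiveAt fun t => ?_⟩
  rcases γ t with P | ⟨i, u⟩
  · exact isPrimitiveAt_of_isOpenEmbedding C.isOpenEmbedding_interiorIncl hh P
  · rw [← C.collarMap_eq_boundary (p := ⟨(0, u), le_rfl, C.radius_pos i, fun _ => u.2⟩) rfl]
    refine isPrimitiveAt_of_isOpenEmbedding C.isOpenEmbedding_collarIncl (fun η => ?_) _
    rw [C.eq_increment_collar hh hψ, increment, ← hcollar, ← hcollar]
    rfl

end ExtendPrimitive

end HurwitzCovering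

/-! ### The arcs of the boundary -/

namespace HurwitzCovering

variable {L M : Type*} [TopologicalSpace L] [ChartedSpace ℂ L] {m : ℕ} {n : Fin (m + 1) → ℕ}
  (C : HurwitzCovering L m n) (z : ℂ) (i : Fin (m + 1))

/-- The number, modulo `n i + 1`, of the arc at `∞_i` which contains the direction `u`. -/
def arcNumber (_C : HurwitzCovering L m n) (z : ℂ) (i : Fin (m + 1)) (u : Circle) :
    ZMod (n i + 1) :=
  (⌊((n i + 1) * (u : ℂ).arg - z.arg) / (2 * Real.pi)⌋ : ℤ)

lemma arcNumber_exp (θ : ℝ) : C.arcNumber z i (Circle.exp θ) =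
    (⌊((n i + 1) * θ - z.arg) / (2 * Real.pi)⌋ : ℤ) := by
  obtain ⟨l, hl⟩ := Circle.exp_eq_exp.1 (Circle.exp_arg (Circle.exp θ)).symm
  have hshift : ((n i + 1) * θ - z.arg) / (2 * Real.pi) =
      ((n i + 1) * (Circle.exp θ : ℂ).arg - z.arg) / (2 * Real.pi) +
        ((l * (n i + 1 : ℕ) : ℤ) : ℝ) := by
    nth_rewrite 1 [hl]
    push_cast
    field_simp [Real.pi_ne_zero]
    ring
  rw [hshift, Int.floor_add_intCast, Int.cast_add, Int.cast_mul, Int.cast_natCast,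
    ZMod.natCast_self, mul_zero, add_zero, arcNumber]

lemma mem_arcAngles_iff {β : ℤ} {θ : ℝ} : θ ∈ C.arcAngles z i β ↔
    Real.pi / 2 < (n i + 1) * θ - z.arg - β * (2 * Real.pi) ∧
      (n i + 1) * θ - z.arg - β * (2 * Real.pi) < 3 * Real.pi / 2 := by
  have h : (0 : ℝ) < n i + 1 := by positivity
  rw [arcAngles, mem_Ioo, div_lt_iff₀ h, lt_div_iff₀ h]
  constructor <;> rintro ⟨h₁, h₂⟩ <;> constructor <;> linarith

lemma add_mem_arcAngles {β : ℤ} {θ : ℝ} (hθ : θ ∈ C.arcAngles z i β) (l : ℤ) :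
    θ + l * (2 * Real.pi) ∈ C.arcAngles z i (β + l * (n i + 1)) := by
  rw [mem_arcAngles_iff] at hθ ⊢
  convert hθ using 2 <;> push_cast <;> ring

lemma exp_mem_arcs_iff {θ : ℝ} : Circle.exp θ ∈ C.arcs z i ↔
    ‖z‖ * Real.cos ((n i + 1) * θ - z.arg) < 0 := by
  have hpolar : z * ((Circle.exp θ : ℂ) ^ (n i + 1))⁻¹ =
      (‖z‖ : ℂ) * Complex.exp (((z.arg - (n i + 1) * θ : ℝ) : ℂ) * Complex.I) := by
    rw [Circle.coe_exp, ← Complex.exp_nat_mul, ← Complex.exp_neg]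
    conv_lhs => rw [← Complex.norm_mul_exp_arg_mul_I z]
    rw [mul_assoc, ← Complex.exp_add]
    push_cast
    ring_nf
  rw [arcs, mem_ofPred_eq, hpolar, Complex.re_ofReal_mul, Complex.exp_ofReal_mul_I_re,
    ← Real.cos_neg, neg_sub]

variable {z i}

lemma exp_mem_arcs (hz : z ≠ 0) {β : ℤ} {θ : ℝ} (hθ : θ ∈ C.arcAngles z i β) :
    Circle.exp θ ∈ C.arcs z i := by
  obtain ⟨h₁, h₂⟩ := (C.mem_arcAngles_iff z i).1 hθ
  refine (C.exp_mem_arcs_iff z i).2 (mul_neg_of_pos_of_neg (norm_pos_iff.2 hz) ?_)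
  rw [← Real.cos_sub_int_mul_two_pi _ β]
  exact Real.cos_neg_of_pi_div_two_lt_of_lt h₁ (by linarith)

lemma arcNumber_exp_of_mem {β : ℤ} {θ : ℝ} (hθ : θ ∈ C.arcAngles z i β) :
    C.arcNumber z i (Circle.exp θ) = β := by
  obtain ⟨h₁, h₂⟩ := (C.mem_arcAngles_iff z i).1 hθ
  rw [arcNumber_exp]
  congr 1
  rw [Int.floor_eq_iff, le_div_iff₀ Real.two_pi_pos, div_lt_iff₀ Real.two_pi_pos]
  constructor <;> linarith [Real.pi_pos]

lemma arg_mem_arcAngles {u : Circle} (hu : u ∈ C.arcs z i) :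
    (u : ℂ).arg ∈ C.arcAngles z i ⌊((n i + 1) * (u : ℂ).arg - z.arg) / (2 * Real.pi)⌋ := by
  rw [← Circle.exp_arg u, exp_mem_arcs_iff] at hu
  have hcos := (mul_neg_iff.1 hu).resolve_right fun h => (norm_nonneg z).not_gt h.1
  set φ := (n i + 1) * (u : ℂ).arg - z.arg
  have hβ := Int.floor_le (φ / (2 * Real.pi))
  have hβ' := Int.lt_floor_add_one (φ / (2 * Real.pi))
  set β := ⌊φ / (2 * Real.pi)⌋
  rw [le_div_iff₀ Real.two_pi_pos] at hβ
  rw [div_lt_iff₀ Real.two_pi_pos] at hβ'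
  have hcosβ := (Real.cos_sub_int_mul_two_pi φ β).trans_lt hcos.2
  have hπ := Real.pi_pos
  refine (C.mem_arcAngles_iff z i).2 ⟨?_, ?_⟩
  · by_contra! hle
    exact hcosβ.not_ge (Real.cos_nonneg_of_neg_pi_div_two_le_of_le (by linarith) hle)
  · by_contra! hle
    rw [← Real.cos_two_pi_sub] at hcosβ
    exact hcosβ.not_ge (Real.cos_nonneg_of_neg_pi_div_two_le_of_le (by linarith) (by linarith))

lemma exists_exp_eq_of_arcNumber_eq {u : Circle} (hu : u ∈ C.arcs z i) {β : ℤ}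
    (hβ : C.arcNumber z i u = β) : ∃ θ ∈ C.arcAngles z i β, Circle.exp θ = u := by
  obtain ⟨l, hl⟩ := (ZMod.intCast_eq_intCast_iff_dvd_sub _ _ _).1 hβ
  refine ⟨(u : ℂ).arg + l * (2 * Real.pi), ?_, ?_⟩
  · convert C.add_mem_arcAngles z i (C.arg_mem_arcAngles hu) l using 2
    push_cast at hl
    linear_combination hl
  · rw [Circle.periodic_exp.int_mul l, Circle.exp_arg]

lemma eventually_arcNumber_eq {u : Circle} (hu : u ∈ C.arcs z i) :
    ∀ᶠ v in 𝓝 u, C.arcNumber z i v = C.arcNumber z i u := by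
  have hnhds := Circle.isCoveringMap_exp.isLocalHomeomorph.isOpenMap.image_mem_nhds
    (isOpen_Ioo.mem_nhds (C.arg_mem_arcAngles hu))
  rw [Circle.exp_arg] at hnhds
  filter_upwards [hnhds]
  rintro _ ⟨θ, hθ, rfl⟩
  exact C.arcNumber_exp_of_mem hθ

/-- The function on the blow-up with value `F i k` on the arc number `k` at `∞_i`. Its values
in the interior play no role. -/
def arcFunction [Zero M] (F : ∀ i, ZMod (n i + 1) → M) : C.Blow z → M
  | .interior _ => 0
  | .boundary i u => F i (C.arcNumber z i u)

lemma eventually_arcFunction_eq [Zero M] (F : ∀ i, ZMod (n i + 1) → M) {x : C.Blow z}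
    (hx : x ∈ C.bdry z) :
    ∀ᶠ y in 𝓝 x, y ∈ C.bdry z → C.arcFunction F y = C.arcFunction F x := by
  obtain ⟨i, u, rfl⟩ := hx
  let p : C.Collar z i := ⟨(0, u), le_rfl, C.radius_pos i, fun _ => u.2⟩
  have hp : C.collarIncl z i p = Blow.boundary i u := C.collarMap_eq_boundary rfl
  rw [← hp, ← C.isOpenEmbedding_collarIncl.map_nhds_eq, eventually_map]
  have hcont : Continuous fun q : C.Collar z i => q.1.2 := by fun_prop
  filter_upwards [hcont.continuousAt.eventually (C.eventually_arcNumber_eq u.2)]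
  rintro q hq ⟨j, v, hv⟩
  obtain ⟨-, rfl, hqv⟩ := C.collarMap_eq_boundary_iff.1 hv
  have hv' : C.collarIncl z i q = Blow.boundary i v := hv
  rw [hv', hp, arcFunction, ← hqv, hq]
  rfl

lemma arcFunction_path_eq [Zero M] (F : ∀ i, ZMod (n i + 1) → M) {γ : C(I, C.Blow z)}
    (hγ : ∀ t, γ t ∈ C.bdry z) (s t : I) : C.arcFunction F (γ s) = C.arcFunction F (γ t) := by
  have hconst : IsLocallyConstant (C.arcFunction F ∘ γ) :=
    (IsLocallyConstant.iff_eventually_eq _).2 fun t =>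
      (γ.continuous.continuousAt.eventually (C.eventually_arcFunction_eq F (hγ t))).mono
        fun t' ht' => ht' (hγ t')
  exact hconst.apply_eq_of_preconnectedSpace s t

lemma vanishesOn_increment_arcFunction [AddCommGroup M] (F : ∀ i, ZMod (n i + 1) → M) :
    VanishesOn (increment (C.arcFunction (z := z) F)) (C.bdry z) := fun _ hγ =>
  sub_eq_zero.2 (C.arcFunction_path_eq F hγ 1 0)

lemma apply_eq_of_arcNumber_eq [AddCommGroup M] (hz : z ≠ 0) {h : C.Blow z → M}
    (hh : VanishesOn (increment h) (C.bdry z)) {u v : C.arcs z i}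
    (huv : C.arcNumber z i u = C.arcNumber z i v) :
    h (Blow.boundary i u) = h (Blow.boundary i v) := by
  obtain ⟨β, hβ⟩ := ZMod.intCast_surjective (C.arcNumber z i v)
  obtain ⟨θ, hθ, hu⟩ := C.exists_exp_eq_of_arcNumber_eq u.2 (huv.trans hβ.symm)
  obtain ⟨θ', hθ', hv⟩ := C.exists_exp_eq_of_arcNumber_eq v.2 hβ.symm
  have harc : ∀ t : I, Circle.exp (AffineMap.lineMap θ θ' (t : ℝ)) ∈ C.arcs z i := fun t =>
    C.exp_mem_arcs hz ((convex_Ioo _ _).lineMap_mem hθ hθ' t.2)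
  let γ : C(I, C.Collar z i) :=
    ⟨fun t => ⟨(0, Circle.exp (AffineMap.lineMap θ θ' (t : ℝ))), le_rfl, C.radius_pos i,
      fun _ => harc t⟩, by fun_prop⟩
  have hγ := hh ((C.collarIncl z i).comp γ) fun t => C.collarMap_mem_bdry z i _ rfl
  have hγ₀ : C.collarMap z i (γ 0) = Blow.boundary i u :=
    C.collarMap_eq_boundary_iff.2 ⟨rfl, rfl, by simpa [γ] using hu⟩
  have hγ₁ : C.collarMap z i (γ 1) = Blow.boundary i v :=
    C.collarMap_eq_boundary_iff.2 ⟨rfl, rfl, by simpa [γ] using hv⟩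
  rw [← hγ₀, ← hγ₁]
  exact (sub_eq_zero.1 hγ).symm

/-! ### The contours generate -/

variable {C} {g : ℕ} (S : C.ContourSystem g z)

namespace ContourSystem

lemma arcNumber_wStart (j : Fin m) : C.arcNumber z 0 (S.wStart j) = S.firstSheet 0 := by
  obtain ⟨θ, hθ, hu⟩ := S.wStart_mem j
  rw [hu, C.arcNumber_exp_of_mem hθ]

lemma arcNumber_wEnd (j : Fin m) :
    C.arcNumber z j.succ (S.wEnd j) = S.firstSheet j.succ := by
  obtain ⟨θ, hθ, hu⟩ := S.wEnd_mem j
  rw [hu, C.arcNumber_exp_of_mem hθ]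

lemma arcNumber_tStart (i : Fin (m + 1)) (α : Fin (n i)) :
    C.arcNumber z i (S.tStart i α).1.2 = S.firstSheet i + (α : ℕ) := by
  rw [← (S.t i α).source, S.t_angle, C.arcNumber_exp_of_mem (S.tAngle_start i α)]
  push_cast
  rfl

lemma arcNumber_tEnd (i : Fin (m + 1)) (α : Fin (n i)) :
    C.arcNumber z i (S.tEnd i α).1.2 = S.firstSheet i + (α : ℕ) + 1 := by
  rw [← (S.t i α).target, S.t_angle, C.arcNumber_exp_of_mem (S.tAngle_end i α)]
  push_cast
  rfl

/-- The path `T_{i;α}` in the blow-up. -/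
def tPath (i : Fin (m + 1)) (α : Fin (n i)) : C(I, C.Blow z) :=
  ((S.t i α).map (C.continuous_collarMap z i)).toContinuousMap

variable [AddCommGroup M] {h : C.Blow z → M} {F : ∀ i, ZMod (n i + 1) → M}

section Increment

variable (hF : ∀ i (u : C.arcs z i), h (Blow.boundary i u) = F i (C.arcNumber z i u))

include hF

lemma increment_w (j : Fin m) : increment h (S.w j).toContinuousMap =
    F j.succ (S.firstSheet j.succ) - F 0 (S.firstSheet 0) := by
  have h₀ : (S.w j).toContinuousMap 0 = _ := (S.w j).source
  have h₁ : (S.w j).toContinuousMap 1 = _ := (S.w j).target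
  rw [increment, h₀, h₁, hF, hF, S.arcNumber_wStart, S.arcNumber_wEnd]

lemma increment_tPath (i : Fin (m + 1)) (α : Fin (n i)) : increment h (S.tPath i α) =
    F i (S.firstSheet i + (α : ℕ) + 1) - F i (S.firstSheet i + (α : ℕ)) := by
  have h₀ : S.tPath i α 0 = _ := ((S.t i α).map (C.continuous_collarMap z i)).source.trans
    (C.collarMap_eq_boundary (S.tStart_radius i α))
  have h₁ : S.tPath i α 1 = _ := ((S.t i α).map (C.continuous_collarMap z i)).target.trans
    (C.collarMap_eq_boundary (S.tEnd_radius i α))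
  rw [increment, h₀, h₁, hF, hF]
  exact congrArg₂ (fun k l => F i k - F i l) (S.arcNumber_tEnd i α) (S.arcNumber_tStart i α)

end Increment

lemma exists_eq_of_increment_eq_zero (hz : z ≠ 0)
    (hbdry : VanishesOn (increment h) (C.bdry z))
    (hw : ∀ j, increment h (S.w j).toContinuousMap = 0)
    (ht : ∀ i α, increment h (S.tPath i α) = 0) : ∃ c, ∀ x ∈ C.bdry z, h x = c := by
  have hfactor : ∀ i, ∃ F : ZMod (n i + 1) → M,
      (fun u : C.arcs z i => h (Blow.boundary i u)) = fun u : C.arcs z i =>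
        F (C.arcNumber z i u) := fun i =>
    (Function.factorsThrough_iff _).1 fun _ _ huv => C.apply_eq_of_arcNumber_eq hz hbdry huv
  choose F hF using hfactor
  have hF' : ∀ i (u : C.arcs z i), h (Blow.boundary i u) = F i (C.arcNumber z i u) :=
    fun i => congrFun (hF i)
  have hfirst : ∀ i, ∀ α ≤ n i, F i (S.firstSheet i + (α : ℕ)) = F i (S.firstSheet i) := by
    intro i α
    induction α with
    | zero => simp
    | succ α ih =>
      intro hα
      have hstep := ht i ⟨α, hα⟩
      rw [S.increment_tPath hF', sub_eq_zero] at hstep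
      rw [← ih (Nat.le_of_succ_le hα), ← hstep, Nat.cast_succ, add_assoc]
  have hconst : ∀ i k, F i k = F i (S.firstSheet i) := fun i k => by
    rw [← hfirst i _ (Nat.lt_succ_iff.1 (ZMod.val_lt (k - (S.firstSheet i : ZMod _)))),
      ZMod.natCast_zmod_val, add_sub_cancel]
  refine ⟨F 0 (S.firstSheet 0), ?_⟩
  rintro _ ⟨i, u, rfl⟩
  rw [hF', hconst]
  exact Fin.cases rfl (fun j => sub_eq_zero.1 ((S.increment_w hF' j).symm.trans (hw j))) i

/-- The values of a cocycle on the contours. -/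
def value (ψ : C(I, C.Blow z) → M) : ContourIndex g m n → M
  | .inl (.inl k) => ψ ((C.interiorIncl z).comp (S.a k).toContinuousMap)
  | .inl (.inr k) => ψ ((C.interiorIncl z).comp (S.b k).toContinuousMap)
  | .inr (.inl i) => ψ ((C.interiorIncl z).comp
      (C.circleLoop i.succ (S.vRadius i) (S.vRadius_pos i) (S.vRadius_lt i)).toContinuousMap)
  | .inr (.inr (.inl i)) => ψ (S.w i).toContinuousMap
  | .inr (.inr (.inr ⟨i, α⟩)) => ψ (S.tPath i α)

lemma homologyFunctional_contour [Module ℂ M] {ψ : C(I, C.Blow z) → M} (hψ : IsPathCocycle ψ)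
    (hA : VanishesOn ψ (C.bdry z)) (k : ContourIndex g m n) :
    homologyFunctional ℂ hψ hA (S.contour k) = S.value ψ k := by
  rcases k with (k | k) | i | i | ⟨i, α⟩
  · exact homologyFunctional_loopClass ℂ hψ hA _
  · exact homologyFunctional_loopClass ℂ hψ hA _
  · exact homologyFunctional_loopClass ℂ hψ hA _
  · exact homologyFunctional_pathClass ℂ hψ hA ⟨_, _, rfl⟩ ⟨_, _, rfl⟩ _
  · exact homologyFunctional_pathClass ℂ hψ hA
      (C.collarMap_mem_bdry z i _ (S.tStart_radius i α))
      (C.collarMap_mem_bdry z i _ (S.tEnd_radius i α)) _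

section Surface

variable [T2Space L] [CompactSpace L] [IsManifold 𝓘(ℂ) ω L]

/-- By the residue theorem the residue at `∞_0` is determined by the others. -/
lemma circleLoop_eq_zero {ψ : C(I, C.Punctured) → M} (hψ : IsPathCocycle ψ)
    (hv : ∀ i, ψ (C.circleLoop i.succ (S.vRadius i) (S.vRadius_pos i)
      (S.vRadius_lt i)).toContinuousMap = 0) (i : Fin (m + 1)) (ρ : ℝ) (h0 : 0 < ρ)
    (hr : ρ < C.radius i) : ψ (C.circleLoop i ρ h0 hr).toContinuousMap = 0 := by
  choose k c _ _ hc using fun i => C.exists_residue i hψ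
  have hsucc : ∀ j : Fin m, c j.succ = 0 := fun j =>
    (hc _ _ (S.vRadius_pos j) (S.vRadius_lt j)).symm.trans (hv j)
  have hsum := C.sum_residue_eq_zero hψ (ρ := fun i => C.radius i / 2)
    (fun i => half_pos (C.radius_pos i)) fun i => half_lt_self (C.radius_pos i)
  simp only [hc, Fin.sum_univ_succ, hsucc, Finset.sum_const_zero, add_zero] at hsum
  rw [hc]
  exact Fin.cases hsum hsucc i

variable [ConnectedSpace L]

lemma exists_eq_increment {ψ : C(I, C.Blow z) → M} (hψ : IsPathCocycle ψ)
    (hval : ∀ k, S.value ψ k = 0) : ∃ H : C.Blow z → M, ψ = increment H := by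
  have hint := hψ.comp (C.interiorIncl z)
  obtain ⟨Ψ, hΨ, hΨψ⟩ := C.exists_extension hint
    (S.circleLoop_eq_zero hint fun i => hval (.inr (.inl i)))
  have := ChartedSpace.locallyPathConnectedSpace ℂ L
  have : PathConnectedSpace L := pathConnectedSpace_iff_connectedSpace.2 inferInstance
  obtain ⟨B, hB⟩ := S.homologyBasis
  obtain ⟨h, rfl⟩ := hΨ.exists_eq_increment_of_loops fun p γ =>
    hΨ.loop_eq_zero_of_span_eq_top ℤ B.span_eq (by
      rintro _ ⟨k | k, rfl⟩
      · rw [hB, Sum.elim_inl, homologyFunctional_loopClass]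
        exact (hΨψ _).trans (hval (.inl (.inl k)))
      · rw [hB, Sum.elim_inr, homologyFunctional_loopClass]
        exact (hΨψ _).trans (hval (.inl (.inr k)))) γ
  obtain ⟨H, hH⟩ := C.exists_eq_increment_of_interior (h := fun P => h P) (fun γ => (hΨψ γ).symm) hψ
  exact ⟨H, funext hH⟩

lemma span_range_contour (hz : z ≠ 0) : Submodule.span ℂ (range S.contour) = ⊤ := by
  by_contra hne
  obtain ⟨φ, hφ, hker⟩ := Submodule.exists_le_ker_of_lt_top _ (lt_top_iff_ne_top.2 hne)
  obtain ⟨ψ, hψ, hA, rfl⟩ := exists_eq_homologyFunctional φ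
  have hval : ∀ k, S.value ψ k = 0 := fun k =>
    (S.homologyFunctional_contour hψ hA k).symm.trans (hker (Submodule.subset_span ⟨k, rfl⟩))
  obtain ⟨H, rfl⟩ := S.exists_eq_increment hψ hval
  obtain ⟨c, hc⟩ := S.exists_eq_of_increment_eq_zero hz hA
    (fun j => hval (.inr (.inr (.inl j)))) fun i α => hval (.inr (.inr (.inr ⟨i, α⟩)))
  exact hφ (homologyFunctional_eq_zero_of_increment ℂ hA hc)

end Surface

end ContourSystem

end HurwitzCovering

/-! ### Logarithms with prescribed winding numbers -/

section Logarithm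

variable {X : Type*} [TopologicalSpace X] {x : X}

lemma eventually_eq_of_exp_eq {a b : X → ℂ} (ha : ContinuousAt a x) (hb : ContinuousAt b x)
    (hexp : ∀ᶠ x' in 𝓝 x, Complex.exp (a x') = Complex.exp (b x')) (hx : a x = b x) :
    ∀ᶠ x' in 𝓝 x, a x' = b x' := by
  have him : Tendsto (fun x' => (a x' - b x').im) (𝓝 x) (𝓝 0) := by
    have := Complex.continuous_im.continuousAt.comp (ha.sub hb)
    simpa [ContinuousAt, Function.comp_def, hx] using this
  filter_upwards [hexp, him.eventually (Ioo_mem_nhds (neg_lt_zero.2 Real.pi_pos) Real.pi_pos)]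
    with x' hx' hlt
  have hlog := Complex.log_exp hlt.1 hlt.2.le
  rw [Complex.exp_sub, hx', div_self (Complex.exp_ne_zero _), Complex.log_one] at hlog
  exact sub_eq_zero.1 hlog.symm

lemma continuousAt_log_div_self {F : X → ℂ} (hF : ContinuousAt F x) (hx : F x ≠ 0) :
    ContinuousAt (fun x' => Complex.log (F x' / F x)) x :=
  (hF.div_const _).clog (by rw [div_self hx]; exact Complex.one_mem_slitPlane)

/-- Both sides vanish at `x` and have the same exponential, so no multiple of `2πi` intervenes. -/
lemma eventually_log_div_eq {F w : X → ℂ} {ℓ : X → ℂ} {d : ℤ} (hF : ContinuousAt F x)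
    (hFx : F x ≠ 0) (hw : ContinuousAt w x) (hwx : w x ≠ 0) (hℓ : ContinuousAt ℓ x)
    (heq : ∀ᶠ x' in 𝓝 x, F x' / F x = (w x' / w x) ^ d * Complex.exp (ℓ x' - ℓ x)) :
    ∀ᶠ x' in 𝓝 x,
      Complex.log (F x' / F x) = d * Complex.log (w x' / w x) + (ℓ x' - ℓ x) := by
  refine eventually_eq_of_exp_eq (continuousAt_log_div_self hF hFx)
    ((continuousAt_const.mul (continuousAt_log_div_self hw hwx)).add
      (hℓ.sub continuousAt_const)) ?_ (by simp [div_self hFx, div_self hwx])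
  filter_upwards [heq, hF.eventually_ne hFx, hw.eventually_ne hwx] with x' h hF' hw'
  rw [Complex.exp_log (div_ne_zero hF' hFx), h, Complex.exp_add, Complex.exp_int_mul,
    Complex.exp_log (div_ne_zero hw' hwx)]

lemma eventually_log_div_eq_sub {F : X → ℂ} (hF : ContinuousAt F x)
    (hx : F x ∈ Complex.slitPlane) :
    ∀ᶠ x' in 𝓝 x, Complex.log (F x' / F x) = Complex.log (F x') - Complex.log (F x) := by
  have hx0 := Complex.slitPlane_ne_zero hx
  have hlog := eventually_log_div_eq (d := 0) hF hx0 hF hx0 (hF.clog hx) (by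
    filter_upwards [hF.eventually_ne hx0] with x' hx'
    rw [zpow_zero, one_mul, Complex.exp_sub, Complex.exp_log hx', Complex.exp_log hx0])
  simpa using hlog

end Logarithm

section Order

variable {L : Type*} [TopologicalSpace L] [ChartedSpace ℂ L]

/-- The chart at `y`, centred at `y`. -/
def centeredChart (y x : L) : ℂ := chartAt ℂ y x - chartAt ℂ y y

/-- `F` is, near `y`, the `d`-th power of a local parameter times a continuous function without
zeros. The conventions of `zpow` at `0` force the value `0` at a zero or pole. -/
def HasOrderAt (F : L → ℂ) (d : ℤ) (y : L) : Prop :=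
  ∃ h : L → ℂ, (∀ᶠ x in 𝓝 y, ContinuousAt h x) ∧ h y ≠ 0 ∧
    ∀ᶠ x in 𝓝 y, F x = centeredChart y x ^ d * h x

variable {F G : L → ℂ} {d : ℤ} {y : L}

lemma eventually_centeredChart (y : L) :
    ∀ᶠ x in 𝓝[≠] y, ContinuousAt (centeredChart y) x ∧ centeredChart y x ≠ 0 := by
  have hy := mem_chart_source ℂ y
  filter_upwards [mem_nhdsWithin_of_mem_nhds ((chartAt ℂ y).open_source.mem_nhds hy),
    self_mem_nhdsWithin] with x hx hne
  exact ⟨((chartAt ℂ y).continuousAt hx).sub continuousAt_const,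
    sub_ne_zero.2 fun h => hne ((chartAt ℂ y).injOn hx hy h)⟩

lemma hasOrderAt_zero_of_continuousAt (hF : ∀ᶠ x in 𝓝 y, ContinuousAt F x) (hy : F y ≠ 0) :
    HasOrderAt F 0 y := ⟨F, hF, hy, .of_forall fun x => by simp⟩

namespace HasOrderAt

lemma inv (hF : HasOrderAt F d y) : HasOrderAt F⁻¹ (-d) y := by
  obtain ⟨h, hc, hy, heq⟩ := hF
  refine ⟨h⁻¹, ?_, inv_ne_zero hy, heq.mono fun x hx => ?_⟩
  · filter_upwards [hc, hc.self_of_nhds.eventually_ne hy] with x hx hne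
    exact hx.inv₀ hne
  · rw [Pi.inv_apply, Pi.inv_apply, hx, mul_inv, zpow_neg]

lemma mul (hF : HasOrderAt F d y) (hG : HasOrderAt G 0 y) : HasOrderAt (F * G) d y := by
  obtain ⟨h, hc, hy, heq⟩ := hF
  obtain ⟨k, hkc, hky, hkeq⟩ := hG
  refine ⟨h * k, (hc.and hkc).mono fun x hx => hx.1.mul hx.2, mul_ne_zero hy hky, ?_⟩
  filter_upwards [heq, hkeq] with x hx hkx
  rw [Pi.mul_apply, Pi.mul_apply, hx, hkx, zpow_zero, one_mul, mul_assoc]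

lemma continuousAt (hF : HasOrderAt F 0 y) : ContinuousAt F y :=
  let ⟨_, hc, _, heq⟩ := hF
  hc.self_of_nhds.congr (heq.mono fun x hx => by rw [hx, zpow_zero, one_mul])

lemma ne_zero (hF : HasOrderAt F 0 y) : F y ≠ 0 := by
  obtain ⟨h, -, hy, heq⟩ := hF
  rwa [heq.self_of_nhds, zpow_zero, one_mul]

lemma exists_log (hF : HasOrderAt F d y) :
    ∃ ℓ : L → ℂ, (d = 0 → ∀ᶠ x in 𝓝 y, Complex.log (F x / F y) = ℓ x) ∧
      ∀ᶠ x in 𝓝[≠] y, ∀ᶠ x' in 𝓝 x, Complex.log (F x' / F x) =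
        d * Complex.log (centeredChart y x' / centeredChart y x) + (ℓ x' - ℓ x) := by
  obtain ⟨h, hc, hy, heq⟩ := hF
  have hslit : ∀ᶠ x in 𝓝 y, h x / h y ∈ Complex.slitPlane :=
    (hc.self_of_nhds.div_const (h y)).preimage_mem_nhds
      (Complex.isOpen_slitPlane.mem_nhds (by
        rw [div_self hy]
        exact Complex.one_mem_slitPlane))
  refine ⟨fun x => Complex.log (h x / h y), ?_, ?_⟩
  · rintro rfl
    filter_upwards [heq] with x hx
    rw [hx, heq.self_of_nhds, zpow_zero, zpow_zero, one_mul, one_mul]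
  filter_upwards [eventually_centeredChart y, hc.filter_mono nhdsWithin_le_nhds,
    heq.eventually_nhds.filter_mono nhdsWithin_le_nhds,
    hslit.eventually_nhds.filter_mono nhdsWithin_le_nhds] with x ⟨hwc, hw⟩ hhc hFx hs
  have hne : ∀ {x}, h x / h y ∈ Complex.slitPlane → h x ≠ 0 := fun hx h0 =>
    Complex.slitPlane_ne_zero hx (by rw [h0, zero_div])
  have hx := hFx.self_of_nhds
  have hFx0 : F x ≠ 0 := hx ▸ mul_ne_zero (zpow_ne_zero _ hw) (hne hs.self_of_nhds)
  have hFc : ContinuousAt F x :=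
    ((hwc.zpow₀ d (.inl hw)).mul hhc).congr (hFx.mono fun _ h => h.symm)
  refine eventually_log_div_eq hFc hFx0 hwc hw ((hhc.div_const _).clog hs.self_of_nhds) ?_
  filter_upwards [hFx, hs] with x' hx' hs'
  rw [Complex.exp_sub, Complex.exp_log (Complex.slitPlane_ne_zero hs'),
    Complex.exp_log (Complex.slitPlane_ne_zero hs.self_of_nhds), hx', hx, div_zpow,
    div_div_div_cancel_right₀ hy, mul_div_mul_comm]

end HasOrderAt

variable {e e' : OpenPartialHomeomorph L ℂ}

lemma differentiableAt_transition (he : e ∈ IsManifold.maximalAtlas 𝓘(ℂ) ω L)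
    (he' : e' ∈ IsManifold.maximalAtlas 𝓘(ℂ) ω L) (hy : y ∈ e.source) (hy' : y ∈ e'.source) :
    DifferentiableAt ℂ (e ∘ e'.symm) (e' y) := by
  have hd : MDifferentiableAt 𝓘(ℂ) 𝓘(ℂ) e (e'.symm (e' y)) := by
    rw [e'.left_inv hy']
    exact (contMDiffAt_of_mem_maximalAtlas he hy).mdifferentiableAt (by simp)
  have hd' : MDifferentiableAt 𝓘(ℂ) 𝓘(ℂ) e'.symm (e' y) :=
    ((contMDiffOn_symm_of_mem_maximalAtlas he').contMDiffAt
      (e'.open_target.mem_nhds (e'.map_source hy'))).mdifferentiableAt (by simp)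
  exact mdifferentiableAt_iff_differentiableAt.1 (hd.comp _ hd')

lemma deriv_transition_ne_zero (he : e ∈ IsManifold.maximalAtlas 𝓘(ℂ) ω L)
    (he' : e' ∈ IsManifold.maximalAtlas 𝓘(ℂ) ω L) (hy : y ∈ e.source) (hy' : y ∈ e'.source) :
    deriv (e ∘ e'.symm) (e' y) ≠ 0 := by
  intro h0
  have hid : (e' ∘ e.symm) ∘ (e ∘ e'.symm) =ᶠ[𝓝 (e' y)] id := by
    have hc : ContinuousAt e'.symm (e' y) := e'.continuousAt_symm (e'.map_source hy')
    filter_upwards [e'.open_target.mem_nhds (e'.map_source hy'), hc.preimage_mem_nhds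
      (e.open_source.mem_nhds (by rwa [e'.left_inv hy']))] with w hw hw'
    simp only [Function.comp_apply, id]
    rw [e.left_inv hw', e'.right_inv hw]
  have hval : (e ∘ e'.symm) (e' y) = e y := by simp [e'.left_inv hy']
  have hchain := deriv_comp (e' y) (hval ▸ differentiableAt_transition he' he hy' hy)
    (differentiableAt_transition he he' hy hy')
  rw [h0, mul_zero, hid.deriv_eq, deriv_id] at hchain
  exact one_ne_zero hchain

lemma exists_sub_eq_mul (he : e ∈ IsManifold.maximalAtlas 𝓘(ℂ) ω L)
    (he' : e' ∈ IsManifold.maximalAtlas 𝓘(ℂ) ω L) (hy : y ∈ e.source) (hy' : y ∈ e'.source) :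
    ∃ h : L → ℂ, (∀ᶠ x in 𝓝 y, ContinuousAt h x) ∧ h y ≠ 0 ∧
      ∀ᶠ x in 𝓝 y, e x - e y = (e' x - e' y) * h x := by
  refine ⟨fun x => dslope (e ∘ e'.symm) (e' y) (e' x), ?_, ?_, ?_⟩
  · filter_upwards [e.open_source.mem_nhds hy, e'.open_source.mem_nhds hy'] with x hx hx'
    refine ContinuousAt.comp (g := dslope (e ∘ e'.symm) (e' y)) ?_ (e'.continuousAt hx')
    by_cases hxy : e' x = e' y
    · rw [hxy, continuousAt_dslope_same]
      exact differentiableAt_transition he he' hy hy'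
    · rw [continuousAt_dslope_of_ne hxy]
      refine ContinuousAt.comp ?_ (e'.continuousAt_symm (e'.map_source hx'))
      rw [e'.left_inv hx']
      exact e.continuousAt hx
  · beta_reduce
    rw [dslope_same]
    exact deriv_transition_ne_zero he he' hy hy'
  · filter_upwards [e'.open_source.mem_nhds hy'] with x hx'
    rw [← smul_eq_mul, sub_smul_dslope]
    simp [e'.left_inv hy', e'.left_inv hx']

lemma hasOrderAt_sub_self [IsManifold 𝓘(ℂ) ω L] (he : e ∈ IsManifold.maximalAtlas 𝓘(ℂ) ω L)
    (hy : y ∈ e.source) :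
    HasOrderAt (fun x => e x - e y) 1 y := by
  obtain ⟨h, hc, hy, heq⟩ := exists_sub_eq_mul he
    (IsManifold.chart_mem_maximalAtlas y) hy (mem_chart_source ℂ y)
  exact ⟨h, hc, hy, heq.mono fun x hx => hx.trans (by rw [zpow_one, centeredChart])⟩

lemma hasOrderAt_sub_of_ne {P : L} (hP : P ∈ e.source) (hy : y ∈ e.source) (hne : y ≠ P) :
    HasOrderAt (fun x => e x - e P) 0 y :=
  hasOrderAt_zero_of_continuousAt ((e.open_source.eventually_mem hy).mono fun _ hx =>
    (e.continuousAt hx).sub continuousAt_const)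
    (sub_ne_zero.2 fun h => hne (e.injOn hy hP h))

end Order

section Winding

lemma eventually_ne_nhdsNE {X : Type*} [TopologicalSpace X] [T1Space X] (x y : X) :
    ∀ᶠ p in 𝓝[≠] x, p ≠ y := by
  rcases eq_or_ne x y with rfl | hxy
  · exact self_mem_nhdsWithin
  · exact eventually_ne_nhdsWithin hxy

variable {L : Type*} [TopologicalSpace L] [ChartedSpace ℂ L] {D D' : L → ℤ}
  {f f' : L → L → ℂ}

/-- `f y` plays the role, near `y`, of the branch at `y` of the logarithm of a function with
divisor `D`, after subtraction of `D y` times the logarithm of a local parameter. Since such a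
function need not exist, the branches are only required to be compatible up to constants. -/
def HasWinding (D : L → ℤ) (f : L → L → ℂ) : Prop :=
  ∀ y, ∀ᶠ x in 𝓝[≠] y, ∀ᶠ x' in 𝓝 x, f x x' - f x x =
    D y * Complex.log (centeredChart y x' / centeredChart y x) + (f y x' - f y x)

lemma HasWinding.add (hf : HasWinding D f) (hf' : HasWinding D' f') :
    HasWinding (D + D') (f + f') := fun y => by
  filter_upwards [hf y, hf' y] with x hx hx'
  filter_upwards [hx, hx'] with x' h h'
  simp only [Pi.add_apply]
  push_cast
  linear_combination h + h'

lemma HasWinding.neg (hf : HasWinding D f) : HasWinding (-D) (-f) := fun y => by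
  filter_upwards [hf y] with x hx
  filter_upwards [hx] with x' h
  simp only [Pi.neg_apply]
  push_cast
  linear_combination -h

lemma exists_hasWinding_of_hasOrderAt {F : L → ℂ} {U K : Set L} (hU : IsOpen U)
    (hK : IsClosed K) (hKU : K ⊆ U) (hF : ∀ y ∈ U, HasOrderAt F (D y) y)
    (hD : ∀ y, ∀ᶠ x in 𝓝[≠] y, D x = 0) (hDU : ∀ y ∉ U, D y = 0)
    (hslit : ∀ x ∈ U \ K, F x ∈ Complex.slitPlane) : ∃ f, HasWinding D f := by
  classical
  choose! ℓ hℓ₀ hℓ using fun y hy => (hF y hy).exists_log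
  refine ⟨fun y x => if y ∈ U then ℓ y x else if x ∈ U then Complex.log (F x) else 0, fun y => ?_⟩
  have hregular : ∀ x ∈ U, D x = 0 → ∀ᶠ x' in 𝓝 x, Complex.log (F x' / F x) = ℓ x x' - ℓ x x := by
    intro x hx hDx
    have hlog := hℓ₀ x hx hDx
    have hxx := hlog.self_of_nhds
    rw [div_self (hDx ▸ hF x hx).ne_zero, Complex.log_one] at hxx
    simpa only [← hxx, sub_zero] using hlog
  by_cases hy : y ∈ U
  · filter_upwards [hℓ y hy, mem_nhdsWithin_of_mem_nhds (hU.mem_nhds hy), hD y] with x hlog hx hDx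
    filter_upwards [hlog, hregular x hx hDx] with x' hx' hreg
    rw [if_pos hx, if_pos hx, if_pos hy, if_pos hy, ← hx', hreg]
  · filter_upwards [mem_nhdsWithin_of_mem_nhds (hK.isOpen_compl.mem_nhds fun h => hy (hKU h)),
      hD y] with x hxK hDx
    rw [hDU y hy, Int.cast_zero]
    by_cases hx : x ∈ U
    · filter_upwards [hregular x hx hDx, hU.mem_nhds hx, eventually_log_div_eq_sub
        (hDx ▸ hF x hx).continuousAt (hslit x ⟨hx, hxK⟩)] with x' hreg hx' hlog
      simp only [if_pos hx, if_pos hx', if_neg hy, ← hreg, hlog, zero_mul, zero_add]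
    · exact .of_forall fun x' => by simp only [if_neg hx, if_neg hy, zero_mul, zero_add]

open scoped Classical in
/-- The divisor `x - y`. -/
def pointDiff (x y : L) : L → ℤ := Pi.single x 1 - Pi.single y 1

section Nearby

variable [IsManifold 𝓘(ℂ) ω L] {e : OpenPartialHomeomorph L ℂ} {x y p : L}

lemma hasOrderAt_sub_div_sub (he : e ∈ IsManifold.maximalAtlas 𝓘(ℂ) ω L) (hx : x ∈ e.source)
    (hy : y ∈ e.source) (hxy : x ≠ y) (hp : p ∈ e.source) :
    HasOrderAt ((fun q => e q - e x) * (fun q => e q - e y)⁻¹) (pointDiff x y p) p := by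
  classical
  rcases eq_or_ne p x with rfl | hpx
  · have h := (hasOrderAt_sub_self he hp).mul (hasOrderAt_sub_of_ne hy hp hxy).inv
    simpa [pointDiff, hxy] using h
  rcases eq_or_ne p y with rfl | hpy
  · have h := (hasOrderAt_sub_self he hp).inv.mul (hasOrderAt_sub_of_ne hx hp hpx)
    simpa [pointDiff, hpx, mul_comm] using h
  · have h := (hasOrderAt_sub_of_ne hx hp hpx).mul (hasOrderAt_sub_of_ne hy hp hpy).inv
    simpa [pointDiff, hpx, hpy] using h

/-- Away from the disc about `y` through `x` the quotient of the two coordinates is close to `1`,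
so it has a logarithm there, and outside the chart the constant `0` can serve as one. -/
lemma exists_hasWinding_of_closedBall_subset [T2Space L]
    (he : e ∈ IsManifold.maximalAtlas 𝓘(ℂ) ω L) (hx : x ∈ e.source) (hy : y ∈ e.source)
    (hball : Metric.closedBall (e y) ‖e x - e y‖ ⊆ e.target) (hxy : x ≠ y) :
    ∃ f, HasWinding (pointDiff x y) f := by
  classical
  set K : Set L := e.symm '' Metric.closedBall (e y) ‖e x - e y‖
  have hKclosed : IsClosed K := ((isCompact_closedBall _ _).image_of_continuousOn
    (e.continuousOn_symm.mono hball)).isClosed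
  have hKU : K ⊆ e.source := by
    rintro _ ⟨v, hv, rfl⟩
    exact e.map_target (hball hv)
  refine exists_hasWinding_of_hasOrderAt e.open_source hKclosed hKU
    (fun p hp => hasOrderAt_sub_div_sub he hx hy hxy hp) (fun p => ?_) (fun p hp => ?_) ?_
  · filter_upwards [eventually_ne_nhdsNE p x, eventually_ne_nhdsNE p y] with q hqx hqy
    simp [pointDiff, hqx, hqy]
  · simp [pointDiff, ne_of_mem_of_not_mem hx hp |>.symm, ne_of_mem_of_not_mem hy hp |>.symm]
  · rintro p ⟨hp, hpK⟩
    have hlt : ‖e x - e y‖ < ‖e p - e y‖ := by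
      by_contra! hle
      exact hpK ⟨e p, by rwa [mem_closedBall_iff_norm], e.left_inv hp⟩
    have hpos : 0 < ‖e p - e y‖ := (norm_nonneg _).trans_lt hlt
    have heq : (e p - e x) * (e p - e y)⁻¹ = 1 + -((e x - e y) / (e p - e y)) := by
      field_simp [norm_pos_iff.1 hpos]
      ring
    rw [Pi.mul_apply, Pi.inv_apply, heq]
    refine Complex.mem_slitPlane_of_norm_lt_one ?_
    rwa [norm_neg, norm_div, div_lt_one hpos]

lemma eventually_exists_hasWinding [T2Space L] (y : L) :
    ∀ᶠ x in 𝓝 y, ∃ f, HasWinding (pointDiff x y) f := by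
  have hy := mem_chart_source ℂ y
  obtain ⟨R, hR, hball⟩ := Metric.isOpen_iff.1 (chartAt ℂ y).open_target _
    ((chartAt ℂ y).map_source hy)
  filter_upwards [(chartAt ℂ y).open_source.mem_nhds hy,
    ((chartAt ℂ y).continuousAt hy).preimage_mem_nhds (Metric.ball_mem_nhds _ hR)] with x hx hxR
  rcases eq_or_ne x y with rfl | hxy
  · exact ⟨0, fun p => by simp [pointDiff]⟩
  · exact exists_hasWinding_of_closedBall_subset (IsManifold.chart_mem_maximalAtlas y) hx hy
      ((Metric.closedBall_subset_ball (mem_ball_iff_norm.1 hxR)).trans hball) hxy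

end Nearby

lemma exists_hasWinding_pointDiff [T2Space L] [ConnectedSpace L] [IsManifold 𝓘(ℂ) ω L] (x y : L) :
    ∃ f, HasWinding (pointDiff x y) f := by
  have hsymm : ∀ x y : L, (∃ f, HasWinding (pointDiff x y) f) →
      ∃ f, HasWinding (pointDiff y x) f := fun x y ⟨f, hf⟩ =>
    ⟨-f, by simpa only [pointDiff, neg_sub] using hf.neg⟩
  have : Std.Symm fun x y : L => ∃ f, HasWinding (pointDiff x y) f := ⟨hsymm⟩
  refine PreconnectedSpace.induction₂ (fun x y : L => ∃ f, HasWinding (pointDiff x y) f)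
    (fun x => (eventually_exists_hasWinding x).mono fun y => hsymm y x) ⟨?_⟩ x y
  rintro x y z ⟨f, hf⟩ ⟨f', hf'⟩
  exact ⟨f + f', by simpa only [pointDiff, sub_add_sub_cancel] using hf.add hf'⟩

end Winding

/-! ### Winding numbers on the blow-up -/

namespace HurwitzCovering

variable {L : Type*} [TopologicalSpace L] [ChartedSpace ℂ L] {m : ℕ} {n : Fin (m + 1) → ℕ}
  (C : HurwitzCovering L m n) (z : ℂ) {i : Fin (m + 1)}

/-- The map of the blow-up to the surface which collapses the boundary circles. -/
def collapse : C.Blow z → L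
  | .interior P => P
  | .boundary i _ => C.pole i

variable {z}

lemma collapse_collarMap (p : C.Collar z i) :
    C.collapse z (C.collarMap z i p) = C.collarPoint z p := by
  by_cases h : p.1.1 = 0
  · rw [C.collarMap_eq_boundary h, collapse, collarPoint, h, Complex.ofReal_zero, zero_mul,
      ← C.coord_pole i, (C.coord i).left_inv (C.pole_mem i)]
  · rw [collarMap, dif_neg h]
    rfl

variable (z) in
lemma continuous_collapse : Continuous (C.collapse z) := by
  refine continuous_def.2 fun O hO => (C.isOpen_blow_iff z).2 ⟨?_, fun i => ?_⟩
  · exact hO.preimage continuous_subtype_val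
  · have hcomp : C.collapse z ∘ C.collarMap z i = C.collarPoint z :=
      funext C.collapse_collarMap
    rw [← preimage_comp, hcomp]
    exact hO.preimage C.continuous_collarPoint

variable (z) in
/-- The collapse of the boundary circles as a continuous map. -/
def collapseMap : C(C.Blow z, L) := ⟨C.collapse z, C.continuous_collapse z⟩

lemma isOpen_arcs (i : Fin (m + 1)) : IsOpen (C.arcs z i) :=
  isOpen_lt (by fun_prop (disch := simp)) continuous_const

lemma eventually_nhds_interior_iff [T2Space L] {P : C.Punctured} {p : C.Blow z → Prop} :
    (∀ᶠ x in 𝓝 (Blow.interior P), p x) ↔ ∀ᶠ Q : C.Punctured in 𝓝 P, p (.interior Q) := by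
  change (∀ᶠ x in 𝓝 (C.interiorIncl z P), p x) ↔ _
  rw [← C.isOpenEmbedding_interiorIncl.map_nhds_eq, eventually_map]
  rfl

lemma eventually_nhds_boundary (u : C.arcs z i) {p : L → Prop}
    (hp : ∀ᶠ x in 𝓝[≠] C.pole i, p x) : ∀ᶠ x in 𝓝 (Blow.boundary i u : C.Blow z),
      (∃ v, x = Blow.boundary i v) ∨ ∃ Q : C.Punctured, x = Blow.interior Q ∧
        (Q : L) ∈ (C.coord i).source ∧ (z * (C.coord i Q ^ (n i + 1))⁻¹).re < 0 ∧ p Q := by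
  have hopen := (C.isOpenEmbedding_collarIncl (z := z) (i := i)).isOpenMap _
    ((C.isOpen_arcs (z := z) i).preimage (f := fun p : C.Collar z i => p.1.2) (by fun_prop))
  have hmem : Blow.boundary i u ∈ C.collarIncl z i ''
      ((fun p : C.Collar z i => p.1.2) ⁻¹' C.arcs z i) :=
    ⟨⟨(0, u), le_rfl, C.radius_pos i, fun _ => u.2⟩, u.2, C.collarMap_eq_boundary rfl⟩
  filter_upwards [hopen.mem_nhds hmem, ((C.continuous_collapse z).continuousAt
    (x := Blow.boundary i u)).eventually (eventually_nhdsWithin_iff.1 hp)]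
  rintro _ ⟨q, hq, rfl⟩ hpq
  rcases hx : C.collarIncl z i q with Q | ⟨j, v⟩
  · obtain ⟨hq0, hqQ⟩ := C.collarMap_eq_interior_iff.1 hx
    rw [hx] at hpq
    refine .inr ⟨Q, rfl, hqQ ▸ C.collarPoint_mem_source q, ?_, hpq fun h => Q.2 ⟨i, h.symm⟩⟩
    have hpolar : z * (((q.1.1 : ℂ) * q.1.2) ^ (n i + 1))⁻¹ =
        (((q.1.1 ^ (n i + 1))⁻¹ : ℝ) : ℂ) * (z * ((q.1.2 : ℂ) ^ (n i + 1))⁻¹) := by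
      push_cast
      rw [mul_pow, mul_inv]
      ring
    rw [← hqQ, coord_collarPoint, hpolar, Complex.re_ofReal_mul]
    exact mul_neg_of_pos_of_neg (inv_pos.2 (pow_pos (lt_of_le_of_ne q.2.1 (Ne.symm hq0)) _)) hq
  · obtain ⟨-, rfl, -⟩ := C.collarMap_eq_boundary_iff.1 hx
    exact .inl ⟨v, rfl⟩

/-- A branch of the logarithm of `w`, up to a constant, over the directions with
`π/2 < arg (z w ^ -(d + 1)) < 3π/2`. -/
def arcLog (z : ℂ) (d : ℕ) (w : ℂ) : ℂ :=
  -(Complex.log (-(z * (w ^ (d + 1))⁻¹)) / (d + 1 : ℕ))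

lemma eventually_arcLog_sub_eq {d : ℕ} {w : ℂ} (hw : (z * (w ^ (d + 1))⁻¹).re < 0) :
    ∀ᶠ w' in 𝓝 w, arcLog z d w' - arcLog z d w = Complex.log (w' / w) := by
  have hw0 : w ≠ 0 := fun h => by simp [h] at hw
  have hz : z ≠ 0 := fun h => by simp [h] at hw
  have hslit : -(z * (w ^ (d + 1))⁻¹) ∈ Complex.slitPlane := .inl (by simpa using hw)
  have hcont : ContinuousAt (fun w' : ℂ => -(z * (w' ^ (d + 1))⁻¹)) w :=
    (continuousAt_const.mul ((continuousAt_id.pow _).inv₀ (pow_ne_zero _ hw0))).neg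
  have hpow := eventually_log_div_eq (d := -(d + 1 : ℕ)) (ℓ := fun _ => 0) hcont
    (Complex.slitPlane_ne_zero hslit) continuousAt_id hw0 continuousAt_const
    (.of_forall fun w' => by
      rw [sub_zero, Complex.exp_zero, mul_one, neg_div_neg_eq, mul_div_mul_left _ _ hz, zpow_neg,
        zpow_natCast, div_pow, id, id, inv_div_inv, inv_div])
  filter_upwards [hpow, eventually_log_div_eq_sub hcont hslit] with w' hpow' hsub
  have hd : ((d + 1 : ℕ) : ℂ) ≠ 0 := Nat.cast_ne_zero.2 d.succ_ne_zero
  rw [arcLog, arcLog, neg_sub_neg, ← sub_div, div_eq_iff hd, ← neg_sub, ← hsub, hpow']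
  push_cast
  simp only [id]
  ring

lemma exists_log_coord [IsManifold 𝓘(ℂ) ω L] {D : L → ℤ} {f : L → L → ℂ}
    (hf : HasWinding D f) (i : Fin (m + 1)) : ∃ g : L → ℂ, ∀ᶠ x in 𝓝[≠] C.pole i,
      ∀ᶠ x' in 𝓝 x, f x x' - f x x =
        D (C.pole i) * Complex.log (C.coord i x' / C.coord i x) + (g x' - g x) := by
  have horder := hasOrderAt_sub_self (C.coord_mem i) (C.pole_mem i)
  simp only [C.coord_pole, sub_zero] at horder
  obtain ⟨ℓ, -, hℓ⟩ := horder.exists_log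
  refine ⟨fun x => f (C.pole i) x - D (C.pole i) * ℓ x, ?_⟩
  filter_upwards [hf (C.pole i), hℓ] with x hx hℓx
  filter_upwards [hx, hℓx] with x' hx' hℓx'
  rw [hx', hℓx']
  push_cast
  ring

/-- The extension to the blow-up of a family of primitives with winding numbers `D`, with `g i` as
in `exists_log_coord`: over the arcs at `∞_i` the logarithm of the local parameter has a
single-valued branch. -/
def blowLog (D : L → ℤ) (f : L → L → ℂ) (g : Fin (m + 1) → L → ℂ) : C.Blow z → C.Blow z → ℂ
  | .interior P, .interior Q => f P Q
  | .boundary i _, .interior Q => D (C.pole i) * arcLog z (n i) (C.coord i Q) + g i Q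
  | _, .boundary _ _ => 0

lemma eventually_log_circle {ρ : ℝ} (h0 : 0 < ρ) (t : I) :
    ∀ᶠ t' : I in 𝓝 t, Complex.log ((ρ * Circle.exp (2 * Real.pi * t')) /
      (ρ * Circle.exp (2 * Real.pi * t))) = 2 * Real.pi * Complex.I * ((t' : ℝ) - (t : ℝ)) := by
  have hne : ∀ t : I, (ρ * Circle.exp (2 * Real.pi * t) : ℂ) ≠ 0 := fun t =>
    mul_ne_zero (Complex.ofReal_ne_zero.2 h0.ne') (Circle.coe_ne_zero _)
  refine eventually_eq_of_exp_eq (continuousAt_log_div_self (F := fun t : I =>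
    (ρ * Circle.exp (2 * Real.pi * t) : ℂ)) (by fun_prop) (hne t)) (by fun_prop)
    (.of_forall fun t' => ?_) (by simp)
  rw [Complex.exp_log (div_ne_zero (hne t') (hne t)),
    mul_div_mul_left _ _ (Complex.ofReal_ne_zero.2 h0.ne'), Circle.coe_exp, Circle.coe_exp,
    ← Complex.exp_sub]
  congr 1
  push_cast
  ring

lemma coord_polarPoint {ρ : ℝ} (h0 : 0 < ρ) (hr : ρ < C.radius i) (u : Circle) :
    C.coord i (C.polarPoint i ρ h0 hr u) = ρ * u := by
  refine (C.coord i).right_inv ?_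
  rwa [C.coord_target, mem_ball_zero_iff, norm_polar h0.le]

section Winding

variable {D : L → ℤ} {f : L → L → ℂ}

lemma isCoherent_blowLog [T2Space L] {g : Fin (m + 1) → L → ℂ}
    (hD : ∀ P ∉ range C.pole, D P = 0) (hf : HasWinding D f)
    (hg : ∀ i, ∀ᶠ x in 𝓝[≠] C.pole i, ∀ᶠ x' in 𝓝 x, f x x' - f x x =
      D (C.pole i) * Complex.log (C.coord i x' / C.coord i x) + (g i x' - g i x)) :
    IsCoherent (C.blowLog (z := z) D f g) := by
  rintro (P | ⟨i, u⟩)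
  · have hL : ∀ᶠ x in 𝓝 (P : L), ∀ᶠ x' in 𝓝 x, f P x' - f x x' = f P x - f x x := by
      filter_upwards [eventually_nhdsWithin_iff.1 (hf P)] with x hx
      rcases eq_or_ne x P with rfl | hxP
      · exact .of_forall fun x' => by simp only [sub_self]
      · filter_upwards [hx hxP] with x' hx'
        rw [hD P P.2, Int.cast_zero, zero_mul, zero_add] at hx'
        linear_combination -hx'
    refine C.eventually_nhds_interior_iff.2 ?_
    filter_upwards [continuous_subtype_val.continuousAt.eventually hL] with Q hQ
    exact C.eventually_nhds_interior_iff.2 (continuous_subtype_val.continuousAt.eventually hQ)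
  · filter_upwards [C.eventually_nhds_boundary u (hg i)]
    rintro _ (⟨v, rfl⟩ | ⟨Q, rfl, hQ, hre, hgQ⟩)
    · exact .of_forall fun x' => by rcases x' with _ | _ <;> simp [blowLog]
    · refine C.eventually_nhds_interior_iff.2 ?_
      have hlog := ((C.coord i).continuousAt hQ).eventually (eventually_arcLog_sub_eq hre)
      filter_upwards [continuous_subtype_val.continuousAt.eventually hlog,
        continuous_subtype_val.continuousAt.eventually hgQ] with Q' hlog' hgQ'
      simp only [blowLog]
      linear_combination (D (C.pole i) : ℂ) * hlog' - hgQ'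

lemma exists_isGlobalPrimitive_circleLoop {g : L → ℂ}
    (hg : ∀ᶠ x in 𝓝[≠] C.pole i, ∀ᶠ x' in 𝓝 x, f x x' - f x x =
      D (C.pole i) * Complex.log (C.coord i x' / C.coord i x) + (g x' - g x)) :
    ∃ ρ, ∃ (h0 : 0 < ρ) (hr : ρ < C.radius i), IsGlobalPrimitive
      (fun t t' => f (C.circleLoop i ρ h0 hr t) (C.circleLoop i ρ h0 hr t'))
      fun t => 2 * Real.pi * Complex.I * D (C.pole i) * (t : ℝ) +
        g (C.circleLoop i ρ h0 hr t) := by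
  have h0t : (0 : ℂ) ∈ (C.coord i).target :=
    C.coord_pole i ▸ (C.coord i).map_source (C.pole_mem i)
  have hcont := (C.coord i).continuousAt_symm h0t
  rw [ContinuousAt, ← C.coord_pole i, (C.coord i).left_inv (C.pole_mem i), C.coord_pole] at hcont
  obtain ⟨ε, hε, hball⟩ :=
    Metric.eventually_nhds_iff.1 (hcont.eventually (eventually_nhdsWithin_iff.1 hg))
  obtain ⟨ρ, h0, hlt⟩ := exists_between (lt_min hε (C.radius_pos i))
  have hr := hlt.trans_le (min_le_right _ _)
  refine ⟨ρ, h0, hr, fun t => ?_⟩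
  set γ := C.circleLoop i ρ h0 hr
  have hcoord : ∀ t, C.coord i (γ t) = ρ * Circle.exp (2 * Real.pi * (t : ℝ)) := fun t =>
    C.coord_polarPoint h0 hr _
  have hγ : ContinuousAt (fun t' => (γ t' : L)) t := by fun_prop
  have hlog := hball (y := ρ * Circle.exp (2 * Real.pi * (t : ℝ)))
    (by rw [dist_zero_right, norm_polar h0.le]; exact hlt.trans_le (min_le_left _ _))
    fun h => (γ t).2 ⟨i, h.symm⟩
  filter_upwards [hγ.eventually hlog, eventually_log_circle h0 t] with t' ht' hcircle
  have hf' : f (γ t) (γ t') - f (γ t) (γ t) = D (C.pole i) *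
      Complex.log (C.coord i (γ t') / C.coord i (γ t)) + (g (γ t') - g (γ t)) := ht'
  rw [hcoord, hcoord, hcircle] at hf'
  linear_combination -hf'

lemma exists_isPathCocycle_winding [T2Space L] [IsManifold 𝓘(ℂ) ω L]
    (hD : ∀ P ∉ range C.pole, D P = 0) (hf : HasWinding D f) :
    ∃ ψ : C(I, C.Blow z) → ℂ, IsPathCocycle ψ ∧ VanishesOn ψ (C.bdry z) ∧
      ∀ i ρ h0 hr, ψ ((C.interiorIncl z).comp (C.circleLoop i ρ h0 hr).toContinuousMap) =
        2 * Real.pi * Complex.I * D (C.pole i) := by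
  choose g hg using C.exists_log_coord hf
  obtain ⟨ψ, hψ, -, hval⟩ := (C.isCoherent_blowLog hD hf hg).exists_isPathCocycle
  refine ⟨ψ, hψ, fun γ hγ => ?_, fun i ρ h0 hr => ?_⟩
  · have hzero : ∀ t x, C.blowLog D f g x (γ t) = 0 := fun t x => by
      obtain ⟨i, u, hu⟩ := hγ t
      rw [hu]
      rcases x with _ | _ <;> rfl
    rw [hval γ 0 fun t => .of_forall fun t' => by simp only [hzero, Pi.zero_apply], Pi.zero_apply,
      Pi.zero_apply, sub_zero]
  · obtain ⟨_, c, -, -, hc⟩ := C.exists_residue (i := i) (hψ.comp (C.interiorIncl z))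
    obtain ⟨ρ', h0', hr', hprim⟩ := C.exists_isGlobalPrimitive_circleLoop (hg i)
    refine (hc ρ h0 hr).trans ((hc ρ' h0' hr').symm.trans ((hval ((C.interiorIncl z).comp
      (C.circleLoop i ρ' h0' hr').toContinuousMap) _ hprim).trans ?_))
    rw [Path.source, Path.target]
    simp

end Winding

end HurwitzCovering

/-! ### The contours are independent -/

namespace HurwitzCovering

variable {L M : Type*} [TopologicalSpace L] [ChartedSpace ℂ L] {m : ℕ} {n : Fin (m + 1) → ℕ}
  {C : HurwitzCovering L m n} {z : ℂ} {g : ℕ}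

lemma circleLoop_eq_zero_of_surface [AddCommGroup M] {ψ : C(I, L) → M} (hψ : IsPathCocycle ψ)
    {i : Fin (m + 1)} {ρ : ℝ} (h0 : 0 < ρ) (hr : ρ < C.radius i) :
    ψ (C.puncturedIncl.comp (C.circleLoop i ρ h0 hr).toContinuousMap) = 0 := by
  obtain ⟨k, hk⟩ := hψ.exists_isPrimitiveAlong_of_convex (K := (C.coord i).target)
    (C.coord_target i ▸ convex_ball _ _) (C.coord i).continuousOn_symm
  rw [hk ⟨fun t => ρ * (Circle.exp (2 * Real.pi * (t : ℝ)) : ℂ), by fun_prop⟩ _ (fun t => ?_)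
    fun t => rfl]
  · simp [increment]
  · rw [C.coord_target, mem_ball_zero_iff]
    exact (norm_polar h0.le _).trans_lt hr

lemma vanishesOn_comp_collapse [AddCommGroup M] {ψ : C(I, L) → M} (hψ : IsPathCocycle ψ) :
    VanishesOn (fun γ => ψ ((C.collapseMap z).comp γ)) (C.bdry z) := fun γ hγ => by
  have hconst : (C.collapseMap z).comp γ = ContinuousMap.const _ (C.collapse z (γ 0)) := by
    ext t
    have hpole := C.arcFunction_path_eq (fun i _ => i) hγ t 0
    obtain ⟨i, u, hu⟩ := hγ t
    obtain ⟨j, v, hv⟩ := hγ 0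
    rw [hu, hv] at hpole
    change C.collapse z (γ t) = C.collapse z (γ 0)
    rw [hu, hv]
    exact congrArg C.pole hpole
  exact (congrArg ψ hconst).trans (hψ.const_eq_zero _)

namespace ContourSystem

variable (S : C.ContourSystem g z)

lemma value_increment_ab [AddCommGroup M] (h : C.Blow z → M) (k : Fin g ⊕ Fin g) :
    S.value (increment h) (.inl k) = 0 := by
  rcases k with k | k
  · exact increment_loop h ((S.a k).map (C.continuous_interior z))
  · exact increment_loop h ((S.b k).map (C.continuous_interior z))

lemma value_increment_v [AddCommGroup M] (h : C.Blow z → M) (i : Fin m) :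
    S.value (increment h) (.inr (.inl i)) = 0 :=
  increment_loop h ((C.circleLoop i.succ _ _ _).map (C.continuous_interior z))

variable {c : ContourIndex g m n → ℂ}
  (hc : ∑ k, c k • S.contour k = 0)

include hc

lemma coeff_eq_zero {ψ : C(I, C.Blow z) → ℂ} (hψ : IsPathCocycle ψ)
    (hA : VanishesOn ψ (C.bdry z)) {k : ContourIndex g m n} (hk : S.value ψ k ≠ 0)
    (hne : ∀ k' ≠ k, c k' = 0 ∨ S.value ψ k' = 0) : c k = 0 := by
  have hψc := congrArg (homologyFunctional ℂ hψ hA) hc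
  simp only [map_sum, map_smul, map_zero, S.homologyFunctional_contour, smul_eq_mul] at hψc
  rw [Finset.sum_eq_single k (fun k' _ hk' => mul_eq_zero.2 (hne k' hk')) (by simp)] at hψc
  exact (mul_eq_zero.1 hψc).resolve_right hk

open scoped Classical in
lemma coeff_t (i : Fin (m + 1)) (α : Fin (n i)) : c (.inr (.inr (.inr ⟨i, α⟩))) = 0 := by
  let F (j : Fin (m + 1)) (a : ZMod (n j + 1)) : ℂ :=
    if j = i ∧ (α : ℕ) < (a - S.firstSheet j).val then 1 else 0
  have hF : ∀ j (b : ℕ), b ≤ n j → F j (S.firstSheet j + b) = if j = i ∧ α < b then 1 else 0 :=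
    fun j b hb => by simp only [F, add_sub_cancel_left, ZMod.val_cast_of_lt (Nat.lt_succ_iff.2 hb)]
  have ht : ∀ j (β : Fin (n j)), increment (C.arcFunction F) (S.tPath j β) =
      (if j = i ∧ (α : ℕ) < β + 1 then 1 else 0) - if j = i ∧ (α : ℕ) < β then 1 else 0 := by
    intro j β
    rw [S.increment_tPath (F := F) fun _ _ => rfl, add_assoc, ← Nat.cast_succ, hF j _ β.2,
      hF j _ β.2.le]
  refine S.coeff_eq_zero hc (isPathCocycle_increment _) (C.vanishesOn_increment_arcFunction F)
    (ne_of_eq_of_ne (ht i α) (by simp)) fun k hk => .inr ?_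
  rcases k with k | j | j | ⟨j, β⟩
  · exact S.value_increment_ab _ k
  · exact S.value_increment_v _ j
  · have hF₀ : ∀ j, F j (S.firstSheet j) = 0 := fun j => by simp [F]
    exact (S.increment_w (F := F) (fun _ _ => rfl) j).trans (by rw [hF₀, hF₀, sub_zero])
  · refine (ht j β).trans ?_
    by_cases hj : j = i
    · subst hj
      have hβ : (α : ℕ) ≠ β := fun h => hk (by rw [Fin.ext h])
      simp only [Nat.lt_succ_iff_lt_or_eq, hβ, or_false, sub_self]
    · simp only [hj, false_and, if_false, sub_self]

lemma coeff_w (j : Fin m) : c (.inr (.inr (.inl j))) = 0 := by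
  let F (i : Fin (m + 1)) (_ : ZMod (n i + 1)) : ℂ := if i = j.succ then 1 else 0
  have hw : ∀ j', increment (C.arcFunction F) (S.w j').toContinuousMap =
      if j' = j then 1 else 0 := fun j' => by
    rw [S.increment_w (F := F) fun _ _ => rfl]
    simp [F, (Fin.succ_ne_zero j).symm]
  refine S.coeff_eq_zero hc (isPathCocycle_increment _) (C.vanishesOn_increment_arcFunction F)
    (ne_of_eq_of_ne (hw j) (by simp)) fun k hk => .inr ?_
  rcases k with k | j' | j' | ⟨i, α⟩
  · exact S.value_increment_ab _ k
  · exact S.value_increment_v _ j'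
  · exact (hw j').trans (if_neg fun h => hk (by rw [h]))
  · exact (S.increment_tPath (F := F) (fun _ _ => rfl) i α).trans (sub_self _)

lemma coeff_ab [ConnectedSpace L] (k : Fin g ⊕ Fin g) : c (.inl k) = 0 := by
  have := ChartedSpace.locallyPathConnectedSpace ℂ L
  have : PathConnectedSpace L := pathConnectedSpace_iff_connectedSpace.2 inferInstance
  obtain ⟨B, hB⟩ := S.homologyBasis
  obtain ⟨ψ, hψ, hval⟩ := exists_isPathCocycle_eq_on_loops
    ((Int.castAddHom ℂ).toIntLinearMap.comp (B.coord k))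
  have hab : ∀ k', S.value (fun γ => ψ ((C.collapseMap z).comp γ)) (.inl k') =
      if k' = k then 1 else 0 := by
    intro k'
    have hcoord : S.value (fun γ => ψ ((C.collapseMap z).comp γ)) (.inl k') =
        (Int.castAddHom ℂ).toIntLinearMap (B.coord k (B k')) := by
      rw [hB]
      rcases k' with k' | k'
      · exact hval _ ((S.a k').map continuous_subtype_val)
      · exact hval _ ((S.b k').map continuous_subtype_val)
    rw [hcoord]
    simp [Finsupp.single_apply]
  refine S.coeff_eq_zero hc (hψ.comp (C.collapseMap z)) (vanishesOn_comp_collapse hψ)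
    (ne_of_eq_of_ne (hab k) (by simp)) fun k' hk' => ?_
  rcases k' with k' | i | i | ⟨i, α⟩
  · exact .inr ((hab k').trans (if_neg fun h => hk' (by rw [h])))
  · exact .inr (circleLoop_eq_zero_of_surface hψ (S.vRadius_pos i) (S.vRadius_lt i))
  · exact .inl (S.coeff_w hc i)
  · exact .inl (S.coeff_t hc i α)

lemma coeff_v [T2Space L] [ConnectedSpace L] [IsManifold 𝓘(ℂ) ω L] (i : Fin m) :
    c (.inr (.inl i)) = 0 := by
  obtain ⟨f, hf⟩ := exists_hasWinding_pointDiff (C.pole i.succ) (C.pole 0)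
  have hD : ∀ P ∉ range C.pole, pointDiff (C.pole i.succ) (C.pole 0) P = 0 := fun P hP => by
    have hne : ∀ j, P ≠ C.pole j := fun j h => hP ⟨j, h.symm⟩
    simp [pointDiff, hne]
  obtain ⟨ψ, hψ, hA, hval⟩ := C.exists_isPathCocycle_winding (z := z) hD hf
  have hv : ∀ j, S.value ψ (.inr (.inl j)) = 2 * Real.pi * Complex.I * if j = i then 1 else 0 := by
    intro j
    refine (hval _ _ (S.vRadius_pos j) (S.vRadius_lt j)).trans ?_
    simp [pointDiff, Pi.single_apply, C.pole_injective.eq_iff]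
  refine S.coeff_eq_zero hc hψ hA (ne_of_eq_of_ne (hv i) (by simp)) fun k hk => ?_
  rcases k with k | j | j | ⟨j, α⟩
  · exact .inl (S.coeff_ab hc k)
  · exact .inr ((hv j).trans (by rw [if_neg fun h => hk (by rw [h]), mul_zero]))
  · exact .inl (S.coeff_w hc j)
  · exact .inl (S.coeff_t hc j α)

omit hc in
lemma linearIndependent [T2Space L] [ConnectedSpace L] [IsManifold 𝓘(ℂ) ω L] :
    LinearIndependent ℂ S.contour := by
  rw [Fintype.linearIndependent_iff]
  rintro c hc (k | j | j | ⟨j, α⟩)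
  · exact S.coeff_ab hc k
  · exact S.coeff_v hc j
  · exact S.coeff_w hc j
  · exact S.coeff_t hc j α

end ContourSystem

end HurwitzCovering

end

theorem mainTheorem12 {L : Type*} [TopologicalSpace L] [T2Space L] [CompactSpace L]
    [ConnectedSpace L] [ChartedSpace ℂ L] [IsManifold 𝓘(ℂ) ω L]
    {g m : ℕ} {n : Fin (m + 1) → ℕ} (C : HurwitzCovering L m n) (z : ℂ) (hz : z ≠ 0)
    (S : C.ContourSystem g z) :
    ∃ B : Module.Basis (ContourIndex g m n) ℂ (C.LambdaStar z), ⇑B = S.contour :=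
  ⟨.mk S.linearIndependent (S.span_range_contour hz).ge, Module.Basis.coe_mk _ _⟩
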